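/- **Setting.** An *arena* $A$ is a set $M_A$ of moves, each owned by $\mathsf O$ or $\mathsf P$ and being a question or an answer, with an enabling relation $\vdash_A\subseteq (M_A+\{\ast\})\times M_A$ such that: an initial move ($\ast\vdash m$) is an $\mathsf O$-question enabled only by $\ast$; answers are enabled only by questions; if $m\vdash n$ with $m\neq\ast$ then $m,n$ have different owners. A *justified sequence* is a finite sequence of moves in which each occurrence is either initial and without pointer, or points to an earlier occurrence (its justifier) of a move enabling it. The $\mathsf P$-view is given by $\ulcorner\epsilon\urcorner=\epsilon$, $\ulcorner sp\urcorner=\ulcorner s\urcorner p$ ($p$ a $\mathsf P$-move), $\ulcorner si\urcorner=i$ ($i$ initial), $\ulcorner s\,p\,t\,o\urcorner=\ulcorner s\urcorner p\,o$ ($o$ an $\mathsf O$-move justified by $p$); the $\mathsf O$-view by $\llcorner\epsilon\lrcorner=\epsilon$, $\llcorner so\lrcorner=\llcorner s\lrcorner o$, $\llcorner s\,o\,t\,p\lrcorner=\llcorner s\lrcorner o\,p$ ($p$ justified by $o$). Views carry their pointers, and equality of views includes equality of pointers. A justified sequence is *legal* if the owners alternate and each non-initial $\mathsf P$-move (resp.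 $\mathsf O$-move) is justified inside the $\mathsf P$-view (resp. $\mathsf O$-view) of what precedes it; it is *well-bracketed* if each answer is justified by the last question not yet answered; it is *complete* if every question in it is answered; it is *single-threaded* if it has exactly one initial occurrence. The *thread* of an initial occurrence consists of the occurrences hereditarily justified by it. A *game* $A$ is an arena with a non-empty prefix-closed set $P_A$ of well-bracketed legal sequences, its *plays*. A *strategy* $\sigma:A$ is a set of even-length plays that contains $\epsilon$, is closed under even-length prefixes, and satisfies $sab,sac\in\sigma\Rightarrow b=c$. It is *innocent* if $sab\in\sigma$, $t\in\sigma$, $ta\in P_A$ and $\ulcorner sa\urcorner=\ulcorner ta\urcorner$ imply $tab\in\sigma$ (with the same justifier of $b$ in the view). Let $\Sigma$ be the game with an initial $\mathsf O$-question $q$ enabling one $\mathsf P$-answer $a$, and plays $\epsilon,q,qa$; let $\top=\{\epsilon,qa\}$. The arena of $A\to\Sigma$ is the disjoint union of both arenas, with owners exchanged in $A$ and the initial moves of $A$ enabled by $q$ instead of $\ast$; its plays are the well-bracketed legal sequences whose restriction to $\Sigma$ is a play of $\Sigma$ and for which every thread of the restriction to $A$ is a play of $A$. For $\sigma:A$ and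 $\alpha:A\to\Sigma$ let $\sigma;\alpha$ be the set of the restrictions to $\Sigma$ of those $u\in\alpha$ for which every thread of $u{\restriction}A$ is in $\sigma$. For innocent $\sigma,\tau:A$ write $\sigma\le_{ib}\tau$ if for every innocent $\alpha:A\to\Sigma$, $\sigma;\alpha=\top$ implies $\tau;\alpha=\top$. A play $s$ is *$\mathsf O$-innocent* if for all prefixes $s_1o_1,s_2o_2\sqsubseteq s$ ending in $\mathsf O$-moves, $\llcorner s_1\lrcorner=\llcorner s_2\lrcorner$ implies $o_1=o_2$ (with the same justifier in the view). Put $\mathsf{ovw}(s)=\{\llcorner t\lrcorner: t\sqsubseteq s\}$ and $$\mathsf{obs}(\sigma)=\{\mathsf{ovw}(s): s\in\sigma \text{ complete, } \mathsf O\text{-innocent and single-threaded}\}.$$ For sets $\mathcal S,\mathcal T$ of sets of $\mathsf O$-views write $\mathcal S\le_{os}\mathcal T$ if for every $S\in\mathcal S$ there is $T\in\mathcal T$ with $T\subseteq S$. **Proposition.** Let $A$ be a game in which answers enable no moves, and in which the moves available to $\mathsf O$ depend only on the $\mathsf O$-view: whenever $so$ and $t$ are single-threaded plays of $A$, $o$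 is an $\mathsf O$-move and $\llcorner s\lrcorner=\llcorner t\lrcorner$, then $to$ (with the same justifier of $o$ in the view) is a play of $A$. (For example, $P_A$ may consist of all well-bracketed legal sequences.) Let $\sigma,\tau$ be innocent strategies on $A$. Then $$\sigma\le_{ib}\tau\iff \mathsf{obs}(\sigma)\le_{os}\mathsf{obs}(\tau).$$ -/

import Mathlib

universe u v

/-- The two participants of a play: Opponent and Player. -/
inductive Player
  | O
  | P
  deriving DecidableEq

/-- Exchange of roles. -/
def Player.swap : Player → Player
  | .O => .P
  | .P => .O

/-- Moves are questions or answers. -/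
inductive Kind
  | question
  | answer
  deriving DecidableEq

/-- An arena: labelled moves with an enabling relation. `initial m` stands for `⋆ ⊢ m`. -/
structure Arena where
  Move : Type u
  player : Move → Player
  kind : Move → Kind
  initial : Move → Prop
  enables : Move → Move → Prop
  initial_opponent : ∀ m, initial m → player m = Player.O
  initial_question : ∀ m, initial m → kind m = Kind.question
  initial_not_enabled : ∀ m n, initial n → ¬ enables m n
  answer_enabled : ∀ m n, enables m n → kind n = Kind.answer → kind m = Kind.question
  enables_alternate : ∀ m n, enables m n → player m ≠ player n

/-- A sequence of moves with justification pointers: the second component of an entry is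
the position (counted from `0`) of its justifier, or `none` if it has no pointer. -/
abbrev JSeq (M : Type u) : Type u := List (M × Option ℕ)

namespace JSeq

/-- The subsequence at the positions listed (in increasing order) in `K`. Pointers to retained
positions are kept (and renumbered), pointers to deleted positions are dropped. -/
def sub {M : Type u} (s : JSeq M) (K : List ℕ) : JSeq M :=
  K.filterMap fun i => (s[i]?).map fun x => (x.1, x.2.bind fun j => K.idxOf? j)

/-- The position at which the chain of pointers starting at position `n` ends. -/
def root {M : Type u} (s : JSeq M) (n : ℕ) : ℕ :=
  match (s[n]?).bind Prod.snd with
  | none => n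
  | some j => if _h : j < n then root s j else n
termination_by n

/-- The thread of the occurrence at position `i`: the subsequence of all occurrences hereditarily
justified by it. (If no chain of pointers ends at `i`, this is the empty sequence.) -/
def thread {M : Type u} (s : JSeq M) (i : ℕ) : JSeq M :=
  s.sub ((List.range s.length).filter fun n => root s n = i)

/-- Restriction to the left component of a disjoint union of sets of moves. -/
def left {M : Type u} {N : Type v} (s : JSeq (M ⊕ N)) : JSeq M :=
  (s.sub ((List.range s.length).filter fun n => ((s[n]?).any fun x => x.1.isLeft))).filterMap
    fun x => x.1.getLeft?.map fun m => (m, x.2)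

/-- Restriction to the right component of a disjoint union of sets of moves. -/
def right {M : Type u} {N : Type v} (s : JSeq (M ⊕ N)) : JSeq N :=
  (s.sub ((List.range s.length).filter fun n => ((s[n]?).any fun x => x.1.isRight))).filterMap
    fun x => x.1.getRight?.map fun m => (m, x.2)

/-- Exactly one occurrence has no justifier, i.e. (in a justified sequence) is initial. -/
def SingleThreaded {M : Type u} (s : JSeq M) : Prop :=
  ∃! i : ℕ, ∃ m : M, s[i]? = some (m, none)

end JSeq

namespace Arena

/-- The positions that make up the `X`-view of the prefix of length `n` of `s`. For `X = P`:
a P-move extends the view, an initial O-move restarts it, and any other O-move with justifier at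
position `j` gives the view of the part before `j`, followed by `j` and the O-move. For `X = O`:
an O-move extends the view, and a P-move with justifier at `j` gives the view of
the part before `j`, followed by `j` and the P-move. -/
def viewPos (A : Arena.{u}) (X : Player) (s : JSeq A.Move) : ℕ → List ℕ
  | 0 => []
  | n + 1 =>
    match s[n]? with
    | none => []
    | some (m, p) =>
      if A.player m = X then viewPos A X s n ++ [n]
      else match p with
        | none => [n]
        | some j => if _h : j < n then viewPos A X s j ++ [j, n] else [n]
termination_by n => n

/-- The `X`-view, as a sequence with pointers. -/
def view (A : Arena.{u}) (X : Player) (s : JSeq A.Move) : JSeq A.Move :=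
  s.sub (A.viewPos X s s.length)

/-- Occurrences without pointer are initial moves, and all others point to an earlier
occurrence of a move that enables them. -/
def Justified (A : Arena.{u}) (s : JSeq A.Move) : Prop :=
  (∀ (i : ℕ) (m : A.Move), s[i]? = some (m, none) → A.initial m) ∧
  ∀ (i : ℕ) (m : A.Move) (j : ℕ), s[i]? = some (m, some j) →
    j < i ∧ ∃ x : A.Move × Option ℕ, s[j]? = some x ∧ A.enables x.1 m

/-- Opponent and Player move alternately. -/
def Alternating (A : Arena.{u}) (s : JSeq A.Move) : Prop :=
  ∀ (i : ℕ) (x y : A.Move × Option ℕ), s[i]? = some x → s[i + 1]? = some y → A.player x.1 ≠ A.player y.1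

/-- Every justifier lies in the view, at that moment, of the participant who moves. -/
def Visible (A : Arena.{u}) (s : JSeq A.Move) : Prop :=
  ∀ (i : ℕ) (m : A.Move) (j : ℕ), s[i]? = some (m, some j) → j ∈ A.viewPos (A.player m) s i

/-- Legal sequences. -/
structure Legal (A : Arena.{u}) (s : JSeq A.Move) : Prop where
  justified : A.Justified s
  alternating : A.Alternating s
  visible : A.Visible s

/-- Position `i` carries a question. -/
def IsQuestionAt (A : Arena.{u}) (s : JSeq A.Move) (i : ℕ) : Prop :=
  ∃ x : A.Move × Option ℕ, s[i]? = some x ∧ A.kind x.1 = Kind.question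

/-- The occurrence at position `i` is answered before position `n`. -/
def AnsweredBefore (A : Arena.{u}) (s : JSeq A.Move) (i n : ℕ) : Prop :=
  ∃ k < n, ∃ m : A.Move, s[k]? = some (m, some i) ∧ A.kind m = Kind.answer

/-- Every answer answers the pending question, i.e. the last question that has not yet been
answered. -/
def WellBracketed (A : Arena.{u}) (s : JSeq A.Move) : Prop :=
  ∀ (n : ℕ) (m : A.Move) (j : ℕ), s[n]? = some (m, some j) → A.kind m = Kind.answer →
    ¬ A.AnsweredBefore s j n ∧
    ∀ i, j < i → i < n → A.IsQuestionAt s i → A.AnsweredBefore s i n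

/-- Every question has been answered. -/
def Complete (A : Arena.{u}) (s : JSeq A.Move) : Prop :=
  ∀ i, A.IsQuestionAt s i → A.AnsweredBefore s i s.length

/-- O-innocence: O-moves of `s` made in the same O-view are the same (with the same justifier
in that view). -/
def OInnocent (A : Arena.{u}) (s : JSeq A.Move) : Prop :=
  ∀ (s₁ s₂ : JSeq A.Move) (x₁ x₂ : A.Move × Option ℕ),
    s₁ ++ [x₁] <+: s → s₂ ++ [x₂] <+: s →
    A.player x₁.1 = Player.O → A.player x₂.1 = Player.O →
    A.view Player.O s₁ = A.view Player.O s₂ →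
    A.view Player.O (s₁ ++ [x₁]) = A.view Player.O (s₂ ++ [x₂])

/-- The set of O-views of the prefixes of `s`. -/
def ovw (A : Arena.{u}) (s : JSeq A.Move) : Set (JSeq A.Move) :=
  {v | ∃ t : JSeq A.Move, t <+: s ∧ v = A.view Player.O t}

/-- The arena of the function space: the roles in `A` are exchanged, and initial moves of `A`
are enabled by initial moves of `B`. -/
abbrev arrow (A : Arena.{u}) (B : Arena.{v}) : Arena.{max u v} where
  Move := A.Move ⊕ B.Move
  player := Sum.elim (fun a => (A.player a).swap) B.player
  kind := Sum.elim A.kind B.kind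
  initial := Sum.elim (fun _ => False) B.initial
  enables
    | .inl a, .inl a' => A.enables a a'
    | .inr b, .inr b' => B.enables b b'
    | .inr b, .inl a => B.initial b ∧ A.initial a
    | .inl _, .inr _ => False
  initial_opponent := by
    rintro (a | b) h
    · exact h.elim
    · exact B.initial_opponent b h
  initial_question := by
    rintro (a | b) h
    · exact h.elim
    · exact B.initial_question b h
  initial_not_enabled := by
    rintro (a | b) (a' | b') h h'
    · exact h
    · exact h'
    · exact h
    · exact B.initial_not_enabled b b' h h'
  answer_enabled := by
    rintro (a | b) (a' | b') h h'
    · exact A.answer_enabled a a' h h'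
    · exact h.elim
    · exact B.initial_question b h.1
    · exact B.answer_enabled b b' h h'
  enables_alternate := by
    rintro (a | b) (a' | b') h
    · have := A.enables_alternate a a' h
      simp only [Sum.elim_inl]
      cases h1 : A.player a <;> cases h2 : A.player a' <;> simp_all [Player.swap]
    · exact h.elim
    · simp [B.initial_opponent b h.1, A.initial_opponent a' h.2, Player.swap]
    · exact B.enables_alternate b b' h

end Arena

/-- A game: an arena with a non-empty prefix-closed set of (well-bracketed, legal) plays. -/
structure Game extends Arena.{u} where
  plays : Set (JSeq Move)
  nil_mem : [] ∈ plays
  prefix_mem : ∀ s x, s ++ [x] ∈ plays → s ∈ plays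
  legal : ∀ s ∈ plays, toArena.Legal s
  wellBracketed : ∀ s ∈ plays, toArena.WellBracketed s

/-- A strategy: a non-empty set of even-length plays, closed under even-length prefixes,
and deterministic. -/
structure Strategy (G : Game.{u}) where
  carrier : Set (JSeq G.Move)
  subset_plays : carrier ⊆ G.plays
  even : ∀ s ∈ carrier, Even s.length
  nil_mem : [] ∈ carrier
  prefix_mem : ∀ s a b, s ++ [a, b] ∈ carrier → s ∈ carrier
  deterministic : ∀ s a b c, s ++ [a, b] ∈ carrier → s ++ [a, c] ∈ carrier → b = c

/-- Innocence: if `sab` and `t` are in the strategy, `ta'` is a play, and `sa`, `ta'` have the same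
P-view, then the strategy answers `ta'` by the same move, with the same justifier in
the view. -/
def Strategy.Innocent {G : Game.{u}} (σ : Strategy G) : Prop :=
  ∀ (s t : JSeq G.Move) (a a' b : G.Move × Option ℕ),
    s ++ [a, b] ∈ σ.carrier → t ∈ σ.carrier → t ++ [a'] ∈ G.plays →
    G.view Player.P (s ++ [a]) = G.view Player.P (t ++ [a']) →
    ∃ b', t ++ [a', b'] ∈ σ.carrier ∧
      G.view Player.P (s ++ [a, b]) = G.view Player.P (t ++ [a', b'])

namespace JSeq

theorem sub_snoc {M : Type u} (s : JSeq M) (x : M × Option ℕ) (K : List ℕ)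
    (hK : ∀ i ∈ K, i < s.length)
    (hs : ∀ (i : ℕ) (m : M) (j : ℕ), s[i]? = some (m, some j) → j < i) :
    sub (s ++ [x]) K = sub s K ∧
    sub (s ++ [x]) (K ++ [s.length]) = sub s K ++ [(x.1, x.2.bind fun j =>
      (K ++ [s.length]).idxOf? j)] := by
  have h0 : ∀ i ∈ K, (s ++ [x])[i]? = s[i]? := fun i hi =>
    List.getElem?_append_left (hK i hi)
  constructor
  · refine List.filterMap_congr fun i hi => ?_
    rw [h0 i hi]
  · unfold sub
    rw [List.filterMap_append]
    congr 1
    · refine List.filterMap_congr fun i hi => ?_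
      rw [h0 i hi]
      rcases h : s[i]? with _ | ⟨m, _ | j⟩
      · rfl
      · rfl
      · have h1 := hs i m j h
        have h2 := hK i hi
        have h3 : s.length ≠ j := by omega
        simp [List.idxOf?, h3]
    · simp

theorem sub_filter_snoc {M : Type u} (s : JSeq M) (x : M × Option ℕ) (p q : ℕ → Bool)
    (hpq : ∀ i < s.length, p i = q i)
    (hs : ∀ (i : ℕ) (m : M) (j : ℕ), (s ++ [x])[i]? = some (m, some j) → j < i) :
    sub (s ++ [x]) ((List.range (s ++ [x]).length).filter p) =
      sub s ((List.range s.length).filter q) ++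
      if p s.length then [(x.1, x.2.bind fun j => ((List.range s.length).filter q).idxOf? j)]
      else [] := by
  have e : (List.range s.length).filter p = (List.range s.length).filter q :=
    List.filter_congr fun i hi => hpq i (List.mem_range.1 hi)
  have hs' : ∀ (i : ℕ) (m : M) (j : ℕ), s[i]? = some (m, some j) → j < i := by
    intro i m j h
    refine hs i m j ?_
    rw [List.getElem?_append_left (List.getElem?_eq_some_iff.1 h).1, h]
  have hK : ∀ i ∈ (List.range s.length).filter q, i < s.length := fun i hi =>
    List.mem_range.1 (List.mem_filter.1 hi).1
  have key := sub_snoc s x _ hK hs'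
  rw [List.length_append, List.length_singleton, List.range_succ, List.filter_append, e]
  cases h : p s.length
  · simp [h, key.1]
  · simp only [List.filter_cons, h, List.filter_nil, if_true, key.2]
    congr 2
    rcases x with ⟨m, _ | j⟩
    · rfl
    · have h1 : j < s.length := hs s.length m j (by simp)
      have h3 : s.length ≠ j := by omega
      simp [List.idxOf?, h3]

theorem root_snoc {M : Type u} (s : JSeq M) (x : M × Option ℕ) (n : ℕ) (hn : n < s.length) :
    root (s ++ [x]) n = root s n := by
  induction n using Nat.strong_induction_on with
  | _ n ih =>
    rw [root, root, List.getElem?_append_left hn]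
    rcases (s[n]?).bind Prod.snd with _ | j
    · rfl
    · by_cases h : j < n
      · simp only [h, dif_pos]
        exact ih j h (h.trans hn)
      · simp only [h, dif_neg, not_false_eq_true]

/-- Every pointer points to an earlier position. -/
def Backward {M : Type u} (s : JSeq M) : Prop :=
  ∀ (i : ℕ) (m : M) (j : ℕ), s[i]? = some (m, some j) → j < i

theorem Backward.init {M : Type u} {s : JSeq M} {x : M × Option ℕ} (h : Backward (s ++ [x])) :
    Backward s := by
  intro i m j hi
  refine h i m j ?_
  rw [List.getElem?_append_left (List.getElem?_eq_some_iff.1 hi).1, hi]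

theorem Backward.snoc {M : Type u} {s : JSeq M} {x : M × Option ℕ} (h : Backward s)
    (hx : ∀ j, x.2 = some j → j < s.length) : Backward (s ++ [x]) := by
  intro i m j hi
  rcases Nat.lt_trichotomy i s.length with h1 | h1 | h1
  · rw [List.getElem?_append_left h1] at hi
    exact h i m j hi
  · subst h1
    simp at hi
    exact hx j (by rw [hi])
  · rw [List.getElem?_eq_none (by simp; omega)] at hi
    cases hi

theorem thread_snoc {M : Type u} (s : JSeq M) (x : M × Option ℕ) (h : Backward (s ++ [x]))
    (i : ℕ) : ∃ l : JSeq M, l.length ≤ 1 ∧ thread (s ++ [x]) i = thread s i ++ l := by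
  refine ⟨_, ?_, sub_filter_snoc s x _ _ (fun n hn => ?_) h⟩
  · split <;> simp
  · simp only [root_snoc s x n hn]

theorem left_snoc {M : Type u} {N : Type v} (s : JSeq (M ⊕ N)) (x : (M ⊕ N) × Option ℕ)
    (h : Backward (s ++ [x])) :
    ∃ l : JSeq M, l.length ≤ 1 ∧ left (s ++ [x]) = left s ++ l := by
  have := sub_filter_snoc s x (fun n => (((s ++ [x])[n]?).any fun x => x.1.isLeft))
    (fun n => ((s[n]?).any fun x => x.1.isLeft))
    (fun n hn => by simp only [List.getElem?_append_left hn]) h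
  unfold left
  rw [this, List.filterMap_append]
  refine ⟨_, (List.length_filterMap_le _ _).trans ?_, rfl⟩
  split <;> simp

theorem right_snoc {M : Type u} {N : Type v} (s : JSeq (M ⊕ N)) (x : (M ⊕ N) × Option ℕ)
    (h : Backward (s ++ [x])) :
    ∃ l : JSeq N, l.length ≤ 1 ∧ right (s ++ [x]) = right s ++ l := by
  have := sub_filter_snoc s x (fun n => (((s ++ [x])[n]?).any fun x => x.1.isRight))
    (fun n => ((s[n]?).any fun x => x.1.isRight))
    (fun n hn => by simp only [List.getElem?_append_left hn]) h
  unfold right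
  rw [this, List.filterMap_append]
  refine ⟨_, (List.length_filterMap_le _ _).trans ?_, rfl⟩
  split <;> simp

theorem left_backward {M : Type u} {N : Type v} (s : JSeq (M ⊕ N)) (h : Backward s) :
    Backward (left s) ∧ (left s).length =
      ((List.range s.length).filter fun n => ((s[n]?).any fun x => x.1.isLeft)).length := by
  induction s using List.reverseRecOn with
  | nil =>
    constructor
    · intro i m j hi
      simp [left, sub] at hi
    · simp [left, sub]
  | append_singleton s x ih =>
    obtain ⟨ih1, ih2⟩ := ih h.init
    have hp : ∀ n < s.length, (((s ++ [x])[n]?).any fun x => x.1.isLeft) =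
        ((s[n]?).any fun x => x.1.isLeft) :=
      fun n hn => by simp only [List.getElem?_append_left hn]
    have e := sub_filter_snoc s x (fun n => (((s ++ [x])[n]?).any fun x => x.1.isLeft))
      (fun n => ((s[n]?).any fun x => x.1.isLeft)) hp h
    have e2 : (List.range s.length).filter (fun n => (((s ++ [x])[n]?).any fun x => x.1.isLeft))
        = (List.range s.length).filter (fun n => ((s[n]?).any fun x => x.1.isLeft)) :=
      List.filter_congr fun i hi => hp i (List.mem_range.1 hi)
    have e3 := congrArg (List.filterMap fun x : (M ⊕ N) × Option ℕ =>
      x.1.getLeft?.map fun m => (m, x.2)) e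
    rw [List.filterMap_append] at e3
    change left (s ++ [x]) = left s ++ _ at e3
    rw [e3, List.length_append (as := s), List.length_singleton, List.range_succ, List.filter_append, e2]
    rcases x with ⟨a | b, p⟩
    · simp only [List.getElem?_concat_length, Option.any_some, Sum.isLeft_inl, if_true,
        List.filterMap_cons, Sum.getLeft?_inl, Option.map_some, List.filterMap_nil,
        List.filter_cons, List.filter_nil]
      refine ⟨ih1.snoc fun j hj => ?_, ?_⟩
      · rcases p with _ | k
        · cases hj
        · rw [ih2]
          simp only [Option.bind_some] at hj
          exact List.findIdx?_eq_some_iff_getElem.1 hj |>.1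
      · simp [ih2]
    · simp [ih1, ih2]

end JSeq

theorem Arena.viewPos_snoc (A : Arena.{u}) (X : Player) (s : JSeq A.Move)
    (x : A.Move × Option ℕ) (n : ℕ) (hn : n ≤ s.length) :
    A.viewPos X (s ++ [x]) n = A.viewPos X s n := by
  induction n using Nat.strong_induction_on with
  | _ n ih =>
    rcases n with _ | n
    · rw [viewPos, viewPos]
    · rw [viewPos, viewPos, List.getElem?_append_left hn, ih n (by omega) (by omega)]
      rcases s[n]? with _ | ⟨m, _ | j⟩
      · rfl
      · rfl
      · by_cases h : j < n
        · simp only [h, dif_pos, ih j (by omega) (by omega)]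
        · simp only [h, dif_neg, not_false_eq_true]

theorem Arena.Legal.init {A : Arena.{u}} {s : JSeq A.Move} {x : A.Move × Option ℕ}
    (h : A.Legal (s ++ [x])) : A.Legal s := by
  have hl : ∀ {i : ℕ} {y : A.Move × Option ℕ}, s[i]? = some y → (s ++ [x])[i]? = some y :=
    fun {i y} hi => by
      rw [List.getElem?_append_left (List.getElem?_eq_some_iff.1 hi).1, hi]
  refine ⟨⟨fun i m hi => h.justified.1 i m (hl hi), fun i m j hi => ?_⟩,
    fun i y z hy hz => h.alternating i y z (hl hy) (hl hz), fun i m j hi => ?_⟩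
  · obtain ⟨h1, y, h2, h3⟩ := h.justified.2 i m j (hl hi)
    refine ⟨h1, y, ?_, h3⟩
    have := (List.getElem?_eq_some_iff.1 hi).1
    rwa [List.getElem?_append_left (by omega)] at h2
  · have := h.visible i m j (hl hi)
    rwa [A.viewPos_snoc _ _ _ _ (List.getElem?_eq_some_iff.1 hi).1.le] at this

theorem Arena.WellBracketed.init {A : Arena.{u}} {s : JSeq A.Move} {x : A.Move × Option ℕ}
    (h : A.WellBracketed (s ++ [x])) : A.WellBracketed s := by
  have hl : ∀ {i : ℕ} {y : A.Move × Option ℕ}, s[i]? = some y → (s ++ [x])[i]? = some y :=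
    fun {i y} hi => by
      rw [List.getElem?_append_left (List.getElem?_eq_some_iff.1 hi).1, hi]
  intro n m j hn ha
  have hlen := (List.getElem?_eq_some_iff.1 hn).1
  obtain ⟨h1, h2⟩ := h n m j (hl hn) ha
  refine ⟨fun ⟨k, hk, m', h3, h4⟩ => h1 ⟨k, hk, m', hl h3, h4⟩, fun i hji hin hq => ?_⟩
  obtain ⟨y, hy, hq⟩ := hq
  obtain ⟨k, hk, m', h3, h4⟩ := h2 i hji hin ⟨y, hl hy, hq⟩
  refine ⟨k, hk, m', ?_, h4⟩
  rwa [List.getElem?_append_left (by omega)] at h3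

namespace Game

theorem mem_of_append {G : Game.{u}} {s l : JSeq G.Move} (hl : l.length ≤ 1)
    (h : s ++ l ∈ G.plays) : s ∈ G.plays := by
  rcases l with _ | ⟨x, _ | ⟨y, l⟩⟩
  · simpa using h
  · exact G.prefix_mem s x h
  · simp at hl

/-- The function space `A ⇒ B` (that is, `!A ⊸ B`): its plays restrict on `B` to a play of `B`,
and each thread of their restriction to `A` is a play of `A`. -/
abbrev arrow (A : Game.{u}) (B : Game.{v}) : Game.{max u v} where
  toArena := A.toArena.arrow B.toArena
  plays := {s | (A.toArena.arrow B.toArena).Legal s ∧ (A.toArena.arrow B.toArena).WellBracketed s ∧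
    JSeq.right s ∈ B.plays ∧ ∀ i, (JSeq.left s).thread i ∈ A.plays}
  nil_mem := by
    refine ⟨⟨⟨?_, ?_⟩, ?_, ?_⟩, ?_, ?_, ?_⟩
    · intro i m h
      simp at h
    · intro i m j h
      simp at h
    · intro i x y h
      simp at h
    · intro i m j h
      simp at h
    · intro i m j h
      simp at h
    · exact B.nil_mem
    · intro i
      exact A.nil_mem
  prefix_mem := by
    rintro s x ⟨h1, h2, h3, h4⟩
    have hb : JSeq.Backward (s ++ [x]) := fun i m j hi => (h1.justified.2 i m j hi).1
    refine ⟨h1.init, h2.init, ?_, fun i => ?_⟩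
    · obtain ⟨l, hl, e⟩ := JSeq.right_snoc s x hb
      rw [e] at h3
      exact mem_of_append hl h3
    · obtain ⟨l, hl, e⟩ := JSeq.left_snoc s x hb
      have h5 := h4 i
      have hb' := (JSeq.left_backward _ hb).1
      rw [e] at h5 hb'
      rcases l with _ | ⟨y, _ | ⟨z, l⟩⟩
      · simpa using h5
      · obtain ⟨l', hl', e'⟩ := JSeq.thread_snoc _ y hb' i
        rw [e'] at h5
        exact mem_of_append hl' h5
      · simp at hl
  legal := fun _ h => h.1
  wellBracketed := fun _ h => h.2.1

end Game

/-- The two moves of the game `Σ`. -/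
inductive SigmaMove
  | q
  | a

/-- The arena of `Σ`: an initial O-question `q`, which enables a P-answer `a`. -/
abbrev sigmaArena : Arena.{0} where
  Move := SigmaMove
  player
    | .q => Player.O
    | .a => Player.P
  kind
    | .q => Kind.question
    | .a => Kind.answer
  initial m := m = .q
  enables m n := m = .q ∧ n = .a
  initial_opponent := by rintro m rfl; rfl
  initial_question := by rintro m rfl; rfl
  initial_not_enabled := by rintro m n rfl ⟨-, h⟩; cases h
  answer_enabled := by rintro m n ⟨rfl, rfl⟩ -; rfl
  enables_alternate := by rintro m n ⟨rfl, rfl⟩; simp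

/-- The play `qa` of `Σ`. -/
def sigmaQA : JSeq SigmaMove := [(.q, none), (.a, some 0)]

theorem sigmaQA_legal : sigmaArena.Legal sigmaQA ∧ sigmaArena.WellBracketed sigmaQA := by
  have h2 : ∀ n : ℕ, sigmaQA[n + 2]? = none := fun n => rfl
  refine ⟨⟨⟨?_, ?_⟩, ?_, ?_⟩, ?_⟩
  · rintro (_ | _ | i) m h
    · cases h; rfl
    · cases h
    · cases h
  · rintro (_ | _ | i) m j h
    · cases h
    · cases h
      exact ⟨by simp, _, rfl, rfl, rfl⟩
    · cases h
  · rintro (_ | _ | i) x y h h'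
    · cases h; cases h'
      simp
    · cases h'
    · cases h
  · rintro (_ | _ | i) m j h
    · cases h
    · cases h
      rw [Arena.viewPos.eq_def]
      simp [sigmaQA]
    · cases h
  · rintro (_ | _ | i) m j h ha
    · cases h
    · cases h
      refine ⟨?_, fun i h1 h2 => by omega⟩
      rintro ⟨k, hk, m, hm, -⟩
      obtain rfl : k = 0 := by omega
      cases hm
    · cases h

/-- The game `Σ`, with plays `ε`, `q` and `qa`. -/
abbrev sigmaGame : Game.{0} where
  toArena := sigmaArena
  plays := {s | s <+: sigmaQA}
  nil_mem := List.nil_prefix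
  prefix_mem := fun _ x h => (List.prefix_append _ [x]).trans h
  legal := by
    rintro s ⟨l, hl⟩
    have key : ∀ (l s : JSeq SigmaMove), sigmaArena.Legal (s ++ l) → sigmaArena.Legal s := by
      intro l
      induction l using List.reverseRecOn with
      | nil => intro s h; simpa using h
      | append_singleton l x ih =>
        intro s h
        rw [← List.append_assoc] at h
        exact ih s h.init
    exact key l s (hl ▸ sigmaQA_legal.1)
  wellBracketed := by
    rintro s ⟨l, hl⟩
    have key : ∀ (l s : JSeq SigmaMove), sigmaArena.WellBracketed (s ++ l) →
        sigmaArena.WellBracketed s := by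
      intro l
      induction l using List.reverseRecOn with
      | nil => intro s h; simpa using h
      | append_singleton l x ih =>
        intro s h
        rw [← List.append_assoc] at h
        exact ih s h.init
    exact key l s (hl ▸ sigmaQA_legal.2)

/-- The composite `σ;α` of a strategy `σ` on `A` with a strategy `α` on `A ⇒ B`, as a set of plays
of `B`: the restrictions to `B` of the plays of `α` that, in each thread of `A`,
follow `σ`. -/
def Strategy.comp {A : Game.{u}} {B : Game.{v}} (σ : Strategy A) (α : Strategy (A.arrow B)) :
    Set (JSeq B.Move) :=
  {w | ∃ s ∈ α.carrier, (∀ i, (JSeq.left s).thread i ∈ σ.carrier) ∧ w = JSeq.right s}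

/-- The strategy `⊤ = {ε, qa}` on `Σ`. -/
def sigmaTop : Set (JSeq sigmaGame.Move) := {[], sigmaQA}

/-- `σ ≤_ib τ`: each innocent test passed by `σ` is passed by `τ`. -/
def Strategy.LeIB {A : Game.{u}} (σ τ : Strategy A) : Prop :=
  ∀ α : Strategy (A.arrow sigmaGame), α.Innocent → σ.comp α = sigmaTop → τ.comp α = sigmaTop

/-- The set of observations of a strategy. -/
def Strategy.obs {A : Game.{u}} (σ : Strategy A) : Set (Set (JSeq A.Move)) :=
  {S | ∃ s ∈ σ.carrier, A.Complete s ∧ A.OInnocent s ∧ s.SingleThreaded ∧ S = A.ovw s}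

/-- The order on sets of sets of O-views. -/
def LeOS {M : Type u} (𝒮 𝒯 : Set (Set (JSeq M))) : Prop :=
  ∀ S ∈ 𝒮, ∃ T ∈ 𝒯, T ⊆ S

/-- Answers justify no moves. -/
def Arena.AnswersTerminal (A : Arena.{u}) : Prop :=
  ∀ m n, A.enables m n → A.kind m = Kind.question

/-- On single-threaded plays, the moves available to Opponent depend only on the O-view. -/
def Game.OViewDetermined (G : Game.{u}) : Prop :=
  ∀ (s t : JSeq G.Move) (x : G.Move × Option ℕ),
    s ++ [x] ∈ G.plays → t ∈ G.plays → (s ++ [x]).SingleThreaded → t.SingleThreaded →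
    G.player x.1 = Player.O → G.view Player.O s = G.view Player.O t →
    ∃ y, t ++ [y] ∈ G.plays ∧ G.view Player.O (s ++ [x]) = G.view Player.O (t ++ [y])

/-!
A play of `A ⇒ Σ` is `ε`, `q l` or `q l a`, where `l` is a legal, well-bracketed interleaving of
plays of `A` (`Game.Interleaved`); so `σ;α = ⊤` says that `α` contains some `q l a` such that all
threads of `l` are in `σ` (`Game.comp_eq_sigmaTop_iff`). In such an `l` the roles are those of `A`:
the test `α` plays as Opponent, and its P-view is the O-view of `l` preceded by `q`.

*From `≤_ib` to `≤_os`.* A complete, O-innocent, single-threaded `s ∈ σ` defines a test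
(`Game.test`) which opens a single thread, plays on as long as all its O-views lie in `ovw s`, and
answers `q` when the thread is complete. It is deterministic because `s` is O-innocent, and
innocent because the moves available to Opponent depend only on the O-view
(`Game.test_innocent`). It is passed by `σ`, hence by `τ`, and the interaction with `τ` is a play
of `τ` whose O-views all lie in `ovw s` (`Game.leOS_of_leIB`).

*From `≤_os` to `≤_ib`.* Given `q u a ∈ α` with all threads of `u` in `σ`, the threads are replaced
by plays of `τ` one at a time, the last one first (`Game.exists_qaplay_replace`). To replace the
thread that starts at position `k`, regard the remaining participants (the test, and Player in all
other threads) as one, whose environment is Player in the `k`-th thread. What this participant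
may depend on is the *core* of an interleaving (`Arena.core`): the view which skips from a P-move
of the `k`-th thread to its justifier, and which contains every other move made since.

- All O-views, and all P-views of the other threads, can be computed from the core. By innocence
  of `α`, `σ` and `τ`, interleavings with equal cores are therefore continued alike, up to the
  next P-move of the `k`-th thread (`Game.Run.exists_step`).
- The moves of the `k`-th thread in the core form the O-view of this thread
  (`Arena.Legal.view_thread_eq`). Conversely this O-view determines the core
  (`Game.Run.core_eq_of_view_eq`), so the environment is seen only through the O-view of its
  thread. In particular this thread is O-innocent (`Game.Run.oInnocent_thread`), and `≤_os` gives
  `t ∈ τ` with `ovw t` contained in the O-views of this thread.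
- The play `t` then takes the place of the `k`-th thread (`Game.Run.exists_follow`): an interleaving
  `w` is built whose `k`-th thread is a prefix of `t`, together with a prefix of `u` with the same
  core. After a P-move of `t` the prefix of `u` is chosen anew, at an occurrence in `u` of the
  resulting O-view; Opponent's answer is the next move of `t` by O-innocence. When all of `u` has
  been copied, `u` and `w` have the same core, hence the same O-view, and `α` answers `q` in `w` as
  it does in `u`.
-/

/-! ### Chains of positions and subsequences -/

namespace JSeq

/-- The positions visited by following the partial predecessor function `f` from `n`, in
increasing order; the walk stops where `f` is undefined or fails to decrease. -/
def chain (f : ℕ → Option ℕ) (n : ℕ) : List ℕ :=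
  match f n with
  | none => [n]
  | some j => if _h : j < n then chain f j ++ [n] else [n]
termination_by n

theorem chain_none {f : ℕ → Option ℕ} {n : ℕ} (h : f n = none) : chain f n = [n] := by
  rw [chain, h]

theorem chain_some {f : ℕ → Option ℕ} {n j : ℕ} (h : f n = some j) (hj : j < n) :
    chain f n = chain f j ++ [n] := by
  rw [chain, h]
  simp [hj]

theorem chain_stuck {f : ℕ → Option ℕ} {n : ℕ} (h : ∀ j, f n = some j → ¬ j < n) :
    chain f n = [n] := by
  rw [chain]
  split
  · rfl
  · next j hj => simp [h j hj]

/-- Either the walk stops at `n`, or it continues from a smaller predecessor. -/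
theorem chain_cases (f : ℕ → Option ℕ) (n : ℕ) :
    ((∀ j, f n = some j → ¬ j < n) ∧ chain f n = [n]) ∨
      ∃ j, f n = some j ∧ j < n ∧ chain f n = chain f j ++ [n] := by
  by_cases h : ∃ j, f n = some j ∧ j < n
  · obtain ⟨j, h1, h2⟩ := h
    exact Or.inr ⟨j, h1, h2, chain_some h1 h2⟩
  · push Not at h
    have h' : ∀ j, f n = some j → ¬ j < n := fun j hj => not_lt.2 (h j hj)
    exact Or.inl ⟨h', chain_stuck h'⟩

theorem self_mem_chain (f : ℕ → Option ℕ) (n : ℕ) : n ∈ chain f n := by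
  rcases chain_cases f n with ⟨-, h⟩ | ⟨j, -, -, h⟩ <;> simp [h]

theorem chain_ne_nil (f : ℕ → Option ℕ) (n : ℕ) : chain f n ≠ [] :=
  List.ne_nil_of_mem (self_mem_chain f n)

theorem mem_chain_le {f : ℕ → Option ℕ} {n i : ℕ} (h : i ∈ chain f n) : i ≤ n := by
  induction n using Nat.strong_induction_on with
  | _ n ih =>
    rcases chain_cases f n with ⟨-, e⟩ | ⟨j, -, hj, e⟩ <;> rw [e] at h
    · simp_all
    · rcases List.mem_append.1 h with h | h
      · have := ih j hj h
        omega
      · simp_all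

theorem chain_sorted (f : ℕ → Option ℕ) (n : ℕ) : (chain f n).Pairwise (· < ·) := by
  induction n using Nat.strong_induction_on with
  | _ n ih =>
    rcases chain_cases f n with ⟨-, e⟩ | ⟨j, -, hj, e⟩ <;> rw [e]
    · simp
    · refine List.pairwise_append.2 ⟨ih j hj, by simp, fun a ha b hb => ?_⟩
      have := mem_chain_le ha
      simp only [List.mem_singleton] at hb
      omega

theorem chain_prefix {f : ℕ → Option ℕ} {n i : ℕ} (h : i ∈ chain f n) :
    chain f i <+: chain f n := by
  induction n using Nat.strong_induction_on with
  | _ n ih =>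
    rcases chain_cases f n with ⟨-, e⟩ | ⟨j, -, hj, e⟩
    · rw [e, List.mem_singleton] at h
      rw [h]
    · rw [e] at h
      rcases List.mem_append.1 h with h | h
      · rw [e]
        exact (ih j hj h).trans (List.prefix_append _ _)
      · rw [List.mem_singleton.1 h]

theorem chain_subset_of_closed {f : ℕ → Option ℕ} {n : ℕ} (S : ℕ → Prop) (hn : S n)
    (hS : ∀ i j, i ≤ n → S i → f i = some j → j < i → S j) : ∀ i ∈ chain f n, S i := by
  induction n using Nat.strong_induction_on with
  | _ n ih =>
    intro i hi
    rcases chain_cases f n with ⟨-, e⟩ | ⟨j, h1, hj, e⟩ <;> rw [e] at hi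
    · rwa [List.mem_singleton.1 hi]
    · rcases List.mem_append.1 hi with h | h
      · exact ih j hj (hS n j le_rfl hn h1 hj)
          (fun i' j' h' => hS i' j' (h'.trans hj.le)) i h
      · rwa [List.mem_singleton.1 h]

theorem mem_chain_trans {f : ℕ → Option ℕ} {n i j : ℕ} (hi : i ∈ chain f n)
    (hj : j ∈ chain f i) : j ∈ chain f n :=
  (chain_prefix hi).subset hj

theorem mem_chain_of_some {f : ℕ → Option ℕ} {n i j : ℕ} (hi : i ∈ chain f n)
    (hf : f i = some j) (hj : j < i) : j ∈ chain f n :=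
  mem_chain_trans hi (by rw [chain_some hf hj]; simp [self_mem_chain])

theorem chain_congr {f g : ℕ → Option ℕ} {n : ℕ} (h : ∀ i ≤ n, f i = g i) :
    chain f n = chain g n := by
  induction n using Nat.strong_induction_on with
  | _ n ih =>
    rcases chain_cases f n with ⟨h1, e⟩ | ⟨j, h1, hj, e⟩
    · rw [e, chain_stuck]
      rwa [← h n le_rfl]
    · rw [e, chain_some (by rw [← h n le_rfl, h1]) hj,
        ih j hj fun i hi => h i (hi.trans hj.le)]

/-- A renumbering `φ` of positions that commutes with the predecessor functions on a closed set `D`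
carries chains to chains. -/
theorem chain_map {f g : ℕ → Option ℕ} (φ : ℕ → ℕ) (D : ℕ → Prop)
    (hD : ∀ a b, D a → g a = some b → b < a ∧ D b ∧ φ b < φ a)
    (hf : ∀ a, D a → f (φ a) = (g a).map φ) (a : ℕ) (ha : D a) :
    chain f (φ a) = (chain g a).map φ := by
  induction a using Nat.strong_induction_on with
  | _ a ih =>
    rcases h : g a with _ | b
    · rw [chain_none h, chain_none (by rw [hf a ha, h]; rfl)]
      rfl
    · obtain ⟨h1, h2, h3⟩ := hD a b ha h
      rw [chain_some h h1, chain_some (by rw [hf a ha, h]; rfl) h3, ih b h1 h2]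
      simp

/-- The pointer of the entry at position `i`. -/
def ptr {M : Type u} (s : JSeq M) (i : ℕ) : Option ℕ := (s[i]?).bind Prod.snd

/-- The entry with index `a` of a list of positions `K` (`0` if there is none): the position, in a
sequence `s`, of the `a`-th entry of the subsequence `s.sub K`. -/
def posAt (K : List ℕ) (a : ℕ) : ℕ := K.getD a 0

theorem getElem?_posAt {K : List ℕ} {a : ℕ} (h : a < K.length) : K[a]? = some (posAt K a) := by
  simp [posAt, List.getElem?_eq_getElem h]

theorem posAt_mem {K : List ℕ} {a : ℕ} (h : a < K.length) : posAt K a ∈ K :=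
  List.mem_of_getElem? (getElem?_posAt h)

theorem posAt_of_getElem? {K : List ℕ} {a i : ℕ} (h : K[a]? = some i) : posAt K a = i := by
  simp [posAt, h]

theorem posAt_lt_posAt {K : List ℕ} (hK : K.Pairwise (· < ·)) {a b : ℕ} (hab : a < b)
    (hb : b < K.length) : posAt K a < posAt K b := by
  have := List.pairwise_iff_getElem.1 hK a b (hab.trans hb) hb hab
  simpa [posAt, List.getElem?_eq_getElem hb, List.getElem?_eq_getElem (hab.trans hb)] using this

theorem posAt_inj {K : List ℕ} (hK : K.Pairwise (· < ·)) {a b : ℕ} (ha : a < K.length)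
    (hb : b < K.length) (h : posAt K a = posAt K b) : a = b := by
  rcases Nat.lt_trichotomy a b with h1 | h1 | h1
  · have := posAt_lt_posAt hK h1 hb
    omega
  · exact h1
  · have := posAt_lt_posAt hK h1 ha
    omega

theorem lt_of_posAt_lt {K : List ℕ} (hK : K.Pairwise (· < ·)) {a b : ℕ} (ha : a < K.length)
    (hb : b < K.length) (h : posAt K a < posAt K b) : a < b := by
  rcases Nat.lt_trichotomy a b with h1 | h1 | h1
  · exact h1
  · subst h1
    omega
  · have := posAt_lt_posAt hK h1 ha
    omega

theorem exists_posAt_of_mem {K : List ℕ} {i : ℕ} (h : i ∈ K) : ∃ a < K.length, posAt K a = i := by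
  obtain ⟨a, ha, e⟩ := List.mem_iff_getElem.1 h
  exact ⟨a, ha, by simp [posAt, List.getElem?_eq_getElem ha, e]⟩

theorem idxOf?_posAt {K : List ℕ} (hK : K.Pairwise (· < ·)) {a : ℕ} (ha : a < K.length) :
    K.idxOf? (posAt K a) = some a := by
  rw [List.idxOf?_eq_some_iff]
  have h1 : K[a] = posAt K a := by simp [posAt, List.getElem?_eq_getElem ha]
  refine ⟨ha, h1, fun j hj h2 => ?_⟩
  have h3 := List.pairwise_iff_getElem.1 hK j a (hj.trans ha) ha hj
  omega

theorem idxOf?_eq_some {K : List ℕ} {i a : ℕ} (h : K.idxOf? i = some a) :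
    a < K.length ∧ posAt K a = i := by
  rw [List.idxOf?_eq_some_iff] at h
  obtain ⟨h1, h2, -⟩ := h
  exact ⟨h1, by simp [posAt, List.getElem?_eq_getElem h1, h2]⟩

theorem idxOf?_isSome {K : List ℕ} {i : ℕ} (h : i ∈ K) : ∃ a, K.idxOf? i = some a := by
  rcases h' : K.idxOf? i with _ | a
  · exact absurd h (List.idxOf?_eq_none_iff.1 h')
  · exact ⟨a, rfl⟩

/-- Indices are preserved by an injective renumbering. -/
theorem idxOf?_map {φ : ℕ → ℕ} {V : List ℕ} {j : ℕ} (h : ∀ i ∈ V, φ i = φ j → i = j) :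
    (V.map φ).idxOf? (φ j) = V.idxOf? j := by
  induction V with
  | nil => rfl
  | cons a V ih =>
    have ih' := ih fun i hi => h i (List.mem_cons_of_mem _ hi)
    simp only [List.map_cons, List.idxOf?, List.findIdx?_cons] at ih' ⊢
    by_cases e : a = j
    · simp [e]
    · have e' : φ a ≠ φ j := fun e' => e (h a (by simp) e')
      simp only [beq_iff_eq, e, e', if_false, ih']

theorem idxOf?_snoc_of_mem {V : List ℕ} {j : ℕ} (h : j ∈ V) (l : List ℕ) :
    (V ++ l).idxOf? j = V.idxOf? j := by
  induction V with
  | nil => simp at h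
  | cons a V ih =>
    simp only [List.cons_append, List.idxOf?, List.findIdx?_cons] at ih ⊢
    by_cases e : a = j
    · simp [e]
    · simp only [beq_iff_eq, e, if_false]
      rw [ih (by simpa [Ne.symm e] using h)]

section Sub
variable {M : Type u}

theorem filterMap_total {β : Type u} (f : ℕ → Option β) (K : List ℕ)
    (h : ∀ i ∈ K, ∃ b, f i = some b) :
    (K.filterMap f).length = K.length ∧
      ∀ a < K.length, (K.filterMap f)[a]? = f (posAt K a) := by
  induction K with
  | nil => simp
  | cons i K ih =>
    obtain ⟨b, hb⟩ := h i (by simp)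
    obtain ⟨h1, h2⟩ := ih fun i hi => h i (List.mem_cons_of_mem _ hi)
    rw [List.filterMap_cons_some hb]
    refine ⟨by simp [h1], ?_⟩
    rintro (_ | a) ha
    · simp [hb, posAt]
    · have := h2 a (by simpa using ha)
      simpa [posAt] using this

theorem sub_length (s : JSeq M) (K : List ℕ) (hK : ∀ i ∈ K, i < s.length) :
    (s.sub K).length = K.length :=
  (filterMap_total _ K fun i hi => ⟨_, by rw [List.getElem?_eq_getElem (hK i hi)]; rfl⟩).1

theorem sub_getElem? (s : JSeq M) (K : List ℕ) (hK : ∀ i ∈ K, i < s.length) (a : ℕ)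
    (ha : a < K.length) :
    (s.sub K)[a]? = (s[posAt K a]?).map fun x => (x.1, x.2.bind fun j => K.idxOf? j) :=
  (filterMap_total _ K fun i hi => ⟨_, by rw [List.getElem?_eq_getElem (hK i hi)]; rfl⟩).2 a ha

theorem sub_ptr (s : JSeq M) (K : List ℕ) (hK : ∀ i ∈ K, i < s.length) (a : ℕ)
    (ha : a < K.length) :
    ptr (s.sub K) a = (ptr s (posAt K a)).bind fun j => K.idxOf? j := by
  unfold ptr
  rw [sub_getElem? s K hK a ha]
  rcases s[posAt K a]? with _ | ⟨m, p⟩ <;> rfl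

/-- Passing to a subsequence twice. -/
theorem sub_sub (s : JSeq M) (K J : List ℕ) (hK : K.Pairwise (· < ·))
    (hKs : ∀ i ∈ K, i < s.length) (hJ : ∀ a ∈ J, a < K.length) :
    (s.sub K).sub J = s.sub (J.map (posAt K)) := by
  conv_rhs => unfold sub
  conv_lhs => unfold sub
  rw [List.filterMap_map]
  refine List.filterMap_congr fun a ha => ?_
  change ((s.sub K)[a]?).map _ = _
  rw [sub_getElem? s K hKs a (hJ a ha)]
  simp only [Function.comp_apply, Option.map_map]
  congr 1
  funext x
  rcases x with ⟨m, _ | j⟩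
  · rfl
  · simp only [Function.comp_apply, Option.bind_some]
    by_cases hj : j ∈ K
    · obtain ⟨b, hb, rfl⟩ := exists_posAt_of_mem hj
      rw [idxOf?_posAt hK hb, idxOf?_map (j := b)]
      · rfl
      · intro i hi e
        exact posAt_inj hK (hJ i hi) hb e
    · rw [List.idxOf?_eq_none_iff.2 hj]
      symm
      simp only [Option.bind_none, Prod.mk.injEq, true_and]
      rw [List.idxOf?_eq_none_iff]
      intro h
      obtain ⟨b, hb, rfl⟩ := List.mem_map.1 h
      exact hj (posAt_mem (hJ b hb))

theorem sub_congr {s t : JSeq M} {K : List ℕ} (h : ∀ i ∈ K, s[i]? = t[i]?) :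
    s.sub K = t.sub K :=
  List.filterMap_congr fun i hi => by rw [h i hi]

theorem Backward.ptr_lt {s : JSeq M} (h : Backward s) {i j : ℕ} (hj : ptr s i = some j) :
    j < i := by
  unfold ptr at hj
  rcases hs : s[i]? with _ | ⟨m, p⟩
  · simp [hs] at hj
  · simp only [hs, Option.bind_some] at hj
    exact h i m j (by rw [hs, hj])

theorem Backward.ptr_zero {s : JSeq M} (hb : Backward s) : ptr s 0 = none := by
  rcases h : ptr s 0 with _ | j
  · rfl
  · have := hb.ptr_lt h
    omega

theorem getElem?_of_prefix {s t : JSeq M} (h : s <+: t) {i : ℕ} (hi : i < s.length) :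
    t[i]? = s[i]? := by
  obtain ⟨l, rfl⟩ := h
  exact List.getElem?_append_left hi

theorem ptr_of_prefix {s t : JSeq M} (h : s <+: t) {i : ℕ} (hi : i < s.length) :
    ptr t i = ptr s i := by
  unfold ptr
  rw [getElem?_of_prefix h hi]

theorem root_none {s : JSeq M} {n : ℕ} (h : ptr s n = none) : root s n = n := by
  unfold ptr at h
  rw [root, h]

theorem root_some {s : JSeq M} {n j : ℕ} (h : ptr s n = some j) (hj : j < n) :
    root s n = root s j := by
  unfold ptr at h
  rw [root, h]
  simp [hj]

theorem root_le (s : JSeq M) (n : ℕ) : root s n ≤ n := by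
  induction n using Nat.strong_induction_on with
  | _ n ih =>
    rw [root]
    split
    · rfl
    · split
      · next j hj => exact (ih _ hj).trans hj.le
      · rfl

theorem Backward.ptr_root {s : JSeq M} (h : Backward s) (n : ℕ) : ptr s (root s n) = none := by
  induction n using Nat.strong_induction_on with
  | _ n ih =>
    rcases hp : ptr s n with _ | j
    · rw [root_none hp, hp]
    · rw [root_some hp (h.ptr_lt hp), ih j (h.ptr_lt hp)]

theorem root_of_prefix {s t : JSeq M} (h : s <+: t) {i : ℕ} (hi : i < s.length) :
    root t i = root s i := by
  obtain ⟨l, rfl⟩ := h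
  induction l using List.reverseRecOn with
  | nil => simp
  | append_singleton l x ih =>
    rw [← List.append_assoc, root_snoc _ _ _ (by simp; omega), ih]

/-- Appending an entry to a sequence and its position to a list of positions. -/
theorem sub_append_last (s : JSeq M) (x : M × Option ℕ) (K : List ℕ)
    (hK : ∀ i ∈ K, i < s.length) (h : Backward (s ++ [x])) :
    sub (s ++ [x]) (K ++ [s.length]) =
      sub s K ++ [(x.1, x.2.bind fun j => K.idxOf? j)] := by
  rw [(sub_snoc s x K hK h.init).2]
  congr 2
  rcases x with ⟨m, _ | j⟩
  · rfl
  · have h1 : j < s.length := h s.length m j (by simp)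
    simp only [Option.bind_some, Prod.mk.injEq, true_and]
    by_cases hj : j ∈ K
    · exact idxOf?_snoc_of_mem hj _
    · rw [List.idxOf?_eq_none_iff.2 hj, List.idxOf?_eq_none_iff]
      simp only [List.mem_append, List.mem_singleton, not_or]
      exact ⟨hj, by omega⟩

end Sub

end JSeq

/-! ### Views as chains of positions -/

namespace JSeq

theorem Backward.sub {M : Type u} {s : JSeq M} (hs : Backward s) {K : List ℕ}
    (hK : K.Pairwise (· < ·)) (hKs : ∀ i ∈ K, i < s.length) : Backward (s.sub K) := by
  intro a m b h
  have ha : a < K.length := by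
    rw [← sub_length s K hKs]
    exact (List.getElem?_eq_some_iff.1 h).1
  have h1 : ptr (s.sub K) a = some b := by simp [ptr, h]
  rw [sub_ptr s K hKs a ha] at h1
  rcases h2 : ptr s (posAt K a) with _ | j
  · simp [h2] at h1
  · rw [h2, Option.bind_some] at h1
    obtain ⟨hb, e⟩ := idxOf?_eq_some h1
    refine lt_of_posAt_lt hK hb ha ?_
    rw [e]
    exact hs.ptr_lt h2

theorem Backward.of_prefix {M : Type u} {s t : JSeq M} (ht : Backward t) (h : s <+: t) :
    Backward s := by
  intro i m j hi
  refine ht i m j ?_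
  rw [getElem?_of_prefix h (List.getElem?_eq_some_iff.1 hi).1, hi]

end JSeq

namespace Arena
open JSeq

variable {A : Arena.{u}}

/-- The owner of the move at position `i`. -/
def playerAt (A : Arena.{u}) (s : JSeq A.Move) (i : ℕ) : Option Player :=
  (s[i]?).map fun x => A.player x.1

/-- The position preceding `i` in the `X`-view: the previous position for a move of `X`, the
justifier for any other move. -/
def pred (A : Arena.{u}) (X : Player) (s : JSeq A.Move) (i : ℕ) : Option ℕ :=
  if A.playerAt s i = some X then (if i = 0 then none else some (i - 1)) else ptr s i

theorem playerAt_of_prefix {s t : JSeq A.Move} (h : s <+: t) {i : ℕ} (hi : i < s.length) :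
    A.playerAt t i = A.playerAt s i := by
  unfold playerAt
  rw [getElem?_of_prefix h hi]

theorem pred_of_prefix {s t : JSeq A.Move} (h : s <+: t) (X : Player) {i : ℕ}
    (hi : i < s.length) : A.pred X t i = A.pred X s i := by
  unfold pred
  rw [playerAt_of_prefix h hi, ptr_of_prefix h hi]

theorem pred_lt {s : JSeq A.Move} (hs : Backward s) {X : Player} {i j : ℕ}
    (h : A.pred X s i = some j) : j < i := by
  unfold pred at h
  split_ifs at h
  · cases h
    omega
  · exact hs.ptr_lt h

theorem Justified.backward {s : JSeq A.Move} (hs : A.Justified s) : Backward s :=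
  fun i m j h => (hs.2 i m j h).1

theorem Legal.backward {s : JSeq A.Move} (hs : A.Legal s) : Backward s :=
  hs.justified.backward

theorem Legal.of_prefix {s t : JSeq A.Move} (ht : A.Legal t) (h : s <+: t) : A.Legal s := by
  obtain ⟨l, rfl⟩ := h
  induction l using List.reverseRecOn with
  | nil => simpa using ht
  | append_singleton l x ih =>
    rw [← List.append_assoc] at ht
    exact ih ht.init

theorem playerAt_isSome {s : JSeq A.Move} {i : ℕ} (hi : i < s.length) :
    A.playerAt s i = some Player.O ∨ A.playerAt s i = some Player.P := by
  unfold playerAt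
  rw [List.getElem?_eq_getElem hi]
  cases h : A.player s[i].1 <;> simp [h]

theorem Justified.playerAt_ptr {s : JSeq A.Move} (hs : A.Justified s) {i j : ℕ}
    (h : ptr s i = some j) : A.playerAt s j ≠ A.playerAt s i ∧ j < i ∧ i < s.length := by
  unfold ptr at h
  rcases hi : s[i]? with _ | ⟨m, p⟩
  · simp [hi] at h
  · simp only [hi, Option.bind_some] at h
    subst h
    obtain ⟨h1, x, h2, h3⟩ := hs.2 i m j hi
    refine ⟨?_, h1, (List.getElem?_eq_some_iff.1 hi).1⟩
    unfold playerAt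
    rw [hi, h2]
    simpa using A.enables_alternate _ _ h3

theorem viewPos_own {s : JSeq A.Move} {X : Player} {n : ℕ} (h : A.playerAt s n = some X) :
    A.viewPos X s (n + 1) = A.viewPos X s n ++ [n] := by
  rw [viewPos]
  unfold playerAt at h
  rcases hs : s[n]? with _ | ⟨m, p⟩
  · simp [hs] at h
  · simp only [hs, Option.map_some, Option.some.injEq] at h
    simp [h]

theorem viewPos_other_none {s : JSeq A.Move} {X : Player} {n : ℕ} (hn : n < s.length)
    (h : A.playerAt s n ≠ some X) (hp : ptr s n = none) :
    A.viewPos X s (n + 1) = [n] := by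
  rw [viewPos]
  unfold playerAt at h
  unfold ptr at hp
  rcases hs : s[n]? with _ | ⟨m, p⟩
  · rw [List.getElem?_eq_none_iff] at hs
    omega
  · simp only [hs, Option.map_some, ne_eq, Option.some.injEq, Option.bind_some] at h hp
    simp [h, hp]

theorem viewPos_other_some {s : JSeq A.Move} {X : Player} {n j : ℕ}
    (h : A.playerAt s n ≠ some X) (hp : ptr s n = some j) (hj : j < n) :
    A.viewPos X s (n + 1) = A.viewPos X s j ++ [j, n] := by
  rw [viewPos]
  unfold playerAt at h
  unfold ptr at hp
  rcases hs : s[n]? with _ | ⟨m, p⟩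
  · simp [hs] at hp
  · simp only [hs, Option.map_some, ne_eq, Option.some.injEq, Option.bind_some] at h hp
    simp [h, hp, hj]

theorem viewPos_zero {s : JSeq A.Move} {X : Player} : A.viewPos X s 0 = [] := by
  rw [viewPos]

/-- In a justified sequence views are obtained by following predecessors. -/
theorem Justified.viewPos_succ {s : JSeq A.Move} (hs : A.Justified s) (X : Player) {n : ℕ}
    (hn : n < s.length) : A.viewPos X s (n + 1) = chain (A.pred X s) n := by
  induction n using Nat.strong_induction_on with
  | _ n ih =>
    by_cases ho : A.playerAt s n = some X
    · rw [viewPos_own ho]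
      rcases n with _ | n
      · rw [viewPos_zero, chain_none (by simp [pred, ho])]
        rfl
      · rw [ih n (by omega) (by omega), chain_some (f := A.pred X s) (n := n + 1)
          (j := n) (by simp [pred, ho]) (by omega)]
    · rcases hp : ptr s n with _ | j
      · rw [viewPos_other_none hn ho hp, chain_none (by simp [pred, ho, hp])]
      · obtain ⟨h1, h2, -⟩ := hs.playerAt_ptr hp
        have hj : A.playerAt s j = some X := by
          rcases playerAt_isSome (A := A) hn with h | h <;>
            rcases playerAt_isSome (A := A) (h2.trans hn) with h' | h' <;>
              cases X <;> simp_all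
        rw [viewPos_other_some ho hp h2, chain_some (f := A.pred X s) (j := j)
          (by simp [pred, ho, hp]) h2, ← ih j h2 (h2.trans hn), viewPos_own hj]
        simp

/-- The `X`-view of the prefix of `s` that ends with position `n`. -/
def viewAt (A : Arena.{u}) (X : Player) (s : JSeq A.Move) (n : ℕ) : JSeq A.Move :=
  s.sub (chain (A.pred X s) n)

theorem view_nil (X : Player) : A.view X [] = [] := by
  simp [view, viewPos_zero, JSeq.sub]

theorem Justified.view_eq {s : JSeq A.Move} (hs : A.Justified s) (X : Player)
    (hn : s ≠ []) : A.view X s = A.viewAt X s (s.length - 1) := by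
  have : 0 < s.length := List.length_pos_iff.2 hn
  unfold view viewAt
  rw [← hs.viewPos_succ X (n := s.length - 1) (by omega)]
  congr 2
  omega

theorem Justified.view_snoc_eq {s : JSeq A.Move} {x : A.Move × Option ℕ}
    (hs : A.Justified (s ++ [x])) (X : Player) :
    A.view X (s ++ [x]) = A.viewAt X (s ++ [x]) s.length := by
  rw [hs.view_eq X (by simp)]
  simp

theorem viewAt_of_prefix {s t : JSeq A.Move} (h : s <+: t) (X : Player) {n : ℕ}
    (hn : n < s.length) : A.viewAt X t n = A.viewAt X s n := by
  unfold viewAt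
  rw [chain_congr (g := A.pred X s) fun i hi => pred_of_prefix h X (by omega)]
  exact sub_congr fun i hi => getElem?_of_prefix h (by have := mem_chain_le hi; omega)

theorem Legal.ptr_mem_viewPos {s : JSeq A.Move} (hs : A.Legal s) {i j : ℕ} {X : Player}
    (h : ptr s i = some j) (hX : A.playerAt s i = some X) :
    0 < i ∧ j ∈ chain (A.pred X s) (i - 1) := by
  obtain ⟨-, h1, h2⟩ := hs.justified.playerAt_ptr h
  refine ⟨by omega, ?_⟩
  rw [← hs.justified.viewPos_succ X (n := i - 1) (by omega)]
  unfold ptr at h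
  unfold playerAt at hX
  rcases hi : s[i]? with _ | ⟨m, p⟩
  · simp [hi] at h
  · simp only [hi, Option.bind_some, Option.map_some, Option.some.injEq] at h hX
    subst h hX
    have := hs.visible i m j hi
    rwa [show i - 1 + 1 = i by omega]

theorem Justified.playerAt_of_ptr_none {s : JSeq A.Move} (hs : A.Justified s) {i : ℕ}
    (hi : i < s.length) (h : ptr s i = none) : A.playerAt s i = some Player.O := by
  unfold ptr at h
  unfold playerAt
  rw [List.getElem?_eq_getElem hi] at h ⊢
  simp only [Option.bind_some, Option.map_some, Option.some.injEq] at h ⊢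
  exact A.initial_opponent _ (hs.1 i _ (by rw [List.getElem?_eq_getElem hi, ← h]))

theorem Alternating.playerAt_succ {s : JSeq A.Move} (hs : A.Alternating s) {i : ℕ}
    (hi : i + 1 < s.length) : A.playerAt s (i + 1) ≠ A.playerAt s i := by
  have := hs i s[i] s[i + 1] (List.getElem?_eq_getElem _) (List.getElem?_eq_getElem _)
  unfold playerAt
  rw [List.getElem?_eq_getElem hi, List.getElem?_eq_getElem (by omega)]
  simpa using this.symm

/-- Opponent starts, so Opponent owns exactly the even positions. -/
theorem Legal.playerAt_eq {s : JSeq A.Move} (hs : A.Legal s) {i : ℕ} (hi : i < s.length) :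
    A.playerAt s i = some (if Even i then Player.O else Player.P) := by
  induction i with
  | zero =>
    rw [hs.justified.playerAt_of_ptr_none hi]
    · simp
    · exact hs.backward.ptr_zero
  | succ i ih =>
    have h1 := hs.alternating.playerAt_succ hi
    rw [ih (by omega)] at h1
    rcases playerAt_isSome (A := A) hi with h | h <;> rw [h] at h1 ⊢ <;>
      by_cases hev : Even i <;> simp_all [Nat.even_add_one]

theorem Legal.playerAt_eq_O_iff {s : JSeq A.Move} (hs : A.Legal s) {i : ℕ}
    (hi : i < s.length) : A.playerAt s i = some Player.O ↔ Even i := by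
  rw [hs.playerAt_eq hi]
  split_ifs with h <;> simp [h]

theorem Legal.playerAt_eq_P_iff {s : JSeq A.Move} (hs : A.Legal s) {i : ℕ}
    (hi : i < s.length) : A.playerAt s i = some Player.P ↔ ¬ Even i := by
  rw [hs.playerAt_eq hi]
  split_ifs with h <;> simp [h]

theorem playerAt_sub {s : JSeq A.Move} {K : List ℕ} (hKs : ∀ i ∈ K, i < s.length) {a : ℕ}
    (ha : a < K.length) : A.playerAt (s.sub K) a = A.playerAt s (posAt K a) := by
  unfold playerAt
  rw [sub_getElem? s K hKs a ha, Option.map_map]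
  rfl

/-- Views computed in a subsequence: if, within a property `D` of positions, the retained positions
are closed under predecessors, then the chain of predecessors in the whole sequence is the one
in the subsequence. -/
theorem chain_pred_sub {s : JSeq A.Move} (hs : Backward s) {K : List ℕ}
    (hK : K.Pairwise (· < ·)) (hKs : ∀ i ∈ K, i < s.length) (X : Player) (D : ℕ → Prop)
    (hcl : ∀ i ∈ K, D i → ∀ j, A.pred X s i = some j → j ∈ K ∧ D j) {a : ℕ}
    (ha : a < K.length) (hD : D (posAt K a)) :
    chain (A.pred X s) (posAt K a) = (chain (A.pred X (s.sub K)) a).map (posAt K) := by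
  have key : ∀ b, (b < K.length ∧ D (posAt K b)) →
      A.pred X s (posAt K b) = (A.pred X (s.sub K) b).map (posAt K) := by
    rintro b ⟨hb, hDb⟩
    have hclb := hcl _ (posAt_mem hb) hDb
    by_cases ho : A.playerAt s (posAt K b) = some X
    · have e1 : A.pred X s (posAt K b) = if posAt K b = 0 then none else some (posAt K b - 1) := by
        rw [pred, if_pos ho]
      have e2 : A.pred X (s.sub K) b = if b = 0 then none else some (b - 1) := by
        rw [pred, playerAt_sub hKs hb, if_pos ho]
      by_cases h0 : posAt K b = 0
      · have hb0 : b = 0 := by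
          by_contra hb0
          have := posAt_lt_posAt hK (show 0 < b by omega) hb
          omega
        rw [e1, e2, if_pos h0, if_pos hb0]
        rfl
      · rw [if_neg h0] at e1
        obtain ⟨c, hc, e⟩ := exists_posAt_of_mem (hclb _ e1).1
        have hcb : c < b := lt_of_posAt_lt hK hc hb (by omega)
        have hcb' : c = b - 1 := by
          by_contra hne
          have h1 := posAt_lt_posAt hK (show c < b - 1 by omega) (by omega)
          have h2 := posAt_lt_posAt hK (show b - 1 < b by omega) hb
          omega
        rw [e1, e2, if_neg (by omega : b ≠ 0)]
        simp [← hcb', e]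
    · have e1 : A.pred X s (posAt K b) = ptr s (posAt K b) := by rw [pred, if_neg ho]
      have e2 : A.pred X (s.sub K) b = (ptr s (posAt K b)).bind fun j => K.idxOf? j := by
        rw [pred, playerAt_sub hKs hb, if_neg ho, sub_ptr s K hKs b hb]
      rw [e1, e2]
      rcases h : ptr s (posAt K b) with _ | j
      · rfl
      · obtain ⟨c, hc, rfl⟩ := exists_posAt_of_mem (hclb j (by rw [e1, h])).1
        simp [idxOf?_posAt hK hc]
  refine chain_map (posAt K) (fun b => b < K.length ∧ D (posAt K b)) ?_ key a ⟨ha, hD⟩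
  rintro b c ⟨hb, hDb⟩ hc
  have hcb := pred_lt (hs.sub hK hKs) hc
  have h1 := (hcl _ (posAt_mem hb) hDb (posAt K c) (by rw [key b ⟨hb, hDb⟩, hc]; rfl)).2
  exact ⟨hcb, ⟨by omega, h1⟩, posAt_lt_posAt hK hcb hb⟩

theorem viewAt_sub {s : JSeq A.Move} (hs : Backward s) {K : List ℕ}
    (hK : K.Pairwise (· < ·)) (hKs : ∀ i ∈ K, i < s.length) (X : Player) (D : ℕ → Prop)
    (hcl : ∀ i ∈ K, D i → ∀ j, A.pred X s i = some j → j ∈ K ∧ D j) {a : ℕ}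
    (ha : a < K.length) (hD : D (posAt K a)) :
    A.viewAt X s (posAt K a) = A.viewAt X (s.sub K) a := by
  unfold viewAt
  rw [chain_pred_sub hs hK hKs X D hcl ha hD, sub_sub s K _ hK hKs]
  intro b hb
  have := mem_chain_le hb
  omega

theorem lt_of_mem_viewPos {s : JSeq A.Move} {X : Player} {n i : ℕ} (hi : i ∈ A.viewPos X s n) :
    i < n := by
  induction n using Nat.strong_induction_on with
  | _ n ih =>
    rcases n with _ | n
    · simp [viewPos_zero] at hi
    · rw [viewPos] at hi
      split at hi
      · simp at hi
      · split_ifs at hi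
        · rcases List.mem_append.1 hi with h | h
          · have := ih n (by omega) h
            omega
          · simp at h
            omega
        · split at hi
          · simp at hi
            omega
          · split_ifs at hi with hj
            · rcases List.mem_append.1 hi with h | h
              · have := ih _ (by omega) h
                omega
              · simp at h
                omega
            · simp at hi
              omega

/-- A move of `X` extends the `X`-view. -/
theorem view_snoc_own {s : JSeq A.Move} {x : A.Move × Option ℕ} (hs : Backward (s ++ [x]))
    {X : Player} (hx : A.player x.1 = X) :
    A.view X (s ++ [x]) = A.view X s ++
      [(x.1, x.2.bind fun j => (A.viewPos X s s.length).idxOf? j)] := by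
  have h1 : A.playerAt (s ++ [x]) s.length = some X := by simp [playerAt, hx]
  unfold view
  rw [List.length_append, List.length_singleton, viewPos_own h1,
    A.viewPos_snoc _ _ _ _ le_rfl, sub_append_last s x _ (fun _ => lt_of_mem_viewPos) hs]

end Arena

/-! ### Sequences of moves of `A ⇒ Σ` -/

namespace Arena
open JSeq
variable {A : Arena.{u}}

theorem AnsweredBefore.of_prefix {s t : JSeq A.Move} (h : s <+: t) {i n : ℕ}
    (hi : A.AnsweredBefore s i n) : A.AnsweredBefore t i n := by
  obtain ⟨k, hk, m, h1, h2⟩ := hi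
  refine ⟨k, hk, m, ?_, h2⟩
  rw [getElem?_of_prefix h (List.getElem?_eq_some_iff.1 h1).1, h1]

theorem answeredBefore_prefix_iff {s t : JSeq A.Move} (h : s <+: t) {i n : ℕ}
    (hn : n ≤ s.length) : A.AnsweredBefore t i n ↔ A.AnsweredBefore s i n := by
  refine ⟨?_, fun hi => hi.of_prefix h⟩
  rintro ⟨k, hk, m, h1, h2⟩
  exact ⟨k, hk, m, by rw [← getElem?_of_prefix h (by omega), h1], h2⟩

theorem isQuestionAt_prefix_iff {s t : JSeq A.Move} (h : s <+: t) {i : ℕ}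
    (hi : i < s.length) : A.IsQuestionAt t i ↔ A.IsQuestionAt s i := by
  unfold IsQuestionAt
  rw [getElem?_of_prefix h hi]

theorem WellBracketed.snoc {s : JSeq A.Move} {x : A.Move × Option ℕ} (hs : A.WellBracketed s)
    (hx : ∀ j, x.2 = some j → A.kind x.1 = Kind.answer → ¬ A.AnsweredBefore s j s.length ∧
      ∀ i, j < i → i < s.length → A.IsQuestionAt s i → A.AnsweredBefore s i s.length) :
    A.WellBracketed (s ++ [x]) := by
  have hp : s <+: s ++ [x] := List.prefix_append _ _
  intro n m j h ha
  have hn := (List.getElem?_eq_some_iff.1 h).1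
  simp only [List.length_append, List.length_singleton] at hn
  rw [answeredBefore_prefix_iff hp (by omega)]
  have hq : (∀ i, j < i → i < n → A.IsQuestionAt s i → A.AnsweredBefore s i n) →
      ∀ i, j < i → i < n → A.IsQuestionAt (s ++ [x]) i → A.AnsweredBefore (s ++ [x]) i n := by
    intro H i h1 h2 h3
    rw [answeredBefore_prefix_iff hp (by omega)]
    rw [isQuestionAt_prefix_iff hp (by omega)] at h3
    exact H i h1 h2 h3
  rcases (show n < s.length ∨ n = s.length by omega) with hlt | rfl
  · rw [getElem?_of_prefix hp hlt] at h
    exact ⟨(hs n m j h ha).1, hq (hs n m j h ha).2⟩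
  · rw [List.getElem?_concat_length, Option.some.injEq] at h
    subst h
    exact ⟨(hx j rfl ha).1, hq (hx j rfl ha).2⟩

theorem Legal.snoc {s : JSeq A.Move} {x : A.Move × Option ℕ} (hs : A.Legal s)
    (h0 : x.2 = none → A.initial x.1)
    (h1 : ∀ j, x.2 = some j → ∃ y, s[j]? = some y ∧ A.enables y.1 x.1)
    (h2 : 0 < s.length → A.playerAt s (s.length - 1) ≠ some (A.player x.1))
    (h3 : ∀ j, x.2 = some j → j ∈ A.viewPos (A.player x.1) s s.length) :
    A.Legal (s ++ [x]) := by
  have hp : s <+: s ++ [x] := List.prefix_append _ _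
  have hlt : ∀ {i : ℕ} {y : A.Move × Option ℕ}, (s ++ [x])[i]? = some y →
      (i < s.length ∧ s[i]? = some y) ∨ (i = s.length ∧ x = y) := by
    intro i y h
    have hn := (List.getElem?_eq_some_iff.1 h).1
    simp only [List.length_append, List.length_singleton] at hn
    rcases (show i < s.length ∨ i = s.length by omega) with hlt | rfl
    · exact Or.inl ⟨hlt, by rw [← h, getElem?_of_prefix hp hlt]⟩
    · rw [List.getElem?_concat_length, Option.some.injEq] at h
      exact Or.inr ⟨rfl, h⟩
  refine ⟨⟨fun i m h => ?_, fun i m j h => ?_⟩, fun i y z hy hz => ?_, fun i m j h => ?_⟩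
  · rcases hlt h with ⟨-, h⟩ | ⟨-, rfl⟩
    · exact hs.justified.1 i m h
    · exact h0 rfl
  · rcases hlt h with ⟨-, h⟩ | ⟨rfl, rfl⟩
    · obtain ⟨h4, y, h5, h6⟩ := hs.justified.2 i m j h
      exact ⟨h4, y, by rw [getElem?_of_prefix hp (List.getElem?_eq_some_iff.1 h5).1, h5], h6⟩
    · obtain ⟨y, h5, h6⟩ := h1 j rfl
      have := (List.getElem?_eq_some_iff.1 h5).1
      exact ⟨this, y, by rw [getElem?_of_prefix hp this, h5], h6⟩
  · rcases hlt hz with ⟨h4, hz⟩ | ⟨h4, rfl⟩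
    · rw [getElem?_of_prefix hp (by omega)] at hy
      exact hs.alternating i y z hy hz
    · rw [getElem?_of_prefix hp (by omega)] at hy
      have := h2 (by omega)
      unfold playerAt at this
      rw [← h4, Nat.add_sub_cancel, hy] at this
      simpa using this
  · rcases hlt h with ⟨h4, h⟩ | ⟨rfl, rfl⟩
    · rw [A.viewPos_snoc _ _ _ _ h4.le]
      exact hs.visible i m j h
    · rw [A.viewPos_snoc _ _ _ _ le_rfl]
      exact h3 j rfl

end Arena

/-- An entry of a sequence in `A` as an entry of a sequence in `A ⇒ Σ` played after the initial
move `q`: initial occurrences point to `q`, and the other pointers are shifted. -/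
def liftEntry {M : Type u} (x : M × Option ℕ) : (M ⊕ SigmaMove) × Option ℕ :=
  (.inl x.1, some (x.2.elim 0 (· + 1)))

/-- The sequence `q l` of moves of `A ⇒ Σ`. -/
def qplay {M : Type u} (l : JSeq M) : JSeq (M ⊕ SigmaMove) :=
  (.inr .q, none) :: l.map liftEntry

/-- The sequence `q l a` of moves of `A ⇒ Σ`. -/
def qaplay {M : Type u} (l : JSeq M) : JSeq (M ⊕ SigmaMove) :=
  qplay l ++ [(.inr .a, some 0)]

section Lift
open JSeq
variable {M : Type u}

theorem liftEntry_injective : Function.Injective (liftEntry (M := M)) := by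
  rintro ⟨m, p⟩ ⟨n, r⟩ h
  simp only [liftEntry, Prod.mk.injEq, Sum.inl.injEq, Option.some.injEq] at h
  obtain ⟨rfl, h⟩ := h
  rcases p with _ | p <;> rcases r with _ | r <;> simp_all

theorem qplay_injective : Function.Injective (qplay (M := M)) := by
  intro l l' h
  simp only [qplay, List.cons.injEq, true_and] at h
  exact liftEntry_injective.list_map h

theorem qaplay_injective : Function.Injective (qaplay (M := M)) := by
  intro l l' h
  exact qplay_injective (List.append_cancel_right h)

@[simp] theorem qplay_length (l : JSeq M) : (qplay l).length = l.length + 1 := by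
  simp [qplay]

theorem qplay_snoc (l : JSeq M) (x : M × Option ℕ) :
    qplay (l ++ [x]) = qplay l ++ [liftEntry x] := by
  simp [qplay]

theorem qplay_ne_nil (l : JSeq M) : qplay l ≠ [] := by
  simp [qplay]

theorem qplay_getElem?_succ (l : JSeq M) (n : ℕ) :
    (qplay l)[n + 1]? = (l[n]?).map liftEntry := by
  simp [qplay]

theorem qplay_getElem?_zero (l : JSeq M) : (qplay l)[0]? = some (.inr .q, none) := rfl

theorem qplay_eq_some {l : JSeq M} {n j : ℕ} {m : M}
    (h : (qplay l)[n + 1]? = some (.inl m, some (j + 1))) : l[n]? = some (m, some j) := by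
  rw [qplay_getElem?_succ, Option.map_eq_some_iff] at h
  obtain ⟨⟨m', p⟩, h1, h2⟩ := h
  simp only [liftEntry, Prod.mk.injEq, Sum.inl.injEq, Option.some.injEq] at h2
  obtain ⟨rfl, h2⟩ := h2
  rcases p with _ | p <;> simp_all

theorem backward_qplay {l : JSeq M} (h : Backward l) : Backward (qplay l) := by
  rintro (_ | i) m j hi
  · cases hi
  · rcases j with _ | j
    · omega
    · rw [qplay_getElem?_succ, Option.map_eq_some_iff] at hi
      obtain ⟨⟨m', p⟩, h1, h2⟩ := hi
      simp only [liftEntry, Prod.mk.injEq, Option.some.injEq] at h2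
      rcases p with _ | p
      · simp at h2
      · simp only [Option.elim_some, add_left_inj] at h2
        have := h i m' p h1
        omega

theorem backward_qaplay {l : JSeq M} (h : Backward l) : Backward (qaplay l) :=
  (backward_qplay h).snoc fun j hj => by
    simp only [Option.some.injEq] at hj
    simp [← hj]

theorem left_append_inl {N : Type v} (s : JSeq (M ⊕ N)) (m : M) (p : Option ℕ)
    (h : Backward (s ++ [(.inl m, p)])) :
    left (s ++ [(.inl m, p)]) = left s ++ [(m, p.bind fun j =>
      ((List.range s.length).filter fun n => ((s[n]?).any fun x => x.1.isLeft)).idxOf? j)] := by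
  have := sub_filter_snoc s (.inl m, p)
    (fun n => (((s ++ [(.inl m, p)])[n]?).any fun x => x.1.isLeft))
    (fun n => ((s[n]?).any fun x => x.1.isLeft))
    (fun n hn => by simp only [List.getElem?_append_left hn]) h
  unfold left
  rw [this, List.filterMap_append]
  simp

theorem left_append_inr {N : Type v} (s : JSeq (M ⊕ N)) (m : N) (p : Option ℕ)
    (h : Backward (s ++ [(.inr m, p)])) :
    left (s ++ [(.inr m, p)]) = left s := by
  have := sub_filter_snoc s (.inr m, p)
    (fun n => (((s ++ [(.inr m, p)])[n]?).any fun x => x.1.isLeft))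
    (fun n => ((s[n]?).any fun x => x.1.isLeft))
    (fun n hn => by simp only [List.getElem?_append_left hn]) h
  unfold left
  rw [this, List.filterMap_append]
  simp

theorem right_append_inr {N : Type v} (s : JSeq (M ⊕ N)) (m : N) (p : Option ℕ)
    (h : Backward (s ++ [(.inr m, p)])) :
    right (s ++ [(.inr m, p)]) = right s ++ [(m, p.bind fun j =>
      ((List.range s.length).filter fun n => ((s[n]?).any fun x => x.1.isRight)).idxOf? j)] := by
  have := sub_filter_snoc s (.inr m, p)
    (fun n => (((s ++ [(.inr m, p)])[n]?).any fun x => x.1.isRight))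
    (fun n => ((s[n]?).any fun x => x.1.isRight))
    (fun n hn => by simp only [List.getElem?_append_left hn]) h
  unfold right
  rw [this, List.filterMap_append]
  simp

theorem right_append_inl {N : Type v} (s : JSeq (M ⊕ N)) (m : M) (p : Option ℕ)
    (h : Backward (s ++ [(.inl m, p)])) :
    right (s ++ [(.inl m, p)]) = right s := by
  have := sub_filter_snoc s (.inl m, p)
    (fun n => (((s ++ [(.inl m, p)])[n]?).any fun x => x.1.isRight))
    (fun n => ((s[n]?).any fun x => x.1.isRight))
    (fun n hn => by simp only [List.getElem?_append_left hn]) h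
  unfold right
  rw [this, List.filterMap_append]
  simp

theorem qplay_leftPos (l : JSeq M) :
    ((List.range (qplay l).length).filter fun n => (((qplay l)[n]?).any fun x => x.1.isLeft)) =
      (List.range l.length).map Nat.succ := by
  rw [qplay_length, List.range_succ_eq_map, List.filter_cons]
  simp only [qplay_getElem?_zero, Option.any_some, Sum.isLeft_inr]
  rw [List.filter_eq_self.2]
  · simp
  · intro n hn
    obtain ⟨i, hi, rfl⟩ := List.mem_map.1 hn
    rw [qplay_getElem?_succ, List.getElem?_eq_getElem (List.mem_range.1 hi)]
    rfl

theorem qplay_rightPos (l : JSeq M) :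
    ((List.range (qplay l).length).filter fun n => (((qplay l)[n]?).any fun x => x.1.isRight)) =
      [0] := by
  rw [qplay_length, List.range_succ_eq_map, List.filter_cons]
  simp only [qplay_getElem?_zero, Option.any_some, Sum.isRight_inr, if_true]
  rw [List.filter_eq_nil_iff.2]
  intro n hn
  obtain ⟨i, hi, rfl⟩ := List.mem_map.1 hn
  rw [qplay_getElem?_succ, List.getElem?_eq_getElem (List.mem_range.1 hi)]
  simp [liftEntry]

theorem left_qplay {l : JSeq M} (h : Backward l) : left (qplay l) = l := by
  induction l using List.reverseRecOn with
  | nil => rfl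
  | append_singleton l x ih =>
    have hb := backward_qplay h
    rw [qplay_snoc] at hb ⊢
    unfold liftEntry at hb ⊢
    rw [left_append_inl _ _ _ hb, ih h.init, qplay_leftPos]
    congr 2
    rcases x with ⟨m, _ | j⟩
    · simp only [Option.elim_none, Option.bind_some, Prod.mk.injEq, true_and]
      rw [List.idxOf?_eq_none_iff]
      simp
    · have hj : j < l.length := h l.length m j (by simp)
      simp only [Option.elim_some, Option.bind_some, Prod.mk.injEq, true_and]
      rw [← Nat.succ_eq_add_one, idxOf?_map (by simp)]
      have := idxOf?_posAt (K := List.range l.length) List.pairwise_lt_range (a := j) (by simpa)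
      rwa [show posAt (List.range l.length) j = j by simp [posAt, hj]] at this

theorem right_qplay {l : JSeq M} (h : Backward l) : right (qplay l) = [(.q, none)] := by
  induction l using List.reverseRecOn with
  | nil => rfl
  | append_singleton l x ih =>
    have hb := backward_qplay h
    rw [qplay_snoc] at hb ⊢
    unfold liftEntry at hb ⊢
    rw [right_append_inl _ _ _ hb, ih h.init]

theorem left_qaplay {l : JSeq M} (h : Backward l) : left (qaplay l) = l := by
  unfold qaplay
  rw [left_append_inr _ _ _ (backward_qaplay h), left_qplay h]

theorem right_qaplay {l : JSeq M} (h : Backward l) : right (qaplay l) = sigmaQA := by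
  unfold qaplay
  rw [right_append_inr _ _ _ (backward_qaplay h), right_qplay h, qplay_rightPos]
  rfl

end Lift

namespace Arena
open JSeq
variable {A : Arena.{u}}

theorem playerAt_qplay_succ (l : JSeq A.Move) (n : ℕ) :
    (A.arrow sigmaArena).playerAt (qplay l) (n + 1) = (A.playerAt l n).map Player.swap := by
  unfold playerAt
  rw [qplay_getElem?_succ]
  rcases l[n]? with _ | x <;> rfl

theorem ptr_qplay_succ (l : JSeq A.Move) (n : ℕ) :
    ptr (qplay l) (n + 1) = (l[n]?).map fun x => x.2.elim 0 (· + 1) := by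
  unfold ptr
  rw [qplay_getElem?_succ]
  rcases l[n]? with _ | x <;> rfl

/-- After the opening move `q`, the view of a participant of `A ⇒ Σ` is `q` followed by the view,
in `A`, of the participant whose role it takes over. -/
theorem viewPos_qplay {l : JSeq A.Move} (hl : Backward l) (X : Player) {n : ℕ}
    (hn : n ≤ l.length) :
    (A.arrow sigmaArena).viewPos X.swap (qplay l) (n + 1) =
      0 :: (A.viewPos X l n).map Nat.succ := by
  induction n using Nat.strong_induction_on with
  | _ n ih =>
    rcases n with _ | n
    · rw [viewPos_zero]
      by_cases h : (A.arrow sigmaArena).playerAt (qplay l) 0 = some X.swap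
      · rw [viewPos_own h, viewPos_zero]
        rfl
      · rw [viewPos_other_none (by simp) h rfl]
        rfl
    · have hp : (A.arrow sigmaArena).playerAt (qplay l) (n + 1) = some X.swap ↔
          A.playerAt l n = some X := by
        rw [playerAt_qplay_succ]
        rcases A.playerAt l n with _ | Y
        · simp
        · cases X <;> cases Y <;> simp [Player.swap]
      by_cases h : A.playerAt l n = some X
      · rw [viewPos_own (hp.2 h), viewPos_own h, ih n (by omega) (by omega)]
        simp
      · have h' := mt hp.1 h
        have e : ptr (qplay l) (n + 1) = some ((ptr l n).elim 0 (· + 1)) := by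
          rw [ptr_qplay_succ]
          unfold ptr
          rw [List.getElem?_eq_getElem (by omega : n < l.length)]
          rfl
        rcases hj : ptr l n with _ | j
        · rw [hj] at e
          rw [viewPos_other_some h' e (by simp), viewPos_other_none (by omega) h hj,
            Option.elim_none, viewPos_zero]
          rfl
        · have hjn := hl.ptr_lt hj
          rw [hj] at e
          rw [viewPos_other_some h' e (by simp; omega), viewPos_other_some h hj hjn,
            Option.elim_some, ih j (by omega) (by omega)]
          simp

theorem legal_qplay_iff {l : JSeq A.Move} :
    (A.arrow sigmaArena).Legal (qplay l) ↔ A.Legal l := by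
  constructor
  · intro h
    have hb : Backward l := by
      intro i m j hi
      have := (h.justified.2 (i + 1) (.inl m) (j + 1)
        (by rw [qplay_getElem?_succ, hi]; rfl)).1
      omega
    refine ⟨⟨fun i m hi => ?_, fun i m j hi => ?_⟩, fun i x y hx hy => ?_, fun i m j hi => ?_⟩
    · obtain ⟨-, x, h1, h2⟩ := h.justified.2 (i + 1) (.inl m) 0
        (by rw [qplay_getElem?_succ, hi]; rfl)
      cases h1
      exact h2.2
    · obtain ⟨h0, x, h1, h2⟩ := h.justified.2 (i + 1) (.inl m) (j + 1)
        (by rw [qplay_getElem?_succ, hi]; rfl)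
      rw [qplay_getElem?_succ, Option.map_eq_some_iff] at h1
      obtain ⟨y, h3, rfl⟩ := h1
      exact ⟨by omega, y, h3, h2⟩
    · have := h.alternating (i + 1) (liftEntry x) (liftEntry y)
        (by rw [qplay_getElem?_succ, hx]; rfl) (by rw [qplay_getElem?_succ, hy]; rfl)
      intro e
      exact this (congrArg Player.swap e)
    · have := h.visible (i + 1) (.inl m) (j + 1) (by rw [qplay_getElem?_succ, hi]; rfl)
      change j + 1 ∈ (A.arrow sigmaArena).viewPos (A.player m).swap (qplay l) (i + 1) at this
      rw [viewPos_qplay hb _ (List.getElem?_eq_some_iff.1 hi).1.le] at this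
      simpa using this
  · intro h
    refine ⟨⟨fun i m hi => ?_, fun i m j hi => ?_⟩, fun i x y hx hy => ?_, fun i m j hi => ?_⟩
    · rcases i with _ | i
      · cases hi
        rfl
      · rw [qplay_getElem?_succ, Option.map_eq_some_iff] at hi
        obtain ⟨x, -, h2⟩ := hi
        simp [liftEntry] at h2
    · rcases i with _ | i
      · cases hi
      · rw [qplay_getElem?_succ, Option.map_eq_some_iff] at hi
        obtain ⟨⟨m, _ | p⟩, h1, h2⟩ := hi <;> cases h2
        · exact ⟨by simp, _, rfl, rfl, h.justified.1 i m h1⟩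
        · obtain ⟨h3, y, h4, h5⟩ := h.justified.2 i m p h1
          refine ⟨by simpa using h3, liftEntry y, ?_, h5⟩
          rw [Option.elim_some, qplay_getElem?_succ, h4]
          rfl
    · rcases i with _ | i
      · cases hx
        rw [qplay_getElem?_succ, Option.map_eq_some_iff] at hy
        obtain ⟨y, h1, rfl⟩ := hy
        have := h.playerAt_eq (List.getElem?_eq_some_iff.1 h1).1
        simp only [playerAt, h1, Option.map_some, Even.zero, if_true, Option.some.injEq] at this
        simp [liftEntry, this, Player.swap]
      · rw [qplay_getElem?_succ, Option.map_eq_some_iff] at hx hy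
        obtain ⟨x, hx, rfl⟩ := hx
        obtain ⟨y, hy, rfl⟩ := hy
        have := h.alternating i x y hx hy
        simp only [liftEntry, Sum.elim_inl]
        intro e
        apply this
        revert e
        cases A.player x.1 <;> cases A.player y.1 <;> simp [Player.swap]
    · rcases i with _ | i
      · cases hi
      · rw [qplay_getElem?_succ, Option.map_eq_some_iff] at hi
        obtain ⟨⟨m, p⟩, h1, h2⟩ := hi
        cases h2
        change _ ∈ (A.arrow sigmaArena).viewPos (A.player m).swap (qplay l) (i + 1)
        rw [viewPos_qplay h.backward _ (List.getElem?_eq_some_iff.1 h1).1.le]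
        rcases p with _ | p
        · simp
        · simpa using h.visible i m p h1

theorem answeredBefore_qplay_iff {l : JSeq A.Move} {i n : ℕ} :
    (A.arrow sigmaArena).AnsweredBefore (qplay l) (i + 1) (n + 1) ↔ A.AnsweredBefore l i n := by
  constructor
  · rintro ⟨_ | k, hk, m, h1, h2⟩
    · cases h1
    · rcases m with m | m
      · exact ⟨k, by omega, m, qplay_eq_some h1, h2⟩
      · rw [qplay_getElem?_succ, Option.map_eq_some_iff] at h1
        obtain ⟨x, -, h⟩ := h1
        simp [liftEntry] at h
  · rintro ⟨k, hk, m, h1, h2⟩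
    exact ⟨k + 1, by omega, .inl m, by rw [qplay_getElem?_succ, h1]; rfl, h2⟩

theorem isQuestionAt_qplay_iff {l : JSeq A.Move} {i : ℕ} :
    (A.arrow sigmaArena).IsQuestionAt (qplay l) (i + 1) ↔ A.IsQuestionAt l i := by
  unfold IsQuestionAt
  rw [qplay_getElem?_succ]
  constructor
  · rintro ⟨x, h1, h2⟩
    rw [Option.map_eq_some_iff] at h1
    obtain ⟨y, h3, rfl⟩ := h1
    exact ⟨y, h3, h2⟩
  · rintro ⟨x, h1, h2⟩
    exact ⟨liftEntry x, by rw [h1]; rfl, h2⟩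

theorem wellBracketed_qplay_iff {l : JSeq A.Move} (hl : A.Justified l) :
    (A.arrow sigmaArena).WellBracketed (qplay l) ↔ A.WellBracketed l := by
  constructor
  · intro h n m j hn ha
    obtain ⟨h1, h2⟩ := h (n + 1) (.inl m) (j + 1) (by rw [qplay_getElem?_succ, hn]; rfl) ha
    rw [answeredBefore_qplay_iff] at h1
    refine ⟨h1, fun i hi hin hq => ?_⟩
    rw [← answeredBefore_qplay_iff]
    exact h2 (i + 1) (by omega) (by omega) (isQuestionAt_qplay_iff.2 hq)
  · rintro h (_ | n) m j hn ha
    · cases hn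
    · rw [qplay_getElem?_succ, Option.map_eq_some_iff] at hn
      obtain ⟨⟨m, _ | p⟩, h1, h2⟩ := hn <;> cases h2
      · have := A.initial_question m (hl.1 n m h1)
        simp only [Sum.elim_inl] at ha
        simp [this] at ha
      · obtain ⟨h3, h4⟩ := h n m p h1 ha
        rw [Option.elim_some, answeredBefore_qplay_iff]
        refine ⟨h3, ?_⟩
        rintro (_ | i) hi hin hq
        · omega
        · rw [answeredBefore_qplay_iff]
          exact h4 i (by omega) (by omega) (isQuestionAt_qplay_iff.1 hq)

end Arena

/-! ### Interleavings: the plays of `A ⇒ Σ` -/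

open JSeq

namespace Game
variable {A : Game.{u}}

/-- The sequences `l` of moves of `A` for which `q l` is a play of `A ⇒ Σ`: several plays of `A`
are interleaved. -/
structure Interleaved (A : Game.{u}) (l : JSeq A.Move) : Prop where
  legal : A.Legal l
  wellBracketed : A.WellBracketed l
  thread_mem : ∀ i, l.thread i ∈ A.plays

theorem qplay_mem_iff {l : JSeq A.Move} :
    qplay l ∈ (A.arrow sigmaGame).plays ↔ A.Interleaved l := by
  constructor
  · rintro ⟨h1, h2, h3, h4⟩
    have h1' := Arena.legal_qplay_iff.1 h1
    rw [left_qplay h1'.backward] at h4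
    exact ⟨h1', (Arena.wellBracketed_qplay_iff h1'.justified).1 h2, h4⟩
  · rintro ⟨h1, h2, h3⟩
    refine ⟨Arena.legal_qplay_iff.2 h1, (Arena.wellBracketed_qplay_iff h1.justified).2 h2, ?_, ?_⟩
    · rw [right_qplay h1.backward]
      exact ⟨[(.a, some 0)], rfl⟩
    · rwa [left_qplay h1.backward]

/-- Answering `q` is possible when it is Player's turn in `A ⇒ Σ`, that is after an even number of
moves of `A`, and all questions of `A` are answered. -/
theorem qaplay_mem_iff {l : JSeq A.Move} :
    qaplay l ∈ (A.arrow sigmaGame).plays ↔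
      A.Interleaved l ∧ Even l.length ∧ A.Complete l := by
  constructor
  · intro h
    have h0 : A.Interleaved l := qplay_mem_iff.1 ((A.arrow sigmaGame).prefix_mem _ _ h)
    obtain ⟨h1, h2, -, -⟩ := h
    refine ⟨h0, ?_, fun i hq => ?_⟩
    · by_contra hev
      rcases hn : l.length with _ | n
      · simp [hn] at hev
      · have h3 := h1.alternating.playerAt_succ (i := n + 1) (by simp [qaplay, hn])
        have hp : qplay l <+: qaplay l := List.prefix_append _ _
        rw [Arena.playerAt_of_prefix hp (i := n + 1) (by simp [hn]), Arena.playerAt_qplay_succ,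
          h0.legal.playerAt_eq (by omega)] at h3
        rw [hn, Nat.even_add_one, not_not] at hev
        apply h3
        have e : (qaplay l)[n + 1 + 1]? = some (.inr .a, some 0) := by
          unfold qaplay
          rw [← hn, ← qplay_length]
          simp
        unfold Arena.playerAt
        rw [e]
        simp [hev, Player.swap]
    · have hp : qplay l <+: qaplay l := List.prefix_append _ _
      have e : (qaplay l)[l.length + 1]? = some (.inr .a, some 0) := by
        unfold qaplay
        rw [← qplay_length]
        simp
      have hi : i < l.length := by
        obtain ⟨x, hx, -⟩ := hq
        exact (List.getElem?_eq_some_iff.1 hx).1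
      have := (h2 _ _ _ e rfl).2 (i + 1) (by omega) (by omega)
        ((Arena.isQuestionAt_prefix_iff hp (by simpa)).2 (Arena.isQuestionAt_qplay_iff.2 hq))
      rw [Arena.answeredBefore_prefix_iff hp (by simp)] at this
      exact Arena.answeredBefore_qplay_iff.1 this
  · rintro ⟨h1, h2, h3⟩
    have h4 := qplay_mem_iff.2 h1
    refine ⟨h4.1.snoc (by simp) ?_ ?_ ?_, h4.2.1.snoc ?_, ?_, ?_⟩
    · rintro j hj
      cases hj
      exact ⟨_, rfl, rfl, rfl⟩
    · intro _
      rcases hn : l.length with _ | n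
      · obtain rfl := List.length_eq_zero_iff.1 hn
        simp [Arena.playerAt, qplay]
      · rw [qplay_length, hn, Nat.add_sub_cancel, Arena.playerAt_qplay_succ,
          h1.legal.playerAt_eq (by omega)]
        rw [hn, Nat.even_add_one] at h2
        simp [h2, Player.swap]
    · rintro j hj
      cases hj
      have := Arena.viewPos_qplay h1.legal.backward Player.O le_rfl
      change 0 ∈ (A.toArena.arrow sigmaArena).viewPos Player.P (qplay l) (qplay l).length
      rw [qplay_length]
      rw [show Player.O.swap = Player.P from rfl] at this
      rw [this]
      simp
    · rintro j hj -
      cases hj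
      constructor
      · rintro ⟨_ | k, hk, m, h5, h6⟩
        · cases h5
        · rw [qplay_getElem?_succ, Option.map_eq_some_iff] at h5
          obtain ⟨⟨m, _ | p⟩, h7, h8⟩ := h5
          · cases h8
            have := A.initial_question m (h1.legal.justified.1 k m h7)
            simp only [Sum.elim_inl] at h6
            simp [this] at h6
          · cases h8
      · rintro (_ | i) h5 h6 h7
        · omega
        · rw [qplay_length, Arena.answeredBefore_qplay_iff]
          exact h3 i (Arena.isQuestionAt_qplay_iff.1 h7)
    · change right (qaplay l) <+: _
      rw [right_qaplay h1.legal.backward]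
    · change ∀ i, (left (qaplay l)).thread i ∈ A.plays
      rw [left_qaplay h1.legal.backward]
      exact h1.thread_mem

/-- The plays of `A ⇒ Σ` are `ε` and sequences of the forms `q l` and `q l a`. -/
theorem arrow_plays_cases {w : JSeq (A.arrow sigmaGame).Move}
    (h : w ∈ (A.arrow sigmaGame).plays) :
    w = [] ∨ (∃ l, w = qplay l) ∨ ∃ l, w = qaplay l := by
  induction w using List.reverseRecOn with
  | nil => exact Or.inl rfl
  | append_singleton w x ih =>
    have hw := (A.arrow sigmaGame).prefix_mem _ _ h
    obtain ⟨h1, h2, h3, h4⟩ := h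
    have hx : (w ++ [x])[w.length]? = some x := by simp
    rcases ih hw with rfl | ⟨l, rfl⟩ | ⟨l, rfl⟩
    · right; left
      refine ⟨[], ?_⟩
      rcases x with ⟨m, _ | j⟩
      · have := h1.justified.1 0 m rfl
        rcases m with m | m
        · exact this.elim
        · cases this
          rfl
      · have := (h1.justified.2 0 m j rfl).1
        omega
    · have hl := (qplay_mem_iff.1 hw).legal.backward
      right
      rcases x with ⟨m | m, _ | j⟩
      · exact (h1.justified.1 _ _ hx).elim
      · left
        rcases j with _ | j
        · exact ⟨l ++ [(m, none)], by rw [qplay_snoc]; rfl⟩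
        · exact ⟨l ++ [(m, some j)], by rw [qplay_snoc]; rfl⟩
      · exfalso
        obtain rfl : m = .q := h1.justified.1 _ _ hx
        change right _ <+: _ at h3
        rw [right_append_inr _ _ _ h1.backward, right_qplay hl] at h3
        obtain ⟨l', hl'⟩ := h3
        cases hl'
      · right
        refine ⟨l, ?_⟩
        obtain ⟨h5, y, h6, h7⟩ := h1.justified.2 _ _ _ hx
        rw [List.getElem?_append_left h5] at h6
        rcases j with _ | j
        · cases h6
          cases h7.2
          rfl
        · rw [qplay_getElem?_succ, Option.map_eq_some_iff] at h6
          obtain ⟨z, -, rfl⟩ := h6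
          exact h7.elim
    · exfalso
      have hl := (qaplay_mem_iff.1 hw).1.legal
      have hp : qplay l <+: qaplay l := List.prefix_append _ _
      have hlen : (qaplay l).length = l.length + 1 + 1 := by simp [qaplay]
      have e : (qaplay l)[l.length + 1]? = some (.inr .a, some 0) := by
        unfold qaplay
        rw [← qplay_length]
        simp
      have halt : (A.arrow sigmaGame).player x.1 = Player.O := by
        have := h1.alternating (l.length + 1) (.inr .a, some 0) x
          (by rw [List.getElem?_append_left (by omega), e]) (by rw [← hlen]; exact hx)
        cases h : (A.arrow sigmaGame).player x.1
        · rfl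
        · exact absurd h.symm this
      rcases x with ⟨m, _ | j⟩
      · have h5 := h1.justified.1 _ _ hx
        rcases m with m | m
        · exact h5.elim
        · cases h5
          change right _ <+: _ at h3
          rw [right_append_inr _ _ _ h1.backward, right_qaplay hl.backward] at h3
          have := h3.length_le
          simp [sigmaQA] at this
      · have h6 := h1.visible _ _ _ hx
        change (A.toArena.arrow sigmaArena).player m = Player.O at halt
        rw [halt, Arena.viewPos_snoc _ _ _ _ _ le_rfl, hlen] at h6
        have h7 : ptr (qaplay l) (l.length + 1) = some 0 := by
          unfold ptr
          rw [e]
          rfl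
        have h8 : (A.arrow sigmaGame).playerAt (qaplay l) (l.length + 1) ≠ some Player.O := by
          unfold Arena.playerAt
          rw [e]
          simp
        rw [Arena.viewPos_other_some h8 h7 (by omega), Arena.viewPos_zero] at h6
        obtain ⟨h9, y, h10, h11⟩ := h1.justified.2 _ _ _ hx
        rw [List.getElem?_append_left h9] at h10
        simp only [List.nil_append, List.mem_cons, List.not_mem_nil, or_false] at h6
        rcases h6 with rfl | rfl
        · cases h10
          rcases m with m | m
          · have := A.initial_opponent m h11.2
            simp [this, Player.swap] at halt
          · cases h11.2
            simp at halt
        · rw [e] at h10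
          cases h10
          rcases m with m | m
          · cases h11.1
          · cases h11.1

theorem Interleaved.of_prefix {l l' : JSeq A.Move} (h : A.Interleaved l') (hp : l <+: l') :
    A.Interleaved l := by
  obtain ⟨r, rfl⟩ := hp
  induction r using List.reverseRecOn with
  | nil => simpa using h
  | append_singleton r x ih =>
    rw [← List.append_assoc] at h
    rw [← qplay_mem_iff, qplay_snoc] at h
    exact ih (qplay_mem_iff.1 ((A.arrow sigmaGame).prefix_mem _ _ h))

theorem mem_of_prefix {G : Game.{u}} {s t : JSeq G.Move} (ht : t ∈ G.plays) (h : s <+: t) :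
    s ∈ G.plays := by
  obtain ⟨r, rfl⟩ := h
  induction r using List.reverseRecOn with
  | nil => simpa using ht
  | append_singleton r x ih =>
    rw [← List.append_assoc] at ht
    exact ih (G.prefix_mem _ _ ht)

end Game

theorem Strategy.mem_of_prefix {G : Game.{u}} (σ : Strategy G) {s t : JSeq G.Move}
    (ht : t ∈ σ.carrier) (h : s <+: t) (hs : Even s.length) : s ∈ σ.carrier := by
  obtain ⟨r, rfl⟩ := h
  induction hn : r.length using Nat.strong_induction_on generalizing r with
  | _ n ih =>
    have hev := σ.even _ ht
    rw [List.length_append, Nat.even_add] at hev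
    rcases r.eq_nil_or_concat with rfl | ⟨r, y, rfl⟩
    · simpa using ht
    · rcases r.eq_nil_or_concat with rfl | ⟨r, x, rfl⟩
      · simp [hs] at hev
      · refine ih r.length (by simp at hn; omega) r (σ.prefix_mem _ x y ?_) rfl
        simpa using ht

namespace Arena
variable {A : Arena.{u}}

/-- Justifiers of occurrences in a view lie in that view. -/
theorem Legal.ptr_mem_chain {s : JSeq A.Move} (hs : A.Legal s) {X : Player} {n i j : ℕ}
    (hi : i ∈ chain (A.pred X s) n) (hj : ptr s i = some j) : j ∈ chain (A.pred X s) n := by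
  by_cases ho : A.playerAt s i = some X
  · obtain ⟨h1, h2⟩ := hs.ptr_mem_viewPos hj ho
    refine mem_chain_trans (mem_chain_of_some hi (j := i - 1) ?_ (by omega)) h2
    rw [pred, if_pos ho, if_neg (by omega)]
  · refine mem_chain_of_some hi (j := j) ?_ (hs.backward.ptr_lt hj)
    rw [pred, if_neg ho, hj]

theorem Legal.viewPos_closed {s : JSeq A.Move} (hs : A.Legal s) {X : Player} {n i j : ℕ}
    (hn : n ≤ s.length) (hi : i ∈ A.viewPos X s n) (hj : ptr s i = some j) :
    j ∈ A.viewPos X s n := by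
  rcases n with _ | n
  · simp [viewPos_zero] at hi
  · rw [hs.justified.viewPos_succ X (by omega)] at hi ⊢
    exact hs.ptr_mem_chain hi hj

/-- The participants of `A ⇒ Σ` see the moves made in `A` as the opposite participants of `A`
do. -/
theorem view_qplay {l : JSeq A.Move} (hl : A.Legal l) (X : Player) :
    (A.arrow sigmaArena).view X.swap (qplay l) = qplay (A.view X l) := by
  unfold view
  rw [qplay_length, viewPos_qplay hl.backward X le_rfl, qplay]
  have key : ∀ i ∈ A.viewPos X l l.length, ∃ y, l[i]? = some y ∧
      ∀ j, y.2 = some j → j ∈ A.viewPos X l l.length := by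
    intro i hi
    have h1 := lt_of_mem_viewPos hi
    refine ⟨_, List.getElem?_eq_getElem h1, fun j hj => ?_⟩
    exact hl.viewPos_closed le_rfl hi (by rw [ptr, List.getElem?_eq_getElem h1]; exact hj)
  generalize A.viewPos X l l.length = V at key ⊢
  unfold JSeq.sub qplay
  rw [List.filterMap_cons, List.filterMap_map, List.map_filterMap]
  simp only [List.getElem?_cons_zero, Option.map_some, Option.bind_none]
  congr 1
  refine List.filterMap_congr fun i hi => ?_
  obtain ⟨⟨m, p⟩, h1, h2⟩ := key i hi
  simp only [Function.comp_apply, Nat.succ_eq_add_one, List.getElem?_cons_succ,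
    List.getElem?_map, h1, Option.map_some, Option.some.injEq]
  rcases p with _ | j
  · simp [liftEntry, List.idxOf?, List.findIdx?_cons]
  · obtain ⟨a, ha⟩ := idxOf?_isSome (h2 j rfl)
    have h3 : (0 :: V.map Nat.succ).idxOf? (j + 1) = some (a + 1) := by
      have h4 : (V.map Nat.succ).idxOf? (Nat.succ j) = some a := by
        rw [idxOf?_map (by simp), ha]
      rw [List.idxOf?, List.findIdx?_cons]
      simp only [beq_iff_eq, Nat.right_eq_add, Nat.add_eq_zero_iff, one_ne_zero, and_false,
        if_false]
      rw [List.idxOf?] at h4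
      simp [h4]
    simp only [liftEntry, Option.elim_some, Option.bind_some, ha]
    rw [h3]

theorem view_qplay_P {l : JSeq A.Move} (hl : A.Legal l) :
    (A.arrow sigmaArena).view Player.P (qplay l) = qplay (A.view Player.O l) :=
  view_qplay hl Player.O

end Arena

/-! ### Threads -/

namespace JSeq
variable {M : Type u}

/-- The positions of the thread of the occurrence at position `i`. -/
def threadPos (s : JSeq M) (i : ℕ) : List ℕ :=
  (List.range s.length).filter fun n => root s n = i

theorem thread_eq (s : JSeq M) (i : ℕ) : s.thread i = s.sub (threadPos s i) := rfl

theorem threadPos_sorted (s : JSeq M) (i : ℕ) : (threadPos s i).Pairwise (· < ·) :=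
  List.pairwise_lt_range.filter _

theorem mem_threadPos {s : JSeq M} {i n : ℕ} :
    n ∈ threadPos s i ↔ n < s.length ∧ root s n = i := by
  simp [threadPos]

theorem threadPos_lt (s : JSeq M) (i : ℕ) : ∀ n ∈ threadPos s i, n < s.length :=
  fun _ hn => (mem_threadPos.1 hn).1

theorem thread_length (s : JSeq M) (i : ℕ) : (s.thread i).length = (threadPos s i).length :=
  sub_length _ _ (threadPos_lt s i)

theorem threadPos_snoc (s : JSeq M) (x : M × Option ℕ) (i : ℕ) :
    threadPos (s ++ [x]) i =
      threadPos s i ++ if root (s ++ [x]) s.length = i then [s.length] else [] := by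
  unfold threadPos
  rw [List.length_append, List.length_singleton, List.range_succ, List.filter_append]
  congr 1
  · refine List.filter_congr fun n hn => ?_
    rw [root_snoc s x n (List.mem_range.1 hn)]
  · by_cases h : root (s ++ [x]) s.length = i <;> simp [h]

theorem thread_snoc_self {s : JSeq M} {x : M × Option ℕ} {i : ℕ} (hs : Backward (s ++ [x]))
    (h : root (s ++ [x]) s.length = i) :
    (s ++ [x]).thread i =
      s.thread i ++ [(x.1, x.2.bind fun j => (threadPos s i).idxOf? j)] := by
  rw [thread_eq, threadPos_snoc, if_pos h, sub_append_last _ _ _ (threadPos_lt s i) hs]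
  rfl

theorem thread_snoc_other {s : JSeq M} {x : M × Option ℕ} {i : ℕ}
    (h : root (s ++ [x]) s.length ≠ i) : (s ++ [x]).thread i = s.thread i := by
  rw [thread_eq, threadPos_snoc, if_neg h, List.append_nil, thread_eq]
  exact sub_congr fun n hn => List.getElem?_append_left (threadPos_lt s i n hn)

theorem thread_prefix {s t : JSeq M} (ht : Backward t) (h : s <+: t) (i : ℕ) :
    s.thread i <+: t.thread i := by
  obtain ⟨l, rfl⟩ := h
  induction l using List.reverseRecOn with
  | nil => simp
  | append_singleton l x ih =>
    rw [← List.append_assoc] at ht ⊢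
    refine (ih ht.init).trans ?_
    by_cases h : root (s ++ l ++ [x]) (s ++ l).length = i
    · rw [thread_snoc_self ht h]
      exact List.prefix_append _ _
    · rw [thread_snoc_other h]

theorem threadPos_closed {s : JSeq M} (hs : Backward s) {i n j : ℕ} (hn : n ∈ threadPos s i)
    (hj : ptr s n = some j) : j ∈ threadPos s i := by
  rw [mem_threadPos] at hn ⊢
  have := hs.ptr_lt hj
  exact ⟨by omega, by rw [← hn.2, root_some hj this]⟩

theorem thread_ptr {s : JSeq M} {i a : ℕ} (ha : a < (threadPos s i).length) :
    ptr (s.thread i) a = (ptr s (posAt (threadPos s i) a)).bind fun j =>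
      (threadPos s i).idxOf? j :=
  sub_ptr _ _ (threadPos_lt s i) a ha

theorem thread_ptr_none {s : JSeq M} (hs : Backward s) {i a : ℕ}
    (ha : a < (threadPos s i).length) (h : ptr (s.thread i) a = none) :
    posAt (threadPos s i) a = i := by
  have hm := posAt_mem ha
  rw [thread_ptr ha] at h
  rcases hp : ptr s (posAt (threadPos s i) a) with _ | j
  · exact (root_none hp).symm.trans (mem_threadPos.1 hm).2
  · obtain ⟨b, hb⟩ := idxOf?_isSome (threadPos_closed hs hm hp)
    rw [hp, Option.bind_some, hb] at h
    cases h

/-- A non-empty thread starts with the occurrence that defines it. -/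
theorem threadPos_head {s : JSeq M} (hs : Backward s) {i : ℕ} (h : threadPos s i ≠ []) :
    i < s.length ∧ ptr s i = none ∧ root s i = i ∧ posAt (threadPos s i) 0 = i := by
  obtain ⟨n, hn⟩ := List.exists_mem_of_ne_nil _ h
  rw [mem_threadPos] at hn
  have h1 := hs.ptr_root n
  rw [hn.2] at h1
  have h2 := root_le s n
  have h3 := root_none h1
  have h0 : 0 < (threadPos s i).length := List.length_pos_iff.2 h
  refine ⟨by omega, h1, h3, ?_⟩
  refine thread_ptr_none hs h0 ?_
  rcases hp : ptr (s.thread i) 0 with _ | j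
  · rfl
  · have := (hs.sub (threadPos_sorted s i) (threadPos_lt s i)).ptr_lt hp
    omega

theorem thread_singleThreaded {s : JSeq M} (hs : Backward s) {i : ℕ}
    (h : s.thread i ≠ []) : (s.thread i).SingleThreaded := by
  have hlen : 0 < (threadPos s i).length := by
    rw [← thread_length]
    exact List.length_pos_iff.2 h
  obtain ⟨h1, h2, h3, h4⟩ := threadPos_head hs (List.length_pos_iff.1 hlen)
  refine ⟨0, ⟨(s[i]).1, ?_⟩, ?_⟩
  · rw [thread_eq, sub_getElem? _ _ (threadPos_lt s i) 0 hlen, h4]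
    unfold ptr at h2
    rw [List.getElem?_eq_getElem h1] at h2 ⊢
    simp only [Option.bind_some] at h2
    simp [h2]
  · rintro a ⟨m, ha⟩
    have ha' : a < (threadPos s i).length := by
      rw [← thread_length]
      exact (List.getElem?_eq_some_iff.1 ha).1
    have := thread_ptr_none hs ha' (by simp [ptr, ha])
    exact posAt_inj (threadPos_sorted s i) ha' hlen (this.trans h4.symm)

end JSeq

namespace Arena
variable {A : Arena.{u}}

theorem root_of_mem_chain_of_switch {s : JSeq A.Move} {n i : ℕ}
    (ih : ∀ k ≤ n, A.playerAt s k = some Player.P → root s k = root s (k - 1))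
    (hi : i ∈ chain (A.pred Player.P s) n) : root s i = root s n := by
  refine (chain_subset_of_closed (fun i => i ≤ n ∧ root s i = root s n) ⟨le_rfl, rfl⟩ ?_ i hi).2
  rintro i j - ⟨h1, h2⟩ h3 h4
  refine ⟨by omega, ?_⟩
  rw [← h2]
  unfold pred at h3
  split_ifs at h3 with h5 h6
  · cases h3
    exact (ih i h1 h5).symm
  · exact (root_some h3 h4).symm

/-- Player moves in the thread in which Opponent has just moved. -/
theorem Legal.root_switch {s : JSeq A.Move} (hs : A.Legal s) {n : ℕ}
    (hP : A.playerAt s n = some Player.P) : root s n = root s (n - 1) := by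
  induction n using Nat.strong_induction_on with
  | _ n ih =>
    have hn : n < s.length := by
      by_contra h
      simp [playerAt, List.getElem?_eq_none (not_lt.1 h)] at hP
    rcases hp : ptr s n with _ | j
    · rw [hs.justified.playerAt_of_ptr_none hn hp] at hP
      cases hP
    · obtain ⟨h1, h2⟩ := hs.ptr_mem_viewPos hp hP
      rw [root_some hp (hs.backward.ptr_lt hp)]
      exact root_of_mem_chain_of_switch (fun k hk => ih k (by omega)) h2

theorem playerAt_thread {s : JSeq A.Move} {i a : ℕ} (ha : a < (threadPos s i).length) :
    A.playerAt (s.thread i) a = A.playerAt s (posAt (threadPos s i) a) :=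
  playerAt_sub (threadPos_lt s i) ha

theorem Legal.threadPos_pred_P {s : JSeq A.Move} (hs : A.Legal s) {i n j : ℕ}
    (hn : n ∈ threadPos s i) (hj : A.pred Player.P s n = some j) : j ∈ threadPos s i := by
  unfold pred at hj
  split_ifs at hj with h1 h2
  · cases hj
    rw [mem_threadPos] at hn ⊢
    exact ⟨by omega, by rw [← hs.root_switch h1, hn.2]⟩
  · exact threadPos_closed hs.backward hn hj

/-- The P-view of an interleaving is the P-view of the current thread. -/
theorem Legal.chain_thread {s : JSeq A.Move} (hs : A.Legal s) {i a : ℕ}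
    (ha : a < (threadPos s i).length) :
    chain (A.pred Player.P s) (posAt (threadPos s i) a) =
      (chain (A.pred Player.P (s.thread i)) a).map (posAt (threadPos s i)) :=
  chain_pred_sub hs.backward (threadPos_sorted s i) (threadPos_lt s i) Player.P (fun _ => True)
    (fun _ hn _ _ hj => ⟨hs.threadPos_pred_P hn hj, trivial⟩) ha trivial

theorem Legal.viewAt_thread {s : JSeq A.Move} (hs : A.Legal s) {i a : ℕ}
    (ha : a < (threadPos s i).length) :
    A.viewAt Player.P s (posAt (threadPos s i) a) = A.viewAt Player.P (s.thread i) a :=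
  viewAt_sub hs.backward (threadPos_sorted s i) (threadPos_lt s i) Player.P (fun _ => True)
    (fun _ hn _ _ hj => ⟨hs.threadPos_pred_P hn hj, trivial⟩) ha trivial

theorem posAt_threadPos_last {M : Type u} {s : JSeq M} {n i : ℕ} (hn : s.length = n + 1)
    (hi : root s n = i) : (s.thread i).length - 1 < (threadPos s i).length ∧
      posAt (threadPos s i) ((s.thread i).length - 1) = n := by
  rw [thread_length]
  have hm : n ∈ threadPos s i := mem_threadPos.2 ⟨by omega, hi⟩
  have h0 : 0 < (threadPos s i).length := List.length_pos_of_mem hm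
  obtain ⟨a, ha, h⟩ := exists_posAt_of_mem hm
  refine ⟨by omega, ?_⟩
  by_contra hne
  have h1 : a < (threadPos s i).length - 1 := by
    by_contra h2
    apply hne
    rw [← h]
    congr 1
    omega
  have h2 := posAt_lt_posAt (threadPos_sorted s i) h1 (by omega)
  have h3 := threadPos_lt s i _ (posAt_mem (K := threadPos s i)
    (a := (threadPos s i).length - 1) (by omega))
  omega

/-- When it is Opponent's turn in an interleaving, it is Opponent's turn in each thread. -/
theorem Legal.even_thread {s : JSeq A.Move} (hs : A.Legal s) (hev : Even s.length) {i : ℕ}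
    (hi : A.Legal (s.thread i)) : Even (s.thread i).length := by
  by_contra hodd
  have h0 : (s.thread i).length ≠ 0 := fun h => hodd (by simp [h])
  set a := (s.thread i).length - 1 with ha
  have ha' : a < (threadPos s i).length := by
    rw [← thread_length]
    omega
  have hO : A.playerAt (s.thread i) a = some Player.O := by
    rw [hi.playerAt_eq_O_iff (by omega)]
    obtain ⟨k, hk⟩ := Nat.not_even_iff_odd.1 hodd
    exact ⟨k, by omega⟩
  rw [playerAt_thread ha'] at hO
  have hm := mem_threadPos.1 (posAt_mem ha')
  rw [hs.playerAt_eq_O_iff hm.1] at hO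
  have hlt : posAt (threadPos s i) a + 1 < s.length := by
    obtain ⟨k, hk⟩ := hO
    obtain ⟨k', hk'⟩ := hev
    omega
  have hP : A.playerAt s (posAt (threadPos s i) a + 1) = some Player.P := by
    rw [hs.playerAt_eq_P_iff hlt, Nat.even_add_one, not_not]
    exact hO
  have hr := hs.root_switch hP
  rw [Nat.add_sub_cancel, hm.2] at hr
  obtain ⟨b, hb, e⟩ := exists_posAt_of_mem (mem_threadPos.2 ⟨hlt, hr⟩)
  have := lt_of_posAt_lt (threadPos_sorted s i) ha' hb (by omega)
  rw [← thread_length] at hb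
  omega

theorem isQuestionAt_thread {s : JSeq A.Move} {i a : ℕ} (ha : a < (threadPos s i).length) :
    A.IsQuestionAt (s.thread i) a ↔ A.IsQuestionAt s (posAt (threadPos s i) a) := by
  unfold IsQuestionAt
  rw [thread_eq, sub_getElem? _ _ (threadPos_lt s i) a ha]
  rcases s[posAt (threadPos s i) a]? with _ | ⟨m, p⟩ <;> simp

theorem answeredBefore_iff_ptr {s : JSeq A.Move} {i n : ℕ} :
    A.AnsweredBefore s i n ↔ ∃ k < n, ptr s k = some i ∧
      (s[k]?).map (fun x => A.kind x.1) = some Kind.answer := by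
  unfold AnsweredBefore ptr
  refine exists_congr fun k => and_congr_right fun _ => ?_
  rcases s[k]? with _ | ⟨m, p⟩
  · simp
  · simp

theorem answeredBefore_thread {s : JSeq A.Move} (hs : Backward s) {i a : ℕ}
    (ha : a < (threadPos s i).length) :
    A.AnsweredBefore (s.thread i) a (s.thread i).length ↔
      A.AnsweredBefore s (posAt (threadPos s i) a) s.length := by
  rw [answeredBefore_iff_ptr, answeredBefore_iff_ptr, thread_length]
  have key : ∀ k < (threadPos s i).length,
      ((s.thread i)[k]?).map (fun x => A.kind x.1) =
        (s[posAt (threadPos s i) k]?).map fun x => A.kind x.1 := by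
    intro k hk
    rw [thread_eq, sub_getElem? _ _ (threadPos_lt s i) k hk, Option.map_map]
    rfl
  constructor
  · rintro ⟨k, hk, h1, h2⟩
    refine ⟨posAt (threadPos s i) k, threadPos_lt s i _ (posAt_mem hk), ?_, by rw [← key k hk, h2]⟩
    rw [thread_ptr hk] at h1
    rcases hp : ptr s (posAt (threadPos s i) k) with _ | j
    · simp [hp] at h1
    · rw [hp, Option.bind_some] at h1
      rw [(idxOf?_eq_some h1).2]
  · rintro ⟨k, hk, h1, h2⟩
    have hm : k ∈ threadPos s i := by
      rw [mem_threadPos, root_some h1 (hs.ptr_lt h1)]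
      exact ⟨hk, (mem_threadPos.1 (posAt_mem ha)).2⟩
    obtain ⟨b, hb, rfl⟩ := exists_posAt_of_mem hm
    refine ⟨b, hb, ?_, by rw [key b hb, h2]⟩
    rw [thread_ptr hb, h1, Option.bind_some, idxOf?_posAt (threadPos_sorted s i) ha]

theorem Complete.thread {s : JSeq A.Move} (hs : A.Complete s) (hb : Backward s) (i : ℕ) :
    A.Complete (s.thread i) := by
  intro a hq
  have ha : a < (threadPos s i).length := by
    obtain ⟨x, hx, -⟩ := hq
    rw [← thread_length]
    exact (List.getElem?_eq_some_iff.1 hx).1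
  rw [answeredBefore_thread hb ha]
  exact hs _ ((isQuestionAt_thread ha).1 hq)

/-- If Opponent has just moved at `n`, then a pending question of another thread is
followed by a pending question of the current thread: the last pending question belongs to the
current thread. -/
theorem Legal.exists_pending {s : JSeq A.Move} (hs : A.Legal s) (hw : A.WellBracketed s)
    {n : ℕ} (hn : n < s.length) (hO : A.playerAt s n = some Player.O) {i : ℕ} (hi : i ≤ n)
    (hq : A.IsQuestionAt s i) (hr : root s i ≠ root s n)
    (hna : ¬ A.AnsweredBefore s i (n + 1)) :
    ∃ i', i < i' ∧ i' ≤ n ∧ root s i' = root s n ∧ A.IsQuestionAt s i' ∧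
      ¬ A.AnsweredBefore s i' (n + 1) := by
  induction n using Nat.strong_induction_on with
  | _ n ih =>
    have hin : i ≠ n := by
      rintro rfl
      exact hr rfl
    have hsn := List.getElem?_eq_getElem hn
    by_cases hk : A.kind s[n].1 = Kind.question
    · refine ⟨n, by omega, le_rfl, rfl, ⟨_, hsn, hk⟩, ?_⟩
      rintro ⟨k, h1, m, h2, -⟩
      have := hs.backward k m n h2
      omega
    · have hka : A.kind s[n].1 = Kind.answer := by
        cases h : A.kind s[n].1 <;> simp_all
      rcases hp : s[n].2 with _ | m
      · have := A.initial_question _ (hs.justified.1 n s[n].1 (by rw [hsn, ← hp]))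
        exact absurd this hk
      · have hsn' : s[n]? = some (s[n].1, some m) := by rw [hsn, ← hp]
        have hptr : ptr s n = some m := by simp [ptr, hsn, hp]
        obtain ⟨h1, h2⟩ := hw n _ m hsn' hka
        obtain ⟨h3, y, h4, h5⟩ := hs.justified.2 n _ m hsn'
        have hrm : root s n = root s m := root_some hptr h3
        have him : i < m := by
          rcases Nat.lt_trichotomy i m with h | rfl | h
          · exact h
          · exact absurd hrm.symm hr
          · obtain ⟨k, hk, r⟩ := h2 i h (by omega) hq
            exact absurd ⟨k, by omega, r⟩ hna
        have hmP : A.playerAt s m = some Player.P := by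
          have := (hs.justified.playerAt_ptr hptr).1
          rcases playerAt_isSome (A := A) (h3.trans hn) with h | h
          · rw [h, hO] at this
            exact absurd rfl this
          · exact h
        have hsw := hs.root_switch hmP
        have hm1O : A.playerAt s (m - 1) = some Player.O := by
          rw [hs.playerAt_eq_O_iff (by omega)]
          rw [hs.playerAt_eq_P_iff (by omega)] at hmP
          obtain ⟨k, hk⟩ := Nat.not_even_iff_odd.1 hmP
          exact ⟨k, by omega⟩
        obtain ⟨i', g1, g2, g3, g4, g5⟩ := ih (m - 1) (by omega) (by omega) hm1O (by omega)
          (by rw [← hsw, ← hrm]; exact hr)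
          (fun ⟨k, hk, r⟩ => hna ⟨k, by omega, r⟩)
        refine ⟨i', g1, by omega, by rw [g3, ← hsw, hrm], g4, ?_⟩
        rintro ⟨k, e1, m', e2, e3⟩
        have e4 : m ≤ k := by
          by_contra e4
          exact g5 ⟨k, by omega, m', e2, e3⟩
        have hmq : A.kind y.1 = Kind.question := A.answer_enabled _ _ h5 hka
        rcases (show k = n ∨ k = m ∨ (m < k ∧ k < n) by omega) with rfl | rfl | ⟨e5, e6⟩
        · rw [hsn'] at e2
          cases e2
          omega
        · rw [h4] at e2
          cases e2
          rw [hmq] at e3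
          cases e3
        · obtain ⟨k', e7, r⟩ := (hw k m' i' e2 e3).2 m (by omega) e5 ⟨y, h4, hmq⟩
          exact h1 ⟨k', by omega, r⟩

end Arena

namespace Game
variable {A : Game.{u}}

/-- A P-move that is possible in the current thread is possible in the interleaving. An answer stays
well-bracketed because the last pending question belongs to the current thread. -/
theorem Interleaved.extend {l : JSeq A.Move} (hl : A.Interleaved l) {n : ℕ}
    (hn : l.length = n + 1) (hO : A.playerAt l n = some Player.O) {c : A.Move × Option ℕ}
    (hc : l.thread (root l n) ++ [c] ∈ A.plays) (hcP : A.player c.1 = Player.P) :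
    ∃ j e, c.2 = some e ∧ j = posAt (threadPos l (root l n)) e ∧
      e < (threadPos l (root l n)).length ∧
      j ∈ chain (A.pred Player.P l) n ∧
      A.Interleaved (l ++ [(c.1, some j)]) ∧
      root (l ++ [(c.1, some j)]) l.length = root l n ∧
      (l ++ [(c.1, some j)]).thread (root l n) = l.thread (root l n) ++ [c] := by
  set y := root l n with hy
  set θ := l.thread y with hθ
  have hcl := A.legal _ hc
  have hcw := A.wellBracketed _ hc
  have hθc : (θ ++ [c])[θ.length]? = some c := by simp
  obtain ⟨hlast, hlast'⟩ := Arena.posAt_threadPos_last hn hy.symm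
  have hθpos : 0 < θ.length := by
    rw [hθ, thread_length]
    omega
  rcases hc2 : c.2 with _ | e
  · have := A.initial_opponent _ (hcl.justified.1 θ.length c.1 (by rw [hθc, ← hc2]))
    rw [hcP] at this
    cases this
  have hθc' : (θ ++ [c])[θ.length]? = some (c.1, some e) := by rw [hθc, ← hc2]
  obtain ⟨he, z, hz1, hz2⟩ := hcl.justified.2 _ _ _ hθc'
  rw [List.getElem?_append_left he] at hz1
  have he' : e < (threadPos l y).length := by
    rw [← thread_length]
    exact he
  set j := posAt (threadPos l y) e with hj
  have hθl : A.Legal θ := hcl.init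
  have hev : e ∈ chain (A.pred Player.P θ) (θ.length - 1) := by
    have := hcl.visible _ _ _ hθc'
    rw [hcP, A.viewPos_snoc _ _ _ _ le_rfl] at this
    rwa [← hθl.justified.viewPos_succ Player.P (by omega), Nat.sub_add_cancel hθpos]
  have hjv : j ∈ chain (A.pred Player.P l) n := by
    rw [← hlast', hl.legal.chain_thread hlast]
    exact List.mem_map_of_mem hev
  have hjm := mem_threadPos.1 (posAt_mem he')
  have hL : A.Legal (l ++ [(c.1, some j)]) := by
    refine hl.legal.snoc (by simp) ?_ ?_ ?_
    · rintro j' hj'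
      cases hj'
      rw [hθ, thread_eq, sub_getElem? _ _ (threadPos_lt l y) e he', Option.map_eq_some_iff] at hz1
      obtain ⟨x, hx1, hx2⟩ := hz1
      exact ⟨x, hx1, by rw [← hx2] at hz2; exact hz2⟩
    · intro _
      rw [hn, Nat.add_sub_cancel, hO, hcP]
      simp
    · rintro j' hj'
      cases hj'
      rw [hcP, hn, hl.legal.justified.viewPos_succ Player.P (by omega)]
      exact hjv
  have hroot : root (l ++ [(c.1, some j)]) l.length = y := by
    rw [root_some (j := j) (by simp [ptr]) hjm.1, root_snoc _ _ _ hjm.1, hjm.2]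
  have hthread : (l ++ [(c.1, some j)]).thread y = θ ++ [c] := by
    rw [thread_snoc_self hL.backward hroot]
    simp only [Option.bind_some]
    rw [hj, idxOf?_posAt (threadPos_sorted l y) he', ← hc2]
  refine ⟨j, e, rfl, rfl, he', hjv, ⟨hL, hl.wellBracketed.snoc ?_, ?_⟩, hroot, hthread⟩
  · rintro j' hj' hca
    cases hj'
    obtain ⟨w1, w2⟩ := hcw _ _ _ hθc' hca
    have hpre : θ <+: θ ++ [c] := List.prefix_append _ _
    rw [Arena.answeredBefore_prefix_iff hpre le_rfl] at w1
    refine ⟨fun h => w1 ((Arena.answeredBefore_thread hl.legal.backward he').2 h), ?_⟩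
    have key : ∀ i, j < i → i ∈ threadPos l y → A.IsQuestionAt l i →
        A.AnsweredBefore l i l.length := by
      intro i hji him hq
      obtain ⟨a, ha, rfl⟩ := exists_posAt_of_mem him
      have hea := lt_of_posAt_lt (threadPos_sorted l y) he' ha hji
      have haθ : a < θ.length := by rwa [hθ, thread_length]
      have := w2 a hea haθ
        ((Arena.isQuestionAt_prefix_iff hpre haθ).2 ((Arena.isQuestionAt_thread ha).2 hq))
      rw [Arena.answeredBefore_prefix_iff hpre le_rfl] at this
      exact (Arena.answeredBefore_thread hl.legal.backward ha).1 this
    intro i hji hil hq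
    by_cases him : i ∈ threadPos l y
    · exact key i hji him hq
    · by_contra hna
      rw [mem_threadPos, not_and] at him
      obtain ⟨i', h1, h2, h3, h4, h5⟩ := hl.legal.exists_pending hl.wellBracketed (n := n)
        (by omega) hO (i := i) (by omega) hq (him hil) (by rwa [← hn])
      rw [← hn] at h5
      exact h5 (key i' (by omega) (mem_threadPos.2 ⟨by omega, h3⟩) h4)
  · intro i
    by_cases hi : y = i
    · rw [← hi, hthread]
      exact hc
    · rw [thread_snoc_other (by rwa [hroot])]
      exact hl.thread_mem i

end Game

/-! ### Single-threaded sequences and O-views -/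

namespace JSeq

theorem idxOf?_injOn {V : List ℕ} {i j : ℕ} (hi : i ∈ V) (h : V.idxOf? i = V.idxOf? j) :
    i = j := by
  obtain ⟨a, ha⟩ := idxOf?_isSome hi
  exact (idxOf?_eq_some ha).2.symm.trans (idxOf?_eq_some (h ▸ ha)).2

theorem bind_idxOf?_injOn {V : List ℕ} {p r : Option ℕ} (hp : ∀ j, p = some j → j ∈ V)
    (hr : ∀ j, r = some j → j ∈ V)
    (h : (p.bind fun j => V.idxOf? j) = r.bind fun j => V.idxOf? j) : p = r := by
  rcases p with _ | i <;> rcases r with _ | j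
  · rfl
  · obtain ⟨a, ha⟩ := idxOf?_isSome (hr j rfl)
    simp [ha] at h
  · obtain ⟨a, ha⟩ := idxOf?_isSome (hp i rfl)
    simp [ha] at h
  · simp only [Option.bind_some] at h
    rw [idxOf?_injOn (hp i rfl) h]

theorem SingleThreaded.ptr_ne_none {M : Type u} {s : JSeq M} (hs : s.SingleThreaded)
    (hb : Backward s) {i : ℕ} (hi : i < s.length) (h0 : i ≠ 0) : ptr s i ≠ none := by
  obtain ⟨a, ⟨m, ha⟩, hu⟩ := hs
  have key : ∀ n < s.length, ptr s n = none → n = a := by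
    intro n hn h
    refine hu n ⟨s[n].1, ?_⟩
    unfold ptr at h
    rw [List.getElem?_eq_getElem hn] at h ⊢
    simp only [Option.bind_some] at h
    rw [← h]
  intro h
  exact h0 ((key i hi h).trans (key 0 (by omega) hb.ptr_zero).symm)

theorem SingleThreaded.ne_nil {M : Type u} {s : JSeq M} (hs : s.SingleThreaded) : s ≠ [] := by
  rintro rfl
  obtain ⟨a, ⟨m, ha⟩, -⟩ := hs
  simp at ha

theorem singleThreaded_of_ptr {M : Type u} {s : JSeq M} (hb : Backward s) (h0 : s ≠ [])
    (h : ∀ i < s.length, i ≠ 0 → ptr s i ≠ none) : s.SingleThreaded := by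
  have hl := List.length_pos_iff.2 h0
  have hp := hb.ptr_zero
  refine ⟨0, ⟨s[0].1, ?_⟩, ?_⟩
  · unfold ptr at hp
    rw [List.getElem?_eq_getElem hl] at hp ⊢
    simp only [Option.bind_some] at hp
    rw [← hp]
  · rintro i ⟨m, hi⟩
    by_contra hne
    exact h i (List.getElem?_eq_some_iff.1 hi).1 hne (by simp [ptr, hi])

theorem SingleThreaded.of_prefix {M : Type u} {s t : JSeq M} (ht : t.SingleThreaded)
    (hb : Backward t) (h : s <+: t) (h0 : s ≠ []) : s.SingleThreaded := by
  refine singleThreaded_of_ptr (hb.of_prefix h) h0 fun i hi hne => ?_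
  rw [← ptr_of_prefix h hi]
  exact ht.ptr_ne_none hb (hi.trans_le h.length_le) hne

theorem SingleThreaded.root_eq {M : Type u} {s : JSeq M} (hs : s.SingleThreaded)
    (hb : Backward s) {i : ℕ} (hi : i < s.length) : root s i = 0 := by
  by_contra hne
  exact hs.ptr_ne_none hb ((root_le s i).trans_lt hi) hne (hb.ptr_root i)

end JSeq

namespace Arena
variable {A : Arena.{u}}

theorem Justified.view_last {s : JSeq A.Move} {x : A.Move × Option ℕ}
    (hs : A.Justified (s ++ [x])) (X : Player) :
    ∃ v p, A.view X (s ++ [x]) = v ++ [(x.1, p)] := by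
  rw [hs.view_snoc_eq]
  unfold viewAt
  have : ∃ l, chain (A.pred X (s ++ [x])) s.length = l ++ [s.length] := by
    rcases chain_cases (A.pred X (s ++ [x])) s.length with ⟨-, h⟩ | ⟨j, -, -, h⟩
    · exact ⟨[], h⟩
    · exact ⟨_, h⟩
  obtain ⟨l, hl⟩ := this
  rw [hl]
  unfold JSeq.sub
  rw [List.filterMap_append]
  exact ⟨_, (x.2.bind fun j => (l ++ [s.length]).idxOf? j), by simp; rfl⟩

theorem Justified.view_ne_nil {s : JSeq A.Move} (hs : A.Justified s) (h0 : s ≠ [])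
    (X : Player) : A.view X s ≠ [] := by
  rcases s.eq_nil_or_concat with rfl | ⟨s, x, rfl⟩
  · exact absurd rfl h0
  · rw [List.concat_eq_append] at hs ⊢
    obtain ⟨v, p, h⟩ := hs.view_last X
    rw [h]
    simp

/-- A move of `X` is determined by the `X`-view that it produces. -/
theorem eq_of_view_eq {l : JSeq A.Move} {X : Player} {b c : A.Move × Option ℕ}
    (hb : A.Legal (l ++ [b])) (hc : A.Legal (l ++ [c])) (hbX : A.player b.1 = X)
    (hcX : A.player c.1 = X) (h : A.view X (l ++ [b]) = A.view X (l ++ [c])) : b = c := by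
  rw [view_snoc_own hb.backward hbX, view_snoc_own hc.backward hcX] at h
  have h := List.append_cancel_left h
  simp only [List.cons.injEq, Prod.mk.injEq, and_true] at h
  refine Prod.ext h.1 (bind_idxOf?_injOn ?_ ?_ h.2)
  · intro j hj
    have := hb.visible l.length b.1 j (by simp [← hj])
    rwa [hbX, A.viewPos_snoc _ _ _ _ le_rfl] at this
  · intro j hj
    have := hc.visible l.length c.1 j (by simp [← hj])
    rwa [hcX, A.viewPos_snoc _ _ _ _ le_rfl] at this

theorem exists_of_mem_ovw {s l : JSeq A.Move} {b : A.Move × Option ℕ} (hs : A.Legal s)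
    (hl : A.Legal (l ++ [b])) (h : A.view Player.O (l ++ [b]) ∈ A.ovw s) :
    ∃ s' x, s' ++ [x] <+: s ∧ A.player x.1 = A.player b.1 ∧
      A.view Player.O (l ++ [b]) = A.view Player.O (s' ++ [x]) := by
  obtain ⟨t, ht, e⟩ := h
  rcases t.eq_nil_or_concat with rfl | ⟨s', x, rfl⟩
  · exact absurd (e.trans (view_nil _)) (hl.justified.view_ne_nil (by simp) _)
  · rw [List.concat_eq_append] at ht e
    refine ⟨s', x, ht, ?_, e⟩
    obtain ⟨v, p, h1⟩ := hl.justified.view_last Player.O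
    obtain ⟨v', p', h2⟩ := (hs.of_prefix ht).justified.view_last Player.O
    rw [h1, h2] at e
    have := (List.append_inj' e rfl).2
    simp only [List.cons.injEq, Prod.mk.injEq, and_true] at this
    rw [this.1]

/-- In an O-innocent sequence the O-views determine Opponent's next move. -/
theorem OInnocent.view_eq {s : JSeq A.Move} (hs : A.Legal s) (hi : A.OInnocent s)
    {l₁ l₂ : JSeq A.Move} {b₁ b₂ : A.Move × Option ℕ} (h₁ : A.Legal (l₁ ++ [b₁]))
    (h₂ : A.Legal (l₂ ++ [b₂])) (hO₁ : A.player b₁.1 = Player.O)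
    (hO₂ : A.player b₂.1 = Player.O) (hv₁ : A.view Player.O (l₁ ++ [b₁]) ∈ A.ovw s)
    (hv₂ : A.view Player.O (l₂ ++ [b₂]) ∈ A.ovw s)
    (h : A.view Player.O l₁ = A.view Player.O l₂) :
    A.view Player.O (l₁ ++ [b₁]) = A.view Player.O (l₂ ++ [b₂]) := by
  obtain ⟨s₁, x₁, p₁, q₁, e₁⟩ := exists_of_mem_ovw hs h₁ hv₁
  obtain ⟨s₂, x₂, p₂, q₂, e₂⟩ := exists_of_mem_ovw hs h₂ hv₂
  rw [hO₁] at q₁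
  rw [hO₂] at q₂
  rw [e₁, e₂]
  refine hi s₁ s₂ x₁ x₂ p₁ p₂ q₁ q₂ ?_
  rw [view_snoc_own h₁.backward hO₁, view_snoc_own (hs.of_prefix p₁).backward q₁] at e₁
  rw [view_snoc_own h₂.backward hO₂, view_snoc_own (hs.of_prefix p₂).backward q₂] at e₂
  rw [← (List.append_inj' e₁ rfl).1, ← (List.append_inj' e₂ rfl).1, h]

/-- Once the initial question of a thread is answered, Opponent has no further move in it: the
O-view consists of that question and its answer. -/
theorem AnsweredBefore.ptr_snoc_eq_none (hans : A.AnswersTerminal) {s : JSeq A.Move}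
    {x : A.Move × Option ℕ} (hs : A.AnsweredBefore s 0 s.length) (h1 : s.SingleThreaded)
    (hl : A.Legal (s ++ [x])) : x.2 = none := by
  by_contra hx
  have hsl : A.Legal s := hl.init
  have hlen := List.length_pos_iff.2 h1.ne_nil
  obtain ⟨k, hk, m, h2, h3⟩ := hs
  have hpre : s <+: s ++ [x] := List.prefix_append _ _
  have hpk : ptr (s ++ [x]) k = some 0 := by
    rw [ptr_of_prefix hpre hk, ptr, h2]
    rfl
  have h0O : A.playerAt (s ++ [x]) 0 = some Player.O := by
    rw [hl.playerAt_eq_O_iff (by simp)]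
    exact Even.zero
  have hkO := (hl.justified.playerAt_ptr hpk).1
  rw [h0O] at hkO
  have hk1 : k + 1 < (s ++ [x]).length := by
    rw [List.length_append, List.length_singleton]
    omega
  have hkO' : A.playerAt (s ++ [x]) (k + 1) = some Player.O := by
    have h4 := hl.alternating.playerAt_succ hk1
    rcases playerAt_isSome (A := A) hk1 with h | h
    · exact h
    · rcases playerAt_isSome (A := A) (s := s ++ [x]) (i := k) (by omega) with h' | h'
      · rw [h'] at hkO
        exact absurd rfl hkO
      · rw [h, h'] at h4
        exact absurd rfl h4
  have hpn : ptr (s ++ [x]) (k + 1) ≠ none := by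
    rcases (show k + 1 < s.length ∨ k + 1 = s.length by omega) with h | h
    · rw [ptr_of_prefix hpre h]
      exact h1.ptr_ne_none hsl.backward h (by omega)
    · rw [h]
      simpa [ptr] using hx
  obtain ⟨j, hj⟩ := Option.ne_none_iff_exists'.1 hpn
  have h5 := (hl.ptr_mem_viewPos hj hkO').2
  rw [Nat.add_sub_cancel, chain_some (j := 0) (by rw [pred, if_neg (Ne.symm hkO), hpk])
    ((hl.justified.playerAt_ptr hpk).2.1), chain_none (by simp [pred, h0O])] at h5
  simp only [List.cons_append, List.nil_append, List.mem_cons, List.not_mem_nil, or_false] at h5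
  rcases h5 with rfl | rfl
  · have := (hl.justified.playerAt_ptr hj).1
    rw [hkO', h0O] at this
    exact this rfl
  · have h6 : (s ++ [x])[j + 1]? = some ((s ++ [x])[j + 1].1, some j) := by
      unfold ptr at hj
      rw [List.getElem?_eq_getElem hk1] at hj ⊢
      simp only [Option.bind_some] at hj
      rw [← hj]
    obtain ⟨-, y, h7, h8⟩ := hl.justified.2 _ _ _ h6
    rw [getElem?_of_prefix hpre hk, h2] at h7
    cases h7
    have := hans _ _ h8
    rw [h3] at this
    cases this

theorem Complete.answeredBefore_zero {s : JSeq A.Move} (hs : A.Complete s) (hl : A.Legal s)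
    (h0 : s ≠ []) : A.AnsweredBefore s 0 s.length := by
  have hlen := List.length_pos_iff.2 h0
  have hp0 := hl.backward.ptr_zero
  have hs0 : s[0]? = some (s[0].1, none) := by
    unfold ptr at hp0
    rw [List.getElem?_eq_getElem hlen] at hp0 ⊢
    simp only [Option.bind_some] at hp0
    rw [← hp0]
  exact hs 0 ⟨_, hs0, A.initial_question _ (hl.justified.1 _ _ hs0)⟩

/-- A move of the other participant produces the view up to its justifier, followed by it. -/
theorem view_snoc_other {s : JSeq A.Move} {m : A.Move} {j : ℕ} {X : Player}
    (hs : A.Justified (s ++ [(m, some j)])) (hm : A.player m ≠ X) :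
    A.view X (s ++ [(m, some j)]) = A.viewAt X s j ++
      [(m, some ((A.viewAt X s j).length - 1))] := by
  have hj : j < s.length := (hs.2 s.length m j (by simp)).1
  have hpre : s <+: s ++ [(m, some j)] := List.prefix_append _ _
  have hpl : A.playerAt (s ++ [(m, some j)]) s.length ≠ some X := by
    simpa [playerAt] using hm
  rw [hs.view_snoc_eq]
  unfold viewAt
  have hc : chain (A.pred X (s ++ [(m, some j)])) j = chain (A.pred X s) j :=
    chain_congr fun i hi => pred_of_prefix hpre X (by omega)
  have hK : ∀ i ∈ chain (A.pred X s) j, i < s.length := fun i hi => by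
    have := mem_chain_le hi
    omega
  rw [chain_some (n := s.length) (j := j) (by rw [pred, if_neg hpl]; simp [ptr]) hj, hc,
    sub_append_last _ _ _ hK hs.backward, sub_length _ _ hK]
  congr 3
  have h1 : ∃ l, chain (A.pred X s) j = l ++ [j] := by
    rcases chain_cases (A.pred X s) j with ⟨-, h⟩ | ⟨j', -, -, h⟩
    · exact ⟨[], h⟩
    · exact ⟨_, h⟩
  obtain ⟨l, hl⟩ := h1
  have h2 := idxOf?_posAt (chain_sorted (A.pred X s) j) (a := l.length) (by simp [hl])
  have h3 : posAt (chain (A.pred X s) j) l.length = j := posAt_of_getElem? (by simp [hl])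
  rw [h3] at h2
  simp only [Option.bind_some, h2]
  simp [hl]

theorem viewAt_length {s : JSeq A.Move} {X : Player} {n : ℕ} (hn : n < s.length) :
    (A.viewAt X s n).length = (chain (A.pred X s) n).length :=
  sub_length _ _ fun i hi => by
    have := mem_chain_le hi
    omega

theorem playerAt_last {s : JSeq A.Move} {x : A.Move × Option ℕ} :
    A.playerAt (s ++ [x]) s.length = some (A.player x.1) := by
  simp [playerAt]

theorem Legal.player_snoc_O_iff {s : JSeq A.Move} {x : A.Move × Option ℕ}
    (h : A.Legal (s ++ [x])) : A.player x.1 = Player.O ↔ Even s.length := by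
  rw [← h.playerAt_eq_O_iff (by simp), playerAt_last]
  simp

theorem Legal.player_snoc_P_iff {s : JSeq A.Move} {x : A.Move × Option ℕ}
    (h : A.Legal (s ++ [x])) : A.player x.1 = Player.P ↔ ¬ Even s.length := by
  rw [← h.playerAt_eq_P_iff (by simp), playerAt_last]
  simp

end Arena

/-! ### The test for an observation -/

namespace JSeq
variable {M : Type u}

theorem sub_range {s : JSeq M} (hs : Backward s) : s.sub (List.range s.length) = s := by
  have hK : ∀ i ∈ List.range s.length, i < s.length := fun i => List.mem_range.1
  refine List.ext_getElem? fun a => ?_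
  by_cases ha : a < s.length
  · have hpos : ∀ b < s.length, posAt (List.range s.length) b = b := fun b hb =>
      posAt_of_getElem? (by simp [hb])
    rw [sub_getElem? _ _ hK a (by simpa), hpos a ha, List.getElem?_eq_getElem ha]
    rcases h : s[a] with ⟨m, _ | j⟩
    · rfl
    · have hj := hs a m j (by rw [List.getElem?_eq_getElem ha, h])
      have := idxOf?_posAt (K := List.range s.length) List.pairwise_lt_range (a := j)
        (by simp; omega)
      rw [hpos j (by omega)] at this
      simp [this]
  · rw [List.getElem?_eq_none (by rw [sub_length _ _ hK]; simpa using ha),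
      List.getElem?_eq_none (by simpa using ha)]

theorem SingleThreaded.thread_zero {s : JSeq M} (hs : s.SingleThreaded) (hb : Backward s) :
    s.thread 0 = s := by
  have : threadPos s 0 = List.range s.length := by
    unfold threadPos
    rw [List.filter_eq_self]
    intro n hn
    simpa using hs.root_eq hb (List.mem_range.1 hn)
  rw [thread_eq, this, sub_range hb]

theorem SingleThreaded.thread_ne_zero {s : JSeq M} (hs : s.SingleThreaded) (hb : Backward s)
    {i : ℕ} (hi : i ≠ 0) : s.thread i = [] := by
  have : threadPos s i = [] := by
    unfold threadPos
    rw [List.filter_eq_nil_iff]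
    intro n hn
    simpa [hs.root_eq hb (List.mem_range.1 hn)] using hi.symm
  rw [thread_eq, this]
  rfl

theorem SingleThreaded.snoc {s : JSeq M} {x : M × Option ℕ} (hs : s.SingleThreaded)
    (hb : Backward (s ++ [x])) (hx : x.2 ≠ none) : (s ++ [x]).SingleThreaded := by
  refine singleThreaded_of_ptr hb (by simp) fun i hi h0 => ?_
  rw [List.length_append, List.length_singleton] at hi
  rcases (show i < s.length ∨ i = s.length by omega) with h | rfl
  · rw [ptr_of_prefix (List.prefix_append _ _) h]
    exact hs.ptr_ne_none hb.init h h0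
  · simpa [ptr] using hx

theorem SingleThreaded.snoc_ne_none {s : JSeq M} {x : M × Option ℕ}
    (h : (s ++ [x]).SingleThreaded) (hb : Backward (s ++ [x])) (h0 : s ≠ []) : x.2 ≠ none := by
  have := h.ptr_ne_none hb (i := s.length) (by simp) (by simpa using h0)
  simpa [ptr] using this

end JSeq

theorem qplay_ne_qaplay {M : Type u} {l l' : JSeq M} : qplay l ≠ qaplay l' := by
  intro h
  have h1 := congrArg List.length h
  have h2 : (qplay l)[l'.length + 1]? = some (.inr .a, some 0) := by
    rw [h]
    unfold qaplay
    rw [← qplay_length]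
    simp
  rw [qplay_getElem?_succ, Option.map_eq_some_iff] at h2
  obtain ⟨x, -, hx⟩ := h2
  simp [liftEntry] at hx

namespace Game
variable {A : Game.{u}}

theorem interleaved_of_singleThreaded {l : JSeq A.Move} (hl : l ∈ A.plays)
    (h : l.SingleThreaded) : A.Interleaved l := by
  have hb := (A.legal l hl).backward
  refine ⟨A.legal l hl, A.wellBracketed l hl, fun i => ?_⟩
  by_cases hi : i = 0
  · rwa [hi, h.thread_zero hb]
  · rw [h.thread_ne_zero hb hi]
    exact A.nil_mem

/-- Passing a test: some play `q l a` of the test has all threads of `l` in the strategy. -/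
theorem comp_eq_sigmaTop_iff (σ : Strategy A) (α : Strategy (A.arrow sigmaGame)) :
    σ.comp α = sigmaTop ↔ ∃ l, qaplay l ∈ α.carrier ∧ ∀ i, l.thread i ∈ σ.carrier := by
  have key : ∀ w ∈ α.carrier, (∀ i, (left w).thread i ∈ σ.carrier) →
      w = [] ∨ ∃ l, w = qaplay l ∧ A.Legal l ∧ ∀ i, l.thread i ∈ σ.carrier := by
    intro w hw hth
    have hwp := α.subset_plays hw
    rcases arrow_plays_cases hwp with rfl | ⟨l, rfl⟩ | ⟨l, rfl⟩
    · exact Or.inl rfl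
    · exfalso
      have hl := qplay_mem_iff.1 hwp
      rw [left_qplay hl.legal.backward] at hth
      have hev := α.even _ hw
      rw [qplay_length, Nat.even_add_one] at hev
      obtain ⟨n, hn⟩ : ∃ n, l.length = n + 1 :=
        Nat.exists_eq_succ_of_ne_zero fun h => hev (by simp [h])
      rw [hn, Nat.even_add_one, not_not] at hev
      obtain ⟨h1, h2⟩ := Arena.posAt_threadPos_last hn (i := root l n) rfl
      have h3 := (hl.legal.playerAt_eq_O_iff (by omega)).2 hev
      rw [← h2, ← Arena.playerAt_thread h1] at h3
      have h5 : (l.thread (root l n)).length ≠ 0 := by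
        rw [thread_length]
        omega
      rw [(A.legal _ (hl.thread_mem _)).playerAt_eq_O_iff (by omega)] at h3
      have h4 := σ.even _ (hth (root l n))
      obtain ⟨a, ha⟩ := h3
      obtain ⟨b, hb⟩ := h4
      omega
    · have hl := (qaplay_mem_iff.1 hwp).1.legal
      rw [left_qaplay hl.backward] at hth
      exact Or.inr ⟨l, rfl, hl, hth⟩
  constructor
  · intro h
    have : sigmaQA ∈ σ.comp α := by
      rw [h]
      exact Or.inr rfl
    obtain ⟨w, hw, hth, hr⟩ := this
    rcases key w hw hth with rfl | ⟨l, rfl, -, hl⟩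
    · cases hr
    · exact ⟨l, hw, hl⟩
  · rintro ⟨l, h1, h2⟩
    ext w
    constructor
    · rintro ⟨w, hw, hth, rfl⟩
      rcases key w hw hth with rfl | ⟨l', rfl, hl', -⟩
      · exact Or.inl rfl
      · exact Or.inr (right_qaplay hl'.backward)
    · rintro (rfl | rfl)
      · exact ⟨[], α.nil_mem, fun i => σ.nil_mem, rfl⟩
      · have hl := (qaplay_mem_iff.1 (α.subset_plays h1)).1.legal.backward
        exact ⟨qaplay l, h1, by rwa [left_qaplay hl], (right_qaplay hl).symm⟩

/-- The single-threaded plays in which every O-view occurs in `s`. -/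
structure FollowsOViews (A : Game.{u}) (s l : JSeq A.Move) : Prop where
  mem_plays : l ∈ A.plays
  singleThreaded : l.SingleThreaded
  view_mem : ∀ v, v <+: l → A.view Player.O v ∈ A.ovw s

theorem FollowsOViews.of_prefix {s l l' : JSeq A.Move} (h : A.FollowsOViews s l')
    (hp : l <+: l') (h0 : l ≠ []) : A.FollowsOViews s l :=
  ⟨mem_of_prefix h.mem_plays hp,
    h.singleThreaded.of_prefix (A.legal _ h.mem_plays).backward hp h0,
    fun v hv => h.view_mem v (hv.trans hp)⟩

/-- The plays of the test that, as Opponent in a single thread of `A`, only allows the O-views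
occurring in `s`, and answers `q` when that thread is complete. -/
def testCarrier (A : Game.{u}) (s : JSeq A.Move) : Set (JSeq (A.arrow sigmaGame).Move) :=
  {w | w = [] ∨ (∃ l, A.FollowsOViews s l ∧ ¬ Even l.length ∧ w = qplay l) ∨
    ∃ l, A.FollowsOViews s l ∧ Even l.length ∧ A.Complete l ∧ w = qaplay l}

theorem mem_testCarrier_snoc_iff {s : JSeq A.Move} {w : JSeq (A.arrow sigmaGame).Move}
    {a b : (A.arrow sigmaGame).Move × Option ℕ} :
    w ++ [a, b] ∈ testCarrier A s ↔ ∃ l, w ++ [a] = qplay l ∧ Even l.length ∧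
      ((∃ x, b = liftEntry x ∧ A.FollowsOViews s (l ++ [x])) ∨
        (b = (.inr .a, some 0) ∧ A.FollowsOViews s l ∧ A.Complete l)) := by
  have e : w ++ [a, b] = (w ++ [a]) ++ [b] := by simp
  rw [e]
  constructor
  · rintro (h | ⟨l, h1, h2, h3⟩ | ⟨l, h1, h2, h3, h4⟩)
    · simp at h
    · rcases l.eq_nil_or_concat with rfl | ⟨l, x, rfl⟩
      · exact absurd rfl h1.singleThreaded.ne_nil
      · rw [List.concat_eq_append] at h1 h2 h3
        rw [qplay_snoc] at h3
        obtain ⟨h5, h6⟩ := List.append_inj' h3 rfl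
        rw [List.length_append, List.length_singleton, Nat.even_add_one, not_not] at h2
        exact ⟨l, h5, h2, Or.inl ⟨x, by simpa using h6, h1⟩⟩
    · obtain ⟨h5, h6⟩ := List.append_inj' h4 rfl
      exact ⟨l, h5, h2, Or.inr ⟨by simpa using h6, h1, h3⟩⟩
  · rintro ⟨l, h1, h2, ⟨x, rfl, h3⟩ | ⟨rfl, h3, h4⟩⟩
    · refine Or.inr (Or.inl ⟨l ++ [x], h3, ?_, ?_⟩)
      · simpa [Nat.even_add_one] using h2
      · rw [qplay_snoc, h1]
    · exact Or.inr (Or.inr ⟨l, h3, h2, h4, by rw [h1]; rfl⟩)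

/-- The test for the observation given by an O-innocent play `s`. -/
def test (A : Game.{u}) (hans : A.AnswersTerminal) (s : JSeq A.Move) (hs : A.Legal s)
    (hi : A.OInnocent s) : Strategy (A.arrow sigmaGame) where
  carrier := testCarrier A s
  subset_plays := by
    rintro w (rfl | ⟨l, h1, h2, rfl⟩ | ⟨l, h1, h2, h3, rfl⟩)
    · exact (A.arrow sigmaGame).nil_mem
    · exact qplay_mem_iff.2 (interleaved_of_singleThreaded h1.mem_plays h1.singleThreaded)
    · exact qaplay_mem_iff.2
        ⟨interleaved_of_singleThreaded h1.mem_plays h1.singleThreaded, h2, h3⟩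
  even := by
    rintro w (rfl | ⟨l, h1, h2, rfl⟩ | ⟨l, h1, h2, h3, rfl⟩)
    · exact Even.zero
    · simpa [Nat.even_add_one] using h2
    · simpa [qaplay, Nat.even_add_one] using h2
  nil_mem := Or.inl rfl
  prefix_mem := by
    intro w a b h
    obtain ⟨l, h1, h2, h3⟩ := mem_testCarrier_snoc_iff.1 h
    have h4 : l = [] ∨ A.FollowsOViews s l := by
      by_cases h0 : l = []
      · exact Or.inl h0
      · rcases h3 with ⟨x, -, h3⟩ | ⟨-, h3, -⟩
        · exact Or.inr (h3.of_prefix (List.prefix_append _ _) h0)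
        · exact Or.inr h3
    rcases l.eq_nil_or_concat with rfl | ⟨l, x, rfl⟩
    · left
      exact (List.append_inj' h1 rfl (s₂ := [])).1
    · rw [List.concat_eq_append] at h1 h2 h4
      rw [qplay_snoc] at h1
      rw [List.length_append, List.length_singleton, Nat.even_add_one] at h2
      rcases h4 with h4 | h4
      · simp at h4
      · refine Or.inr (Or.inl ⟨l, h4.of_prefix (List.prefix_append _ _) ?_, h2,
          (List.append_inj' h1 rfl).1⟩)
        rintro rfl
        simp at h2
  deterministic := by
    intro w a b c hb hc
    obtain ⟨l, h1, h2, h3⟩ := mem_testCarrier_snoc_iff.1 hb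
    obtain ⟨l', h1', h2', h3'⟩ := mem_testCarrier_snoc_iff.1 hc
    obtain rfl := qplay_injective (h1.symm.trans h1')
    have key : ∀ x, A.FollowsOViews s (l ++ [x]) → A.FollowsOViews s l → A.Complete l →
        False := by
      intro x hx hl hcl
      have hx' := A.legal _ hx.mem_plays
      have h0 := hl.singleThreaded.ne_nil
      exact hx.singleThreaded.snoc_ne_none hx'.backward h0
        ((hcl.answeredBefore_zero hx'.init h0).ptr_snoc_eq_none hans hl.singleThreaded hx')
    rcases h3 with ⟨x, rfl, h3⟩ | ⟨rfl, h3, h4⟩ <;> rcases h3' with ⟨y, rfl, h3'⟩ | ⟨rfl, h3', h4'⟩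
    · have hx := A.legal _ h3.mem_plays
      have hy := A.legal _ h3'.mem_plays
      have hxO := hx.player_snoc_O_iff.2 h2
      have hyO := hy.player_snoc_O_iff.2 h2
      have := hi.view_eq hs hx hy hxO hyO (h3.view_mem _ List.prefix_rfl)
        (h3'.view_mem _ List.prefix_rfl) rfl
      rw [Arena.eq_of_view_eq hx hy hxO hyO this]
    · exact (key x h3 h3' h4').elim
    · exact (key y h3' h3 h4).elim
    · rfl

end Game

namespace Arena
variable {A : Arena.{u}}

/-- A single-threaded sequence is complete if and only if its last move answers its initial
question. -/
theorem complete_snoc_iff (hans : A.AnswersTerminal) {l : JSeq A.Move}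
    {x : A.Move × Option ℕ} (hl : A.Legal (l ++ [x])) (hw : A.WellBracketed (l ++ [x]))
    (h1 : (l ++ [x]).SingleThreaded) :
    A.Complete (l ++ [x]) ↔ x.2 = some 0 ∧ A.kind x.1 = Kind.answer := by
  constructor
  · intro hc
    obtain ⟨k, hk, m, h2, h3⟩ := hc.answeredBefore_zero hl (by simp)
    rw [List.length_append, List.length_singleton] at hk
    rcases (show k < l.length ∨ k = l.length by omega) with h | rfl
    · exfalso
      have h0 : l ≠ [] := by
        rintro rfl
        simp at h
      have hls := h1.of_prefix hl.backward (List.prefix_append _ _) h0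
      have ha : A.AnsweredBefore l 0 l.length :=
        ⟨k, h, m, by rw [← h2, List.getElem?_append_left h], h3⟩
      exact h1.snoc_ne_none hl.backward h0 (ha.ptr_snoc_eq_none hans hls hl)
    · rw [List.getElem?_concat_length, Option.some.injEq] at h2
      subst h2
      exact ⟨rfl, h3⟩
  · rintro ⟨h2, h3⟩ i hi
    have hx : (l ++ [x])[l.length]? = some (x.1, some 0) := by simp [← h2]
    have hil : i < (l ++ [x]).length := by
      obtain ⟨y, hy, -⟩ := hi
      exact (List.getElem?_eq_some_iff.1 hy).1
    rw [List.length_append, List.length_singleton] at hil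
    have hlt : i < l.length := by
      by_contra h
      obtain rfl : i = l.length := by omega
      obtain ⟨y, hy, hq⟩ := hi
      rw [hx, Option.some.injEq] at hy
      subst hy
      rw [h3] at hq
      cases hq
    by_cases h0 : i = 0
    · subst h0
      exact ⟨l.length, by simp, x.1, hx, h3⟩
    · obtain ⟨k, hk, r⟩ := (hw _ _ _ hx h3).2 i (by omega) hlt hi
      exact ⟨k, by simp; omega, r⟩

/-- Completeness of a single-threaded sequence can be read off from its O-view. -/
theorem Complete.of_view_eq (hans : A.AnswersTerminal) {l l' : JSeq A.Move}
    {x x' : A.Move × Option ℕ} (hl : A.Legal (l ++ [x])) (hw : A.WellBracketed (l ++ [x]))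
    (h1 : (l ++ [x]).SingleThreaded) (hl' : A.Legal (l' ++ [x']))
    (hw' : A.WellBracketed (l' ++ [x'])) (h1' : (l' ++ [x']).SingleThreaded)
    (hP : A.player x.1 = Player.P) (hP' : A.player x'.1 = Player.P)
    (hv : A.view Player.O (l ++ [x]) = A.view Player.O (l' ++ [x']))
    (hc : A.Complete (l ++ [x])) : A.Complete (l' ++ [x']) := by
  obtain ⟨h2, h3⟩ := (complete_snoc_iff hans hl hw h1).1 hc
  rw [complete_snoc_iff hans hl' hw' h1']
  rcases x with ⟨m, p⟩
  subst h2
  rcases x' with ⟨m', _ | j⟩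
  · have := A.initial_opponent _ (hl'.justified.1 l'.length m' (by simp))
    rw [this] at hP'
    cases hP'
  · rw [view_snoc_other hl.justified (by simp [hP]), view_snoc_other hl'.justified
      (by simp [hP'])] at hv
    obtain ⟨h4, h5⟩ := List.append_inj' hv rfl
    simp only [List.cons.injEq, Prod.mk.injEq, and_true] at h5
    refine ⟨?_, by rw [← h5.1]; exact h3⟩
    have hl0 : 0 < l.length := (hl.justified.2 l.length m 0 (by simp)).1
    have hj : j < l'.length := (hl'.justified.2 l'.length m' j (by simp)).1
    have h6 := congrArg List.length h4
    rw [viewAt_length hl0, viewAt_length hj, chain_none] at h6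
    · by_contra hne
      have hne' : j ≠ 0 := fun h => hne (by rw [h])
      have hpj : ptr (l' ++ [(m', some j)]) l'.length = some j := by simp [ptr]
      have h7 := (hl'.justified.playerAt_ptr hpj).1
      rw [playerAt_last, playerAt_of_prefix (List.prefix_append _ _) hj] at h7
      have h8 : A.playerAt l' j = some Player.O := by
        rcases playerAt_isSome (A := A) hj with h | h
        · exact h
        · simp [h, hP'] at h7
      rw [chain_some (j := j - 1) (by rw [pred, if_pos h8, if_neg hne']) (by omega)] at h6
      have := List.length_pos_iff.2 (chain_ne_nil (A.pred Player.O l') (j - 1))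
      rw [List.length_append, List.length_singleton, List.length_singleton] at h6
      omega
    · rw [pred, (hl.init.playerAt_eq_O_iff hl0).2 Even.zero]
      simp

end Arena

/-! ### Intrinsic order implies the order on observations -/

namespace Game
variable {A : Game.{u}}

theorem FollowsOViews.snoc {s l : JSeq A.Move} {x : A.Move × Option ℕ}
    (hl : l = [] ∨ A.FollowsOViews s l) (h1 : l ++ [x] ∈ A.plays)
    (h2 : (l ++ [x]).SingleThreaded) (h3 : A.view Player.O (l ++ [x]) ∈ A.ovw s) :
    A.FollowsOViews s (l ++ [x]) := by
  refine ⟨h1, h2, fun v hv => ?_⟩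
  rcases List.prefix_concat_iff.1 hv with rfl | hv
  · exact h3
  · rcases hl with rfl | hl
    · rw [List.prefix_nil.1 hv]
      exact ⟨[], List.nil_prefix, rfl⟩
    · exact hl.view_mem v hv

theorem view_qaplay {l : JSeq A.Move} (hl : A.Legal l) :
    (A.arrow sigmaGame).view Player.P (qaplay l) =
      qplay (A.view Player.O l) ++ [(.inr .a, some 0)] := by
  unfold qaplay
  rw [Arena.view_snoc_own (A := A.toArena.arrow sigmaArena) (X := Player.P)
    (x := (.inr .a, some 0)) (backward_qaplay hl.backward) rfl, Arena.view_qplay_P hl]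
  congr 3
  have := Arena.viewPos_qplay hl.backward Player.O le_rfl
  rw [show Player.O.swap = Player.P from rfl] at this
  rw [qplay_length, this]
  rfl

/-- The test is innocent: a move that it makes in some O-view is available at every play with this
O-view, and completeness of the thread shows in the O-view. -/
theorem test_innocent (hans : A.AnswersTerminal) (hview : A.OViewDetermined)
    {s : JSeq A.Move} (hs : A.Legal s) (hi : A.OInnocent s) :
    (A.test hans s hs hi).Innocent := by
  intro w t a a' b hw ht hta hv
  obtain ⟨l, h1, h2, h3⟩ := mem_testCarrier_snoc_iff.1 hw
  have hlL : A.Legal l := by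
    rcases h3 with ⟨x, -, h3⟩ | ⟨-, h3, -⟩
    · exact (A.legal _ h3.mem_plays).init
    · exact A.legal _ h3.mem_plays
  have htev := (A.test hans s hs hi).even _ ht
  have e : ∀ (w : JSeq (A.arrow sigmaGame).Move) (a b : (A.arrow sigmaGame).Move × Option ℕ),
      w ++ [a, b] = (w ++ [a]) ++ [b] := fun _ _ _ => by simp
  rcases arrow_plays_cases hta with h | ⟨l', h4⟩ | ⟨l', h4⟩
  · simp at h
  · rw [h4] at hta
    have hI := qplay_mem_iff.1 hta
    rw [h1, h4, Arena.view_qplay_P hlL, Arena.view_qplay_P hI.legal] at hv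
    have hv := qplay_injective hv
    rcases l'.eq_nil_or_concat with rfl | ⟨l₁, x', rfl⟩
    · -- the view `q` only arises at the start
      have hl0 : l = [] := by
        by_contra hne
        exact hlL.justified.view_ne_nil hne _ (hv.trans (Arena.view_nil _))
      subst hl0
      refine ⟨b, ?_, by rw [e, e, h1, h4]⟩
      rw [e, h4, ← h1, ← e]
      exact hw
    · rw [List.concat_eq_append] at h4 hI hv
      rw [qplay_snoc] at h4
      have ht' : t = qplay l₁ := (List.append_inj' h4 rfl).1
      rw [ht', qplay_length] at htev
      have hodd : ¬ Even l₁.length := by simpa [Nat.even_add_one] using htev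
      have hf₁ : A.FollowsOViews s l₁ := by
        rcases ht with h | ⟨l₂, h5, -, h6⟩ | ⟨l₂, -, -, -, h6⟩
        · rw [ht'] at h
          exact absurd h (qplay_ne_nil _)
        · obtain rfl := qplay_injective (ht'.symm.trans h6)
          exact h5
        · exact absurd (ht'.symm.trans h6) qplay_ne_qaplay
      have hL' := hI.legal
      have hP' : A.player x'.1 = Player.P := hL'.player_snoc_P_iff.2 hodd
      have hx'ptr : x'.2 ≠ none := by
        intro h
        have := A.initial_opponent _ (hL'.justified.1 l₁.length x'.1 (by simp [← h]))
        rw [hP'] at this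
        cases this
      have hs' := hf₁.singleThreaded.snoc hL'.backward hx'ptr
      have hplay : l₁ ++ [x'] ∈ A.plays := by
        have := hI.thread_mem 0
        rwa [hs'.thread_zero hL'.backward] at this
      have hl0 : l ≠ [] := by
        rintro rfl
        exact hL'.justified.view_ne_nil (by simp) _ (hv.symm.trans (Arena.view_nil _))
      have hfl : A.FollowsOViews s l := by
        rcases h3 with ⟨x, -, h3⟩ | ⟨-, h3, -⟩
        · exact h3.of_prefix (List.prefix_append _ _) hl0
        · exact h3
      have hf' : A.FollowsOViews s (l₁ ++ [x']) :=
        FollowsOViews.snoc (Or.inr hf₁) hplay hs' (hv ▸ hfl.view_mem l List.prefix_rfl)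
      have hev' : Even (l₁ ++ [x']).length := by simpa [Nat.even_add_one] using hodd
      rcases h3 with ⟨x, rfl, h3⟩ | ⟨rfl, h3, h5⟩
      · have hxL := A.legal _ h3.mem_plays
        have hxO := hxL.player_snoc_O_iff.2 h2
        obtain ⟨y, hy1, hy2⟩ := hview l (l₁ ++ [x']) x h3.mem_plays hplay h3.singleThreaded hs'
          hxO hv
        have hyL := A.legal _ hy1
        have hyO := hyL.player_snoc_O_iff.2 hev'
        have hyptr : y.2 ≠ none := by
          intro h
          have h6 := hy2
          rw [Arena.view_snoc_own hxL.backward hxO, Arena.view_snoc_own hyL.backward hyO,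
            h] at h6
          have h7 := (List.append_inj' h6 rfl).2
          simp only [List.cons.injEq, Prod.mk.injEq, and_true, Option.bind_none] at h7
          obtain ⟨j, hj⟩ := Option.ne_none_iff_exists'.1
            (h3.singleThreaded.snoc_ne_none hxL.backward hl0)
          have h8 := hxL.visible l.length x.1 j (by simp [← hj])
          rw [hxO, A.viewPos_snoc _ _ _ _ le_rfl] at h8
          obtain ⟨c, hc⟩ := idxOf?_isSome h8
          rw [hj, Option.bind_some, hc] at h7
          cases h7.2
        refine ⟨liftEntry y, ?_, ?_⟩
        · refine mem_testCarrier_snoc_iff.2 ⟨l₁ ++ [x'], by rw [h4, ← qplay_snoc], hev',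
            Or.inl ⟨y, rfl, FollowsOViews.snoc (Or.inr hf') hy1
              (hs'.snoc hyL.backward hyptr) ?_⟩⟩
          rw [← hy2]
          exact h3.view_mem _ List.prefix_rfl
        · rw [e, e, h1, h4, ← qplay_snoc, ← qplay_snoc, ← qplay_snoc, Arena.view_qplay_P hxL,
            Arena.view_qplay_P hyL, hy2]
      · have hc' : A.Complete (l₁ ++ [x']) := by
          rcases l.eq_nil_or_concat with rfl | ⟨l, z, rfl⟩
          · exact absurd rfl hl0
          · rw [List.concat_eq_append] at *
            have hzP : A.player z.1 = Player.P := by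
              rw [hlL.player_snoc_P_iff]
              simpa [Nat.even_add_one] using h2
            exact Arena.Complete.of_view_eq hans hlL (A.wellBracketed _ h3.mem_plays)
              h3.singleThreaded hL' (A.wellBracketed _ hplay) hs' hzP hP' hv h5
        refine ⟨(.inr .a, some 0), mem_testCarrier_snoc_iff.2 ⟨l₁ ++ [x'],
          by rw [h4, ← qplay_snoc], hev', Or.inr ⟨rfl, hf', hc'⟩⟩, ?_⟩
        rw [e, e, h1, h4, ← qplay_snoc]
        change (A.arrow sigmaGame).view Player.P (qaplay _) =
          (A.arrow sigmaGame).view Player.P (qaplay _)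
        rw [view_qaplay hlL, view_qaplay hL', hv]
  · exfalso
    rw [h4] at hta
    have h5 := (qaplay_mem_iff.1 hta).2.1
    have ht' : t = qplay l' := (List.append_inj' h4 rfl).1
    rw [ht', qplay_length, Nat.even_add_one] at htev
    exact htev h5

/-- Each observation of `σ` gives a test passed by `σ`, and whatever passes this test has a smaller
observation. -/
theorem leOS_of_leIB (hans : A.AnswersTerminal) (hview : A.OViewDetermined)
    {σ τ : Strategy A} (h : σ.LeIB τ) : LeOS σ.obs τ.obs := by
  rintro S ⟨s, hs, hc, hi, h1, rfl⟩
  have hsp := σ.subset_plays hs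
  have hsL := A.legal _ hsp
  have hpass : σ.comp (A.test hans s hsL hi) = sigmaTop := by
    rw [comp_eq_sigmaTop_iff]
    refine ⟨s, Or.inr (Or.inr ⟨s, ⟨hsp, h1, fun v hv => ⟨v, hv, rfl⟩⟩, σ.even _ hs, hc, rfl⟩),
      fun i => ?_⟩
    by_cases hi0 : i = 0
    · rwa [hi0, h1.thread_zero hsL.backward]
    · rw [h1.thread_ne_zero hsL.backward hi0]
      exact σ.nil_mem
  obtain ⟨t, ht, hth⟩ := (comp_eq_sigmaTop_iff _ _).1
    (h _ (test_innocent hans hview hsL hi) hpass)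
  rcases ht with ht | ⟨l, -, -, ht⟩ | ⟨l, hf, -, hcl, ht⟩
  · simp [qaplay] at ht
  · exact absurd ht.symm qplay_ne_qaplay
  · obtain rfl := qaplay_injective ht
    have htL := A.legal _ hf.mem_plays
    have h0 := hth 0
    rw [hf.singleThreaded.thread_zero htL.backward] at h0
    refine ⟨_, ⟨t, h0, hcl, ?_, hf.singleThreaded, rfl⟩, ?_⟩
    · intro s₁ s₂ x₁ x₂ p₁ p₂ o₁ o₂ hv
      exact hi.view_eq hsL (htL.of_prefix p₁) (htL.of_prefix p₂) o₁ o₂ (hf.view_mem _ p₁)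
        (hf.view_mem _ p₂) hv
    · rintro v ⟨r, hr, rfl⟩
      exact hf.view_mem r hr

end Game

/-! ### The core of an interleaving -/

namespace JSeq

/-- The root of an occurrence can be computed in a subsequence closed under justifiers. -/
theorem root_sub {M : Type u} {s : JSeq M} (hs : Backward s) {K : List ℕ}
    (hK : K.Pairwise (· < ·)) (hKs : ∀ i ∈ K, i < s.length)
    (hcl : ∀ i ∈ K, ∀ j, ptr s i = some j → j ∈ K) {a : ℕ} (ha : a < K.length) :
    root (s.sub K) a < K.length ∧ posAt K (root (s.sub K) a) = root s (posAt K a) := by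
  induction a using Nat.strong_induction_on with
  | _ a ih =>
    have h1 := sub_ptr s K hKs a ha
    rcases hp : ptr s (posAt K a) with _ | j
    · rw [hp, Option.bind_none] at h1
      rw [root_none h1, root_none hp]
      exact ⟨ha, rfl⟩
    · obtain ⟨b, hb, rfl⟩ := exists_posAt_of_mem (hcl _ (posAt_mem ha) j hp)
      rw [hp, Option.bind_some, idxOf?_posAt hK hb] at h1
      have hba := (hs.sub hK hKs).ptr_lt h1
      rw [root_some h1 hba, root_some hp (hs.ptr_lt hp)]
      exact ih b hba hb

/-- Two subsequences that share a further subsequence `C` give the same index to corresponding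
positions of `C`. -/
theorem idxOf?_transfer {K K' C : List ℕ} (hK : K.Pairwise (· < ·)) (hK' : K'.Pairwise (· < ·))
    (hC : ∀ c ∈ C, c < K.length) (hC' : ∀ c ∈ C, c < K'.length) {j j' : ℕ}
    (hj : j ∈ C.map (posAt K)) (hj' : j' ∈ C.map (posAt K'))
    (h : (C.map (posAt K)).idxOf? j = (C.map (posAt K')).idxOf? j') :
    K.idxOf? j = K'.idxOf? j' := by
  obtain ⟨c, hc, rfl⟩ := List.mem_map.1 hj
  obtain ⟨c', hc', rfl⟩ := List.mem_map.1 hj'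
  rw [idxOf?_map fun i hi e => posAt_inj hK (hC i hi) (hC c hc) e,
    idxOf?_map fun i hi e => posAt_inj hK' (hC' i hi) (hC' c' hc') e] at h
  obtain rfl := idxOf?_injOn hc h
  rw [idxOf?_posAt hK (hC c hc), idxOf?_posAt hK' (hC' c hc)]

end JSeq

namespace Arena
variable {A : Arena.{u}}

/-- The position preceding `i` in the core relative to the thread of position `k`: the justifier
for a P-move of this thread, the previous position for any other move. -/
def corePred (A : Arena.{u}) (k : ℕ) (s : JSeq A.Move) (i : ℕ) : Option ℕ :=
  if A.playerAt s i = some Player.P ∧ root s i = k then ptr s i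
  else if i = 0 then none else some (i - 1)

/-- The positions of the core of the prefix of `s` ending with position `n`. -/
def coreAt (A : Arena.{u}) (k : ℕ) (s : JSeq A.Move) (n : ℕ) : List ℕ :=
  chain (A.corePred k s) n

/-- The core of `s` relative to the thread of position `k`: the view of a participant who
plays all moves except the P-moves of this thread, which are played by the environment. -/
def core (A : Arena.{u}) (k : ℕ) (s : JSeq A.Move) : JSeq A.Move :=
  s.sub (A.coreAt k s (s.length - 1))

variable {k : ℕ} {s t : JSeq A.Move}

theorem corePred_of_prefix (h : s <+: t) {i : ℕ} (hi : i < s.length) :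
    A.corePred k t i = A.corePred k s i := by
  unfold corePred
  rw [playerAt_of_prefix h hi, root_of_prefix h hi, ptr_of_prefix h hi]

theorem coreAt_of_prefix (h : s <+: t) {n : ℕ} (hn : n < s.length) :
    A.coreAt k t n = A.coreAt k s n :=
  chain_congr fun _ hi => corePred_of_prefix h (by omega)

theorem corePred_ext {i : ℕ} (h : A.playerAt s i = some Player.P) (hr : root s i = k) :
    A.corePred k s i = ptr s i := by
  rw [corePred, if_pos ⟨h, hr⟩]

theorem corePred_int {i : ℕ} (h : ¬ (A.playerAt s i = some Player.P ∧ root s i = k))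
    (hi : 0 < i) : A.corePred k s i = some (i - 1) := by
  rw [corePred, if_neg h, if_neg (by omega)]

theorem corePred_O {i : ℕ} (h : A.playerAt s i = some Player.O) (hi : 0 < i) :
    A.corePred k s i = some (i - 1) :=
  corePred_int (by simp [h]) hi

theorem coreAt_sorted (n : ℕ) : (A.coreAt k s n).Pairwise (· < ·) := chain_sorted _ _

theorem coreAt_lt {n : ℕ} (hn : n < s.length) : ∀ i ∈ A.coreAt k s n, i < s.length :=
  fun _ hi => (mem_chain_le hi).trans_lt hn

theorem coreAt_length_pos (n : ℕ) : 0 < (A.coreAt k s n).length :=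
  List.length_pos_iff.2 (chain_ne_nil _ _)

theorem posAt_coreAt_last (n : ℕ) :
    posAt (A.coreAt k s n) ((A.coreAt k s n).length - 1) = n := by
  obtain ⟨l, hl⟩ : ∃ l, A.coreAt k s n = l ++ [n] := by
    unfold coreAt
    rcases chain_cases (A.corePred k s) n with ⟨-, h⟩ | ⟨j, -, -, h⟩
    · exact ⟨[], h⟩
    · exact ⟨_, h⟩
  apply posAt_of_getElem?
  simp [hl]

/-- Justifiers lie in the core: the O-view, and the P-view of a thread other than the `k`-th,
consist of positions of the core. -/
theorem Legal.ptr_mem_coreAt (hs : A.Legal s) {n j : ℕ} (hn : n < s.length)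
    (hj : ptr s n = some j) : j ∈ A.coreAt k s n := by
  induction n using Nat.strong_induction_on generalizing j with
  | _ n ih =>
    have hjn := hs.backward.ptr_lt hj
    by_cases hext : A.playerAt s n = some Player.P ∧ root s n = k
    · exact mem_chain_of_some (self_mem_chain _ _)
        (by rw [corePred_ext hext.1 hext.2, hj]) hjn
    · have hmem : n - 1 ∈ A.coreAt k s n :=
        mem_chain_of_some (self_mem_chain _ _) (corePred_int hext (by omega)) (by omega)
      have hcl : ∀ i < n, i ∈ A.coreAt k s n → ∀ j, ptr s i = some j → j ∈ A.coreAt k s n :=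
        fun i hi him j hij => mem_chain_trans him (ih i hi (by omega) hij)
      rcases playerAt_isSome (A := A) hn with h | h
      · have hv := (hs.ptr_mem_viewPos hj h).2
        refine chain_subset_of_closed (· ∈ A.coreAt k s n) hmem ?_ j hv
        intro i i' hin him hp hlt
        unfold pred at hp
        split_ifs at hp with h1 h2
        · cases hp
          exact mem_chain_of_some him (corePred_O h1 (by omega)) hlt
        · exact hcl i (by omega) him i' hp
      · have hv := (hs.ptr_mem_viewPos hj h).2
        have hrn : root s n ≠ k := fun hr => hext ⟨h, hr⟩
        rw [hs.root_switch h] at hrn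
        refine (chain_subset_of_closed (fun i => i ∈ A.coreAt k s n ∧ root s i ≠ k)
          ⟨hmem, hrn⟩ ?_ j hv).1
        rintro i i' hin ⟨him, hri⟩ hp hlt
        unfold pred at hp
        split_ifs at hp with h1 h2
        · cases hp
          refine ⟨mem_chain_of_some him (corePred_int (fun h => hri h.2) (by omega)) hlt, ?_⟩
          rwa [← hs.root_switch h1]
        · refine ⟨hcl i (by omega) him i' hp, ?_⟩
          rwa [← root_some hp hlt]

/-- The core is closed under justifiers. -/
theorem Legal.coreAt_closed (hs : A.Legal s) {n : ℕ} (hn : n < s.length) :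
    ∀ i ∈ A.coreAt k s n, ∀ j, ptr s i = some j → j ∈ A.coreAt k s n := by
  intro i hi j hj
  have := mem_chain_le hi
  exact mem_chain_trans hi (hs.ptr_mem_coreAt (by omega) hj)

theorem Legal.coreAt_closed_O (hs : A.Legal s) {n : ℕ} (hn : n < s.length) :
    ∀ i ∈ A.coreAt k s n, True → ∀ j, A.pred Player.O s i = some j →
      j ∈ A.coreAt k s n ∧ True := by
  rintro i hi - j hj
  refine ⟨?_, trivial⟩
  unfold pred at hj
  split_ifs at hj with h1 h2
  · cases hj
    exact mem_chain_of_some hi (corePred_O h1 (by omega)) (by omega)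
  · exact hs.coreAt_closed hn i hi j hj

theorem Legal.coreAt_closed_P (hs : A.Legal s) {n : ℕ} (hn : n < s.length) :
    ∀ i ∈ A.coreAt k s n, root s i ≠ k → ∀ j, A.pred Player.P s i = some j →
      j ∈ A.coreAt k s n ∧ root s j ≠ k := by
  intro i hi hr j hj
  unfold pred at hj
  split_ifs at hj with h1 h2
  · cases hj
    refine ⟨mem_chain_of_some hi (corePred_int (fun h => hr h.2) (by omega)) (by omega), ?_⟩
    rwa [← hs.root_switch h1]
  · refine ⟨hs.coreAt_closed hn i hi j hj, ?_⟩
    rwa [← root_some hj (hs.backward.ptr_lt hj)]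

theorem core_length (h0 : s ≠ []) :
    (A.core k s).length = (A.coreAt k s (s.length - 1)).length :=
  sub_length _ _ (coreAt_lt (by have := List.length_pos_iff.2 h0; omega))

/-- The O-view is determined by the core. -/
theorem Legal.chain_core_O (hs : A.Legal s) {n : ℕ} (hn : s.length = n + 1) :
    chain (A.pred Player.O s) n =
      (chain (A.pred Player.O (A.core k s)) ((A.core k s).length - 1)).map
        (posAt (A.coreAt k s n)) := by
  have h0 : s ≠ [] := by
    rintro rfl
    simp at hn
  have hn' : s.length - 1 = n := by omega
  have h1 := chain_pred_sub hs.backward (coreAt_sorted (A := A) (k := k) (s := s) n)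
    (coreAt_lt (by omega)) Player.O _ (hs.coreAt_closed_O (by omega))
    (a := (A.coreAt k s n).length - 1)
    (by have := coreAt_length_pos (A := A) (k := k) (s := s) n; omega) trivial
  rw [posAt_coreAt_last] at h1
  rw [h1, core_length h0, core, hn']

theorem Legal.view_core_O (hs : A.Legal s) (h0 : s ≠ []) :
    A.view Player.O s = A.viewAt Player.O (A.core k s) ((A.core k s).length - 1) := by
  obtain ⟨n, hn⟩ := Nat.exists_eq_succ_of_ne_zero (List.length_pos_iff.2 h0).ne'
  have hn' : s.length - 1 = n := by omega
  rw [hs.justified.view_eq _ h0, hn']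
  have h1 := viewAt_sub hs.backward (coreAt_sorted (A := A) (k := k) (s := s) n)
    (coreAt_lt (by omega)) Player.O _ (hs.coreAt_closed_O (by omega))
    (a := (A.coreAt k s n).length - 1)
    (by have := coreAt_length_pos (A := A) (k := k) (s := s) n; omega) trivial
  rw [posAt_coreAt_last] at h1
  rw [h1, core_length h0, core, hn']

/-- The P-view of a thread other than the `k`-th is determined by the core. -/
theorem Legal.chain_core_P (hs : A.Legal s) {n : ℕ} (hn : s.length = n + 1)
    (hr : root s n ≠ k) :
    chain (A.pred Player.P s) n =
      (chain (A.pred Player.P (A.core k s)) ((A.core k s).length - 1)).map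
        (posAt (A.coreAt k s n)) := by
  have h0 : s ≠ [] := by
    rintro rfl
    simp at hn
  have hn' : s.length - 1 = n := by omega
  have h1 := chain_pred_sub hs.backward (coreAt_sorted (A := A) (k := k) (s := s) n)
    (coreAt_lt (by omega)) Player.P _ (hs.coreAt_closed_P (by omega))
    (a := (A.coreAt k s n).length - 1)
    (by have := coreAt_length_pos (A := A) (k := k) (s := s) n; omega)
    (by rwa [posAt_coreAt_last])
  rw [posAt_coreAt_last] at h1
  rw [h1, core_length h0, core, hn']

theorem Legal.viewAt_core_P (hs : A.Legal s) {n : ℕ} (hn : s.length = n + 1)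
    (hr : root s n ≠ k) :
    A.viewAt Player.P s n = A.viewAt Player.P (A.core k s) ((A.core k s).length - 1) := by
  have h0 : s ≠ [] := by
    rintro rfl
    simp at hn
  have hn' : s.length - 1 = n := by omega
  have h1 := viewAt_sub hs.backward (coreAt_sorted (A := A) (k := k) (s := s) n)
    (coreAt_lt (by omega)) Player.P _ (hs.coreAt_closed_P (by omega))
    (a := (A.coreAt k s n).length - 1)
    (by have := coreAt_length_pos (A := A) (k := k) (s := s) n; omega)
    (by rwa [posAt_coreAt_last])
  rw [posAt_coreAt_last] at h1
  rw [h1, core_length h0, core, hn']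

/-- Any move other than a P-move of the `k`-th thread extends the core. -/
theorem core_snoc_int {x : A.Move × Option ℕ} (hs : Backward (s ++ [x])) (h0 : s ≠ [])
    (hx : ¬ (A.player x.1 = Player.P ∧ root (s ++ [x]) s.length = k)) :
    A.core k (s ++ [x]) = A.core k s ++
      [(x.1, x.2.bind fun j => (A.coreAt k s (s.length - 1)).idxOf? j)] := by
  have hl := List.length_pos_iff.2 h0
  have e : A.coreAt k (s ++ [x]) s.length = A.coreAt k s (s.length - 1) ++ [s.length] := by
    rw [coreAt, chain_some (n := s.length) (corePred_int (by simpa [playerAt] using hx) hl)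
      (by omega)]
    congr 1
    exact coreAt_of_prefix (List.prefix_append _ _) (by omega)
  unfold core
  rw [List.length_append, List.length_singleton, Nat.add_sub_cancel, e,
    sub_append_last _ _ _ (coreAt_lt (by omega)) hs]

/-- A P-move of the `k`-th thread produces the core up to its justifier, followed by it. -/
theorem core_snoc_ext {m : A.Move} {j : ℕ} (hs : Backward (s ++ [(m, some j)]))
    (hm : A.player m = Player.P) (hr : root (s ++ [(m, some j)]) s.length = k) :
    A.core k (s ++ [(m, some j)]) = A.core k (s.take (j + 1)) ++
      [(m, some ((A.core k (s.take (j + 1))).length - 1))] := by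
  have hj : j < s.length := hs s.length m j (by simp)
  have hpre : s <+: s ++ [(m, some j)] := List.prefix_append _ _
  have ht : s.take (j + 1) <+: s := List.take_prefix _ _
  have htl : (s.take (j + 1)).length = j + 1 := by
    rw [List.length_take]
    omega
  have ht0 : s.take (j + 1) ≠ [] := by
    intro h
    rw [h] at htl
    simp at htl
  have e : A.coreAt k (s ++ [(m, some j)]) s.length =
      A.coreAt k (s.take (j + 1)) j ++ [s.length] := by
    rw [coreAt, chain_some (n := s.length) (j := j)
      (by rw [corePred_ext (by simp [playerAt, hm]) hr]; simp [ptr]) hj]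
    congr 1
    exact coreAt_of_prefix (ht.trans hpre) (by omega)
  have hlt : ∀ i ∈ A.coreAt k (s.take (j + 1)) j, i < s.length := fun i hi => by
    have := mem_chain_le hi
    omega
  rw [core_length ht0]
  unfold core
  rw [List.length_append, List.length_singleton, Nat.add_sub_cancel, e,
    sub_append_last _ _ _ hlt hs, htl, Nat.add_sub_cancel]
  congr 1
  · refine sub_congr fun i hi => ?_
    have := mem_chain_le hi
    exact getElem?_of_prefix ht (by omega)
  · have := idxOf?_posAt (coreAt_sorted (A := A) (k := k) (s := s.take (j + 1)) j)
      (a := (A.coreAt k (s.take (j + 1)) j).length - 1)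
      (by have := coreAt_length_pos (A := A) (k := k) (s := s.take (j + 1)) j; omega)
    rw [posAt_coreAt_last] at this
    simp [this]

/-- Up to the start of the `k`-th thread nothing is hidden in the core. -/
theorem Legal.coreAt_le (hs : A.Legal s) (hk : k < s.length) {i : ℕ} (hi : i ≤ k)
    (hpk : ptr s k = none) : A.coreAt k s i = List.range (i + 1) := by
  induction i with
  | zero =>
    rw [coreAt, chain_stuck (n := 0)]
    · rfl
    · intro j _
      omega
  | succ i ih =>
    have hint : ¬ (A.playerAt s (i + 1) = some Player.P ∧ root s (i + 1) = k) := by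
      rintro ⟨h1, h2⟩
      have h3 := root_le s (i + 1)
      obtain rfl : k = i + 1 := by omega
      rw [hs.justified.playerAt_of_ptr_none hk hpk] at h1
      cases h1
    rw [coreAt, chain_some (n := i + 1) (corePred_int hint (by omega)) (by omega),
      Nat.add_sub_cancel]
    have := ih (by omega)
    rw [coreAt] at this
    rw [this, List.range_succ (n := i + 1)]

theorem Legal.range_prefix_coreAt (hs : A.Legal s) {n : ℕ} (hn : n < s.length) (hk : k ≤ n)
    (hpk : ptr s k = none) : List.range (k + 1) <+: A.coreAt k s n := by
  have hmem : k ∈ A.coreAt k s n := by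
    induction n using Nat.strong_induction_on with
    | _ n ih =>
      by_cases hkn : k = n
      · subst hkn
        exact self_mem_chain _ _
      · by_cases hext : A.playerAt s n = some Player.P ∧ root s n = k
        · rcases hp : ptr s n with _ | j
          · rw [hs.justified.playerAt_of_ptr_none hn hp] at hext
            cases hext.1
          · have hj := hs.backward.ptr_lt hp
            have hkj : k ≤ j := by
              have := root_le s j
              rw [← root_some hp hj, hext.2] at this
              exact this
            exact mem_chain_trans (mem_chain_of_some (self_mem_chain _ _)
              (by rw [corePred_ext hext.1 hext.2, hp]) hj) (ih j hj (by omega) hkj)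
        · exact mem_chain_trans (mem_chain_of_some (self_mem_chain _ _)
            (corePred_int hext (by omega)) (by omega)) (ih (n - 1) (by omega) (by omega) (by omega))
  rw [← hs.coreAt_le (by omega) le_rfl hpk]
  exact chain_prefix hmem

theorem Legal.posAt_coreAt (hs : A.Legal s) {n : ℕ} (hn : n < s.length) (hk : k ≤ n)
    (hpk : ptr s k = none) {i : ℕ} (hi : i ≤ k) :
    i < (A.coreAt k s n).length ∧ posAt (A.coreAt k s n) i = i := by
  obtain ⟨l, hl⟩ := hs.range_prefix_coreAt hn hk hpk
  rw [← hl]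
  refine ⟨by simp; omega, posAt_of_getElem? ?_⟩
  rw [List.getElem?_append_left (by simp; omega), List.getElem?_range (by omega)]

/-- The positions of the `k`-th thread in the core form the O-view of that thread. -/
theorem Legal.coreAt_filter (hs : A.Legal s) (hth : A.Legal (s.thread k)) {a : ℕ}
    (ha : a < (threadPos s k).length) :
    (A.coreAt k s (posAt (threadPos s k) a)).filter (fun i => root s i = k) =
      (chain (A.pred Player.O (s.thread k)) a).map (posAt (threadPos s k)) := by
  induction a using Nat.strong_induction_on with
  | _ a ih =>
    set n := posAt (threadPos s k) a with hn
    obtain ⟨hns, hnr⟩ := mem_threadPos.1 (posAt_mem ha)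
    rw [← hn] at hns hnr
    have hpt := playerAt_thread (A := A) ha
    rw [← hn] at hpt
    rcases playerAt_isSome (A := A) hns with h | h
    · rw [h] at hpt
      by_cases ha0 : a = 0
      · have hT : threadPos s k ≠ [] := by
          intro h
          rw [h] at ha
          simp at ha
        obtain ⟨h1, h2, h3, h4⟩ := threadPos_head hs.backward hT
        rw [ha0] at hn
        rw [h4] at hn
        rw [ha0, hn, hs.coreAt_le h1 le_rfl h2, List.range_succ, List.filter_append,
          List.filter_eq_nil_iff.2, chain_stuck (n := 0)]
        · simp [h3, h4]
        · intro j _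
          omega
        · intro i hi
          have h5 := root_le s i
          have h6 := List.mem_range.1 hi
          simp only [decide_eq_true_eq]
          omega
      · set n₂ := posAt (threadPos s k) (a - 1) with hn₂
        have hlt : n₂ < n := posAt_lt_posAt (threadPos_sorted s k) (by omega) ha
        have hmid : ∀ i, n₂ ≤ i → i < n →
            (A.coreAt k s i).filter (fun i => root s i = k) =
              (A.coreAt k s n₂).filter (fun i => root s i = k) := by
          intro i h1 h2
          induction i, h1 using Nat.le_induction with
          | base => rfl
          | succ i h1 ihi =>
            have hri : root s (i + 1) ≠ k := by
              intro hr
              obtain ⟨b, hb, e⟩ := exists_posAt_of_mem (mem_threadPos.2 ⟨by omega, hr⟩)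
              have h3 := lt_of_posAt_lt (threadPos_sorted s k) (a := a - 1) (by omega) hb
                (by omega)
              have h4 := lt_of_posAt_lt (threadPos_sorted s k) hb ha (by omega)
              omega
            rw [coreAt, chain_some (n := i + 1) (corePred_int (fun h => hri h.2) (by omega))
              (by omega), Nat.add_sub_cancel, List.filter_append, ← ihi (by omega)]
            simp [hri, coreAt]
        rw [coreAt, chain_some (corePred_O h (by omega)) (by omega), List.filter_append]
        have h5 := hmid (n - 1) (by omega) (by omega)
        rw [coreAt] at h5
        rw [h5, ih (a - 1) (by omega) (by omega), chain_some (n := a) (j := a - 1)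
          (by rw [pred, if_pos hpt, if_neg ha0]) (by omega)]
        simp [hnr, ← hn]
    · rw [h] at hpt
      rcases hp : ptr s n with _ | j
      · rw [hs.justified.playerAt_of_ptr_none hns hp] at h
        cases h
      · have hj := hs.backward.ptr_lt hp
        obtain ⟨b, hb, e⟩ := exists_posAt_of_mem
          (threadPos_closed hs.backward (mem_threadPos.2 ⟨hns, hnr⟩) hp)
        have hpb : ptr (s.thread k) a = some b := by
          rw [thread_ptr ha, ← hn, hp, Option.bind_some, ← e,
            idxOf?_posAt (threadPos_sorted s k) hb]
        have hba := hth.backward.ptr_lt hpb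
        rw [coreAt, chain_some (by rw [corePred_ext h hnr, hp]) hj, List.filter_append]
        have h5 := ih b hba hb
        rw [coreAt, e] at h5
        rw [h5, chain_some (n := a) (j := b) (by rw [pred, hpt]; simpa using hpb) hba]
        simp [hnr, ← hn]

/-- The O-view of the `k`-th thread is determined by the core. -/
theorem Legal.view_thread_eq (hs : A.Legal s) (hth : A.Legal (s.thread k)) {n : ℕ}
    (hn : s.length = n + 1) (hr : root s n = k) :
    A.view Player.O (s.thread k) = (A.core k s).thread k := by
  obtain ⟨h1, h2⟩ := posAt_threadPos_last hn hr
  have h0 : s.thread k ≠ [] := by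
    rw [← List.length_pos_iff, thread_length]
    omega
  have hs0 : s ≠ [] := by
    rintro rfl
    simp at hn
  have hf := hs.coreAt_filter hth h1
  rw [h2] at hf
  have hkn : k ≤ n := hr ▸ root_le s n
  have hpk : ptr s k = none := hr ▸ hs.backward.ptr_root n
  obtain ⟨h3, h4⟩ := hs.posAt_coreAt (k := k) (n := n) (by omega) hkn hpk le_rfl
  have hK := coreAt_sorted (A := A) (k := k) (s := s) n
  have hKs : ∀ i ∈ A.coreAt k s n, i < s.length := coreAt_lt (by omega)
  rw [hth.justified.view_eq _ h0, viewAt, thread_eq s k, sub_sub s _ _ (threadPos_sorted s k)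
    (threadPos_lt s k), ← thread_eq s k, ← hf, thread_eq, core,
    show s.length - 1 = n by omega, sub_sub s _ _ hK hKs]
  · congr 1
    have hP : threadPos (s.sub (A.coreAt k s n)) k =
        (List.range (A.coreAt k s n).length).filter
          fun a => root s (posAt (A.coreAt k s n) a) = k := by
      unfold threadPos
      rw [sub_length _ _ hKs]
      refine List.filter_congr fun a ha => ?_
      obtain ⟨h5, h6⟩ := root_sub hs.backward hK hKs (hs.coreAt_closed (by omega))
        (List.mem_range.1 ha)
      rw [← h6]
      refine decide_eq_decide.2 ⟨fun h => by rw [h, h4], fun h => ?_⟩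
      exact posAt_inj hK h5 h3 (h.trans h4.symm)
    rw [hP]
    have hmap : (List.range (A.coreAt k s n).length).map (posAt (A.coreAt k s n)) =
        A.coreAt k s n := by
      refine List.ext_getElem? fun a => ?_
      by_cases ha : a < (A.coreAt k s n).length
      · rw [List.getElem?_map, List.getElem?_range ha, getElem?_posAt ha]
        rfl
      · rw [List.getElem?_eq_none (by simpa using ha), List.getElem?_eq_none (by simpa using ha)]
    conv_lhs => rw [← hmap]
    rw [List.filter_map]
    rfl
  · intro a ha
    have := (mem_threadPos.1 ha).1
    rwa [sub_length _ _ hKs] at this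
  · intro a ha
    have := mem_chain_le ha
    have h7 : (s.sub (threadPos s k)).length = _ := thread_length s k
    omega

end Arena

/-! ### Runs -/

namespace Arena
variable {A : Arena.{u}} {k : ℕ}

/-- Interleavings with equal cores end with moves of the same participant, and their last threads
have the same place relative to the `k`-th one. Of a thread that starts after position `k` the
starting position may differ, as some positions are hidden from the core. -/
theorem core_eq_last {u w : JSeq A.Move} (hu : A.Legal u) (hw : A.Legal w) {n n' : ℕ}
    (hn : u.length = n + 1) (hn' : w.length = n' + 1) (hk : k ≤ n) (hk' : k ≤ n')
    (hpk : ptr u k = none) (hpk' : ptr w k = none) (h : A.core k u = A.core k w) :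
    A.playerAt u n = A.playerAt w n' ∧ (root u n = k → root w n' = k) ∧
      (root u n < k → root w n' = root u n) ∧ (k < root u n → k < root w n') := by
  have hu0 : u ≠ [] := by
    rintro rfl
    simp at hn
  have hw0 : w ≠ [] := by
    rintro rfl
    simp at hn'
  have e : u.length - 1 = n := by omega
  have e' : w.length - 1 = n' := by omega
  have hl := core_length (k := k) hu0
  have hl' := core_length (k := k) hw0
  rw [e] at hl
  rw [e'] at hl'
  have hK := coreAt_sorted (A := A) (k := k) (s := u) n
  have hK' := coreAt_sorted (A := A) (k := k) (s := w) n'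
  have hKs : ∀ i ∈ A.coreAt k u n, i < u.length := coreAt_lt (by omega)
  have hKs' : ∀ i ∈ A.coreAt k w n', i < w.length := coreAt_lt (by omega)
  have hpos := coreAt_length_pos (A := A) (k := k) (s := u) n
  have hpos' := coreAt_length_pos (A := A) (k := k) (s := w) n'
  have hleneq : (A.coreAt k u n).length = (A.coreAt k w n').length := by rw [← hl, h, hl']
  set a := (A.coreAt k u n).length - 1 with ha
  have hua : posAt (A.coreAt k u n) a = n := posAt_coreAt_last n
  have hwa : posAt (A.coreAt k w n') a = n' := by
    rw [ha, hleneq]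
    exact posAt_coreAt_last n'
  have hr : u.sub (A.coreAt k u n) = w.sub (A.coreAt k w n') := by
    unfold core at h
    rwa [e, e'] at h
  obtain ⟨h1, h2⟩ := root_sub hu.backward hK hKs (hu.coreAt_closed (by omega)) (a := a) (by omega)
  obtain ⟨h3, h4⟩ := root_sub hw.backward hK' hKs' (hw.coreAt_closed (by omega)) (a := a) (by omega)
  rw [hua] at h2
  rw [hwa, ← hr] at h4
  rw [← hr] at h3
  set q := root (u.sub (A.coreAt k u n)) a with hq
  have g := fun {i : ℕ} (hi : i ≤ k) => hu.posAt_coreAt (k := k) (n := n) (by omega) hk hpk hi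
  have g' := fun {i : ℕ} (hi : i ≤ k) => hw.posAt_coreAt (k := k) (n := n') (by omega) hk' hpk' hi
  refine ⟨?_, ?_, ?_, ?_⟩
  · have p1 := playerAt_sub hKs (a := a) (by omega)
    have p2 := playerAt_sub hKs' (a := a) (by omega)
    rw [hua] at p1
    rw [hwa] at p2
    rw [← p1, hr, p2]
  · intro hrk
    have : q = k := posAt_inj hK h1 (g le_rfl).1 (by rw [h2, hrk, (g le_rfl).2])
    rw [← h4, this, (g' le_rfl).2]
  · intro hrk
    have : q = root u n := posAt_inj hK h1 (g hrk.le).1 (by rw [h2, (g hrk.le).2])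
    rw [← h4, this, (g' hrk.le).2]
  · intro hrk
    have : k < q := lt_of_posAt_lt hK (g le_rfl).1 h1 (by rw [(g le_rfl).2, h2]; exact hrk)
    have := posAt_lt_posAt hK' this h3
    rwa [(g' le_rfl).2, h4] at this

end Arena

namespace Game
variable {A : Game.{u}}

/-- The interleavings `w` in which the test `α` plays as Opponent and, in every thread `i ≠ k`,
the strategy `ρ i` plays as Player; nothing is required of Player in the `k`-th thread. -/
structure Run (α : Strategy (A.arrow sigmaGame)) (ρ : ℕ → Strategy A) (k : ℕ)
    (w : JSeq A.Move) : Prop where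
  interleaved : A.Interleaved w
  test_mem : ∀ v, v <+: w → ¬ Even v.length → qplay v ∈ α.carrier
  thread_mem : ∀ i ≠ k, ∀ v, v <+: w.thread i → Even v.length → v ∈ (ρ i).carrier

variable {α : Strategy (A.arrow sigmaGame)} {ρ : ℕ → Strategy A} {k : ℕ}

theorem Run.of_prefix {v w : JSeq A.Move} (hw : A.Run α ρ k w) (h : v <+: w) :
    A.Run α ρ k v :=
  ⟨hw.interleaved.of_prefix h, fun r hr => hw.test_mem r (hr.trans h),
    fun i hi r hr => hw.thread_mem i hi r
      (hr.trans (thread_prefix hw.interleaved.legal.backward h i))⟩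

theorem Run.legal {w : JSeq A.Move} (hw : A.Run α ρ k w) : A.Legal w := hw.interleaved.legal

theorem Run.legal_thread {w : JSeq A.Move} (hw : A.Run α ρ k w) (i : ℕ) :
    A.Legal (w.thread i) := A.legal _ (hw.interleaved.thread_mem i)

/-- Extending a run by an Opponent move of the test. -/
theorem Run.snoc_O {w : JSeq A.Move} {c : A.Move × Option ℕ} (hw : A.Run α ρ k w)
    (hev : Even w.length) (hc : qplay (w ++ [c]) ∈ α.carrier) : A.Run α ρ k (w ++ [c]) := by
  have hI := qplay_mem_iff.1 (α.subset_plays hc)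
  refine ⟨hI, fun v hv ho => ?_, fun i hi v hv he => ?_⟩
  · rcases List.prefix_concat_iff.1 hv with rfl | hv
    · exact hc
    · exact hw.test_mem v hv ho
  · by_cases hr : root (w ++ [c]) w.length = i
    · have hL := A.legal _ (hI.thread_mem i)
      rw [thread_snoc_self hI.legal.backward hr] at hv hL
      rcases List.prefix_concat_iff.1 hv with rfl | hv
      · rw [List.length_append, List.length_singleton, Nat.even_add_one] at he
        exact absurd (hL.player_snoc_O_iff.1 (hI.legal.player_snoc_O_iff.2 hev)) he
      · exact hw.thread_mem i hi v hv he
    · rw [thread_snoc_other hr] at hv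
      exact hw.thread_mem i hi v hv he

/-- Extending a run by a Player move. -/
theorem Run.snoc_P {w : JSeq A.Move} {c : A.Move × Option ℕ} (hw : A.Run α ρ k w)
    (hodd : ¬ Even w.length) (hI : A.Interleaved (w ++ [c]))
    (hc : root (w ++ [c]) w.length ≠ k → (w ++ [c]).thread (root (w ++ [c]) w.length) ∈
      (ρ (root (w ++ [c]) w.length)).carrier) : A.Run α ρ k (w ++ [c]) := by
  refine ⟨hI, fun v hv ho => ?_, fun i hi v hv he => ?_⟩
  · rcases List.prefix_concat_iff.1 hv with rfl | hv
    · rw [List.length_append, List.length_singleton, Nat.even_add_one] at ho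
      exact absurd hodd ho
    · exact hw.test_mem v hv ho
  · by_cases hr : root (w ++ [c]) w.length = i
    · subst hr
      exact (ρ _).mem_of_prefix (hc hi) hv he
    · rw [thread_snoc_other hr] at hv
      exact hw.thread_mem i hi v hv he

theorem exists_snoc {M : Type*} {l : List M} (h : l ≠ []) : ∃ l' x, l = l' ++ [x] := by
  rcases l.eq_nil_or_concat with rfl | ⟨l', x, rfl⟩
  · exact absurd rfl h
  · exact ⟨l', x, by simp⟩

/-- The test answers two interleavings with the same O-view alike. -/
theorem Run.exists_O (hα : α.Innocent) {u w : JSeq A.Move} {b : A.Move × Option ℕ}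
    (hu : A.Run α ρ k (u ++ [b])) (hw : A.Run α ρ k w) (hu0 : u ≠ []) (hw0 : w ≠ [])
    (huev : Even u.length) (hwev : Even w.length)
    (hv : A.view Player.O u = A.view Player.O w) :
    ∃ c, A.Run α ρ k (w ++ [c]) ∧ A.view Player.O (u ++ [b]) = A.view Player.O (w ++ [c]) := by
  obtain ⟨w', x, rfl⟩ := exists_snoc hw0
  obtain ⟨u', y, rfl⟩ := exists_snoc hu0
  have hwodd : ¬ Even w'.length := by simpa [Nat.even_add_one] using hwev
  have h1 := hu.test_mem _ List.prefix_rfl (by simpa [Nat.even_add_one] using huev)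
  have h2 := hw.test_mem w' (List.prefix_append _ _) hwodd
  have h3 := qplay_mem_iff.2 hw.interleaved
  have e : ∀ (w : JSeq (A.arrow sigmaGame).Move) (a b : (A.arrow sigmaGame).Move × Option ℕ),
      w ++ [a, b] = (w ++ [a]) ++ [b] := fun _ _ _ => by simp
  have huL := (hu.of_prefix (List.prefix_append _ _)).legal
  obtain ⟨c, h4, h5⟩ := hα (qplay u') (qplay w') (liftEntry y) (liftEntry x) (liftEntry b)
    (by rw [e, ← qplay_snoc, ← qplay_snoc]; exact h1) h2 (by rw [← qplay_snoc]; exact h3)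
    (by rw [← qplay_snoc, ← qplay_snoc, Arena.view_qplay_P huL, Arena.view_qplay_P hw.legal, hv])
  rw [e, ← qplay_snoc] at h4
  rw [e, e, ← qplay_snoc, ← qplay_snoc, ← qplay_snoc, Arena.view_qplay_P hu.legal] at h5
  rcases arrow_plays_cases (α.subset_plays h4) with h | ⟨l, hl⟩ | ⟨l, hl⟩
  · simp at h
  · rcases l.eq_nil_or_concat with rfl | ⟨l, z, rfl⟩
    · have := congrArg List.length hl
      simp at this
    · rw [List.concat_eq_append, qplay_snoc l z] at hl
      obtain ⟨h6, h7⟩ := List.append_inj' hl rfl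
      obtain rfl := qplay_injective h6
      obtain rfl : c = liftEntry z := by simpa using h7
      rw [← qplay_snoc] at h4 h5
      have h8 := hw.snoc_O hwev h4
      refine ⟨z, h8, ?_⟩
      rw [Arena.view_qplay_P h8.legal] at h5
      exact qplay_injective h5
  · exfalso
    obtain ⟨h6, h7⟩ := List.append_inj' hl rfl
    obtain rfl : c = (.inr .a, some 0) := by simpa using h7
    have h8 : qplay (w' ++ [x]) ++ [(.inr .a, some 0)] = qaplay (w' ++ [x]) := rfl
    rw [h8, view_qaplay hw.legal] at h5
    obtain ⟨v, p, h9⟩ := hu.legal.justified.view_last Player.O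
    rw [h9, qplay_snoc] at h5
    have := (List.append_inj' h5 rfl).2
    simp [liftEntry] at this

/-- Opponent's next move in a run is determined. -/
theorem Run.unique_O {w : JSeq A.Move} {c c' : A.Move × Option ℕ}
    (hc : A.Run α ρ k (w ++ [c])) (hc' : A.Run α ρ k (w ++ [c'])) (hev : Even w.length) :
    c = c' := by
  have h1 := hc.test_mem _ List.prefix_rfl (by simpa [Nat.even_add_one] using hev)
  have h2 := hc'.test_mem _ List.prefix_rfl (by simpa [Nat.even_add_one] using hev)
  rw [qplay_snoc] at h1 h2
  obtain ⟨s, a, h3⟩ := exists_snoc (qplay_ne_nil w)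
  rw [h3] at h1 h2
  exact liftEntry_injective (α.deterministic s a _ _ (by simpa using h1) (by simpa using h2))

/-- A P-move stays in the thread of the preceding O-move. -/
theorem Run.root_P {w : JSeq A.Move} {c : A.Move × Option ℕ} (hc : A.Run α ρ k (w ++ [c]))
    (hodd : ¬ Even w.length) : root (w ++ [c]) w.length = root w (w.length - 1) := by
  have hP := (hc.legal.playerAt_eq_P_iff (i := w.length) (by simp)).2 hodd
  have h0 : w.length ≠ 0 := fun h => hodd (by simp [h])
  rw [hc.legal.root_switch hP, root_snoc _ _ _ (by omega)]

/-- Outside the `k`-th thread, Player's next move in a run is determined. -/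
theorem Run.unique_P {w : JSeq A.Move} {c c' : A.Move × Option ℕ}
    (hc : A.Run α ρ k (w ++ [c])) (hc' : A.Run α ρ k (w ++ [c'])) (hodd : ¬ Even w.length)
    (hr : root w (w.length - 1) ≠ k) : c = c' := by
  set y := root w (w.length - 1) with hy
  have h0 : w.length ≠ 0 := fun h => hodd (by simp [h])
  have hl := Arena.posAt_threadPos_last (n := w.length - 1) (by omega) hy.symm
  have key : ∀ {c : A.Move × Option ℕ}, A.Run α ρ k (w ++ [c]) →
      w.thread y ++ [(c.1, c.2.bind fun j => (threadPos w y).idxOf? j)] ∈ (ρ y).carrier ∧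
      ∀ j, c.2 = some j → j ∈ threadPos w y := by
    intro c hc
    have h1 := hc.root_P hodd
    rw [← hy] at h1
    have hL := hc.legal_thread y
    have h2 := hc.thread_mem y hr _ List.prefix_rfl
    have hP : A.player c.1 = Player.P := hc.legal.player_snoc_P_iff.2 hodd
    rw [thread_snoc_self hc.legal.backward h1] at h2 hL
    refine ⟨h2 ?_, fun j hj => ?_⟩
    · simpa [Nat.even_add_one] using hL.player_snoc_P_iff.1 hP
    · have hjw : j < w.length := hc.legal.backward w.length c.1 j (by simp [← hj])
      rw [mem_threadPos]
      refine ⟨hjw, ?_⟩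
      rw [← h1, root_some (j := j) (by simp [ptr, hj]) hjw, root_snoc _ _ _ hjw]
  obtain ⟨h1, h2⟩ := key hc
  obtain ⟨h3, h4⟩ := key hc'
  obtain ⟨s, a, h5⟩ := exists_snoc (l := w.thread y) (by
    rw [← List.length_pos_iff, thread_length]
    omega)
  rw [h5] at h1 h3
  have h6 := (ρ y).deterministic s a _ _ (by simpa using h1) (by simpa using h3)
  simp only [Prod.mk.injEq] at h6
  exact Prod.ext h6.1 (bind_idxOf?_injOn h2 h4 h6.2)

/-- One step of a run that is not a P-move of the `k`-th thread is determined by the core. A thread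
starting after position `k` may be numbered differently in the two runs, so all these threads have
to be played by the same strategy. -/
theorem Run.exists_step (hα : α.Innocent) (hρ : ∀ i, (ρ i).Innocent)
    (hρk : ∀ i j, k < i → k < j → ρ i = ρ j) {u w : JSeq A.Move} {b : A.Move × Option ℕ}
    (hu : A.Run α ρ k (u ++ [b])) (hw : A.Run α ρ k w) (hku : k < u.length)
    (hkw : k < w.length) (hpu : ptr u k = none) (hpw : ptr w k = none)
    (hcore : A.core k u = A.core k w)
    (hb : ¬ (A.player b.1 = Player.P ∧ root (u ++ [b]) u.length = k)) :
    ∃ c, A.Run α ρ k (w ++ [c]) ∧ A.core k (u ++ [b]) = A.core k (w ++ [c]) := by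
  have huR := hu.of_prefix (List.prefix_append u [b])
  have hu0 : u ≠ [] := List.length_pos_iff.1 (by omega)
  have hw0 : w ≠ [] := List.length_pos_iff.1 (by omega)
  obtain ⟨n, hn⟩ := Nat.exists_eq_succ_of_ne_zero (show u.length ≠ 0 by omega)
  obtain ⟨n', hn'⟩ := Nat.exists_eq_succ_of_ne_zero (show w.length ≠ 0 by omega)
  rw [Nat.succ_eq_add_one] at hn hn'
  have en : u.length - 1 = n := by omega
  have en' : w.length - 1 = n' := by omega
  obtain ⟨hpl, hrk, hrlt, hrgt⟩ := Arena.core_eq_last huR.legal hw.legal hn hn' (by omega)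
    (by omega) hpu hpw hcore
  obtain ⟨-, hrk', -, -⟩ := Arena.core_eq_last hw.legal huR.legal hn' hn (by omega)
    (by omega) hpw hpu hcore.symm
  have hparity : Even u.length ↔ Even w.length := by
    have h1 := huR.legal.playerAt_eq_O_iff (i := n) (by omega)
    have h2 := hw.legal.playerAt_eq_O_iff (i := n') (by omega)
    rw [hpl, h2] at h1
    rw [hn, hn', Nat.even_add_one, Nat.even_add_one, h1]
  have hK := Arena.coreAt_sorted (A := A.toArena) (k := k) (s := u) n
  have hK' := Arena.coreAt_sorted (A := A.toArena) (k := k) (s := w) n'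
  have hlen := Arena.core_length (k := k) hu0
  have hlen' := Arena.core_length (k := k) hw0
  rw [en] at hlen
  rw [en', ← hcore] at hlen'
  have hpos := Arena.coreAt_length_pos (A := A.toArena) (k := k) (s := u) n
  have hC : ∀ X, ∀ c ∈ chain (A.pred X (A.core k u)) ((A.core k u).length - 1),
      c < (A.core k u).length := fun X c hc => by
    have := mem_chain_le hc
    omega
  have main : ∀ (X : Player) (c : A.Move × Option ℕ), A.Legal (w ++ [c]) → A.player b.1 = X →
      chain (A.pred X u) n = (chain (A.pred X (A.core k u)) ((A.core k u).length - 1)).map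
        (posAt (A.coreAt k u n)) →
      chain (A.pred X w) n' = (chain (A.pred X (A.core k u)) ((A.core k u).length - 1)).map
        (posAt (A.coreAt k w n')) → b.1 = c.1 →
      (b.2.bind fun j => (chain (A.pred X u) n).idxOf? j) =
        (c.2.bind fun j => (chain (A.pred X w) n').idxOf? j) →
      ¬ (A.player c.1 = Player.P ∧ root (w ++ [c]) w.length = k) →
      A.core k (u ++ [b]) = A.core k (w ++ [c]) := by
    intro X c hcL hX h1 h2 h3 h4 h5
    rw [Arena.core_snoc_int hu.legal.backward hu0 hb, Arena.core_snoc_int hcL.backward hw0 h5,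
      hcore, h3, en, en']
    have hcX : A.player c.1 = X := h3 ▸ hX
    have hbv : ∀ j, b.2 = some j → j ∈ chain (A.pred X u) n := by
      intro j hj
      have := hu.legal.visible u.length b.1 j (by simp [← hj])
      rwa [hX, A.viewPos_snoc _ _ _ _ le_rfl, hn,
        huR.legal.justified.viewPos_succ X (by omega)] at this
    have hcv : ∀ j, c.2 = some j → j ∈ chain (A.pred X w) n' := by
      intro j hj
      have := hcL.visible w.length c.1 j (by simp [← hj])
      rwa [hcX, A.viewPos_snoc _ _ _ _ le_rfl, hn',
        hw.legal.justified.viewPos_succ X (by omega)] at this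
    congr 3
    rcases hb2 : b.2 with _ | j <;> rcases hc2 : c.2 with _ | j'
    · rfl
    · obtain ⟨i, hi⟩ := idxOf?_isSome (hcv j' hc2)
      simp [hb2, hc2, hi] at h4
    · obtain ⟨i, hi⟩ := idxOf?_isSome (hbv j hb2)
      simp [hb2, hc2, hi] at h4
    · rw [hb2, hc2, Option.bind_some, Option.bind_some, h1, h2] at h4
      exact idxOf?_transfer hK hK' (fun c hc => hlen ▸ hC X c hc)
        (fun c hc => hlen' ▸ hC X c hc) (h1 ▸ hbv j hb2) (h2 ▸ hcv j' hc2) h4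
  by_cases hev : Even u.length
  · have hwev := hparity.1 hev
    have hbO : A.player b.1 = Player.O := hu.legal.player_snoc_O_iff.2 hev
    obtain ⟨c, hc, hv⟩ := hu.exists_O hα hw hu0 hw0 hev hwev (by
      rw [huR.legal.view_core_O (k := k) hu0, hw.legal.view_core_O (k := k) hw0, hcore])
    have hcO : A.player c.1 = Player.O := hc.legal.player_snoc_O_iff.2 hwev
    refine ⟨c, hc, ?_⟩
    rw [Arena.view_snoc_own hu.legal.backward hbO, Arena.view_snoc_own hc.legal.backward hcO] at hv
    have h1 := (List.append_inj' hv rfl).2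
    simp only [List.cons.injEq, Prod.mk.injEq, and_true] at h1
    rw [hn, hn', huR.legal.justified.viewPos_succ Player.O (by omega),
      hw.legal.justified.viewPos_succ Player.O (by omega)] at h1
    refine main Player.O c hc.legal hbO (huR.legal.chain_core_O hn) ?_ h1.1 h1.2 ?_
    · have := hw.legal.chain_core_O (k := k) hn'
      rwa [← hcore] at this
    · rw [hcO]
      simp
  · have hwodd := mt hparity.2 hev
    have hbP : A.player b.1 = Player.P := hu.legal.player_snoc_P_iff.2 hev
    have hrb := hu.root_P hev
    rw [en] at hrb
    set y := root u n with hy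
    set y' := root w n' with hy'
    have hyk : y ≠ k := fun h => hb ⟨hbP, by rw [hrb, h]⟩
    have hyk' : y' ≠ k := fun h => hyk (hrk' h)
    have hρy : ρ y = ρ y' := by
      rcases Nat.lt_or_gt_of_ne hyk with h | h
      · rw [hrlt h]
      · exact hρk _ _ h (hrgt h)
    obtain ⟨l1, l2⟩ := Arena.posAt_threadPos_last hn hy.symm
    obtain ⟨l1', l2'⟩ := Arena.posAt_threadPos_last hn' hy'.symm
    obtain ⟨θ, a, hθ⟩ := exists_snoc (l := u.thread y) (by
      rw [← List.length_pos_iff, thread_length]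
      omega)
    obtain ⟨θ', a', hθ'⟩ := exists_snoc (l := w.thread y') (by
      rw [← List.length_pos_iff, thread_length]
      omega)
    have hθL := huR.legal_thread y
    have hθL' := hw.legal_thread y'
    have hnO : A.playerAt u n = some Player.O := by
      rw [huR.legal.playerAt_eq_O_iff (by omega)]
      rwa [hn, Nat.even_add_one, not_not] at hev
    have hnO' : A.playerAt w n' = some Player.O := hpl ▸ hnO
    have h1 := hu.thread_mem y hyk _ List.prefix_rfl
    have h1L := hu.legal_thread y
    rw [thread_snoc_self hu.legal.backward hrb] at h1 h1L
    have h2 := h1 (by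
      simpa [Nat.even_add_one] using h1L.player_snoc_P_iff.1 hbP)
    have hθL2 : A.Legal (θ' ++ [a']) := hθ' ▸ hθL'
    have haO' : Even θ'.length := by
      rw [← l2', ← Arena.playerAt_thread l1', hθ'] at hnO'
      rw [List.length_append, List.length_singleton, Nat.add_sub_cancel] at hnO'
      rwa [Arena.playerAt_last, Option.some.injEq, hθL2.player_snoc_O_iff] at hnO'
    have h3 : θ' ∈ (ρ y').carrier :=
      hw.thread_mem y' hyk' θ' (hθ' ▸ List.prefix_append _ _) haO'
    have e : ∀ (w : JSeq A.Move) (a b : A.Move × Option ℕ),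
      w ++ [a, b] = (w ++ [a]) ++ [b] := fun _ _ _ => by simp
    have hv : A.view Player.P (u.thread y) = A.view Player.P (w.thread y') := by
      rw [hθL.justified.view_eq _ (by rw [hθ]; simp),
        hθL'.justified.view_eq _ (by rw [hθ']; simp), ← huR.legal.viewAt_thread l1,
        ← hw.legal.viewAt_thread l1', l2, l2', huR.legal.viewAt_core_P hn hyk,
        hw.legal.viewAt_core_P hn' hyk', hcore]
    obtain ⟨d, h4, h5⟩ := hρ y θ θ' a a' _ (by rw [e, ← hθ]; exact h2) (hρy ▸ h3)
      (by rw [← hθ']; exact hw.interleaved.thread_mem y') (by rw [← hθ, ← hθ', hv])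
    rw [e, ← hθ'] at h4
    rw [e θ, e θ', ← hθ, ← hθ'] at h5
    have h4p := (ρ y).subset_plays h4
    have hdP : A.player d.1 = Player.P := by
      rw [(A.legal _ h4p).player_snoc_P_iff, hθ', List.length_append, List.length_singleton,
        Nat.even_add_one, not_not]
      exact haO'
    obtain ⟨j, i, hd2, hj, hi, -, hI, hroot, hthr⟩ :=
      hw.interleaved.extend hn' hnO' h4p hdP
    refine ⟨(d.1, some j), hw.snoc_P hwodd hI fun _ => ?_, ?_⟩
    · rw [hroot, hthr, ← hy', ← hρy]
      exact h4
    · rw [Arena.view_snoc_own h1L.backward hbP,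
        Arena.view_snoc_own (A.legal _ h4p).backward hdP] at h5
      have h6 := (List.append_inj' h5 rfl).2
      simp only [List.cons.injEq, Prod.mk.injEq, and_true] at h6
      have hl0 : (u.thread y).length - 1 + 1 = (u.thread y).length := by
        rw [hθ]
        simp
      have hl0' : (w.thread y').length - 1 + 1 = (w.thread y').length := by
        rw [hθ']
        simp
      rw [← hl0, ← hl0', hθL.justified.viewPos_succ _ (by omega),
        hθL'.justified.viewPos_succ _ (by omega), hd2] at h6
      have hcu := huR.legal.chain_thread l1
      have hcw := hw.legal.chain_thread l1'
      rw [l2] at hcu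
      rw [l2'] at hcw
      refine main Player.P _ hI.legal hbP (huR.legal.chain_core_P hn hyk) ?_ h6.1 ?_ ?_
      · have := hw.legal.chain_core_P (k := k) hn' hyk'
        rwa [← hcore] at this
      · obtain ⟨jb, hjb⟩ : ∃ jb, b.2 = some jb := by
          rcases hb2 : b.2 with _ | jb
          · have := A.initial_opponent _ (hu.legal.justified.1 u.length b.1 (by simp [← hb2]))
            rw [hbP] at this
            cases this
          · exact ⟨jb, rfl⟩
        have hjbl : jb < u.length := hu.legal.backward u.length b.1 jb (by simp [← hjb])
        have hjbm : jb ∈ threadPos u y := by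
          rw [mem_threadPos]
          refine ⟨hjbl, ?_⟩
          rw [← hrb, root_some (j := jb) (by simp [ptr, hjb]) hjbl, root_snoc _ _ _ hjbl]
        obtain ⟨f, hf, rfl⟩ := exists_posAt_of_mem hjbm
        have h7 := h6.2
        rw [hjb, Option.bind_some, idxOf?_posAt (threadPos_sorted u y) hf, Option.bind_some,
          Option.bind_some] at h7
        rw [hjb, Option.bind_some, Option.bind_some, hcu, hcw, hj,
          idxOf?_map fun c hc e => posAt_inj (threadPos_sorted u y) (by
            have := mem_chain_le hc
            omega) hf e,
          idxOf?_map fun c hc e => posAt_inj (threadPos_sorted w y') (by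
            have := mem_chain_le hc
            omega) hi e]
        exact h7
      · rw [hroot]
        exact fun h => hyk' h.2

end Game

/-! ### Runs are determined by O-views of a thread -/

namespace JSeq
variable {M : Type u}

theorem threadPos_prefix {s t : JSeq M} (h : s <+: t) (i : ℕ) :
    threadPos s i <+: threadPos t i := by
  have e : threadPos s i = (List.range s.length).filter fun n => root t n = i :=
    List.filter_congr fun n hn => by rw [root_of_prefix h (List.mem_range.1 hn)]
  rw [e]
  refine List.IsPrefix.filter _ ?_
  rw [show t.length = s.length + (t.length - s.length) by have := h.length_le; omega,
    List.range_add]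
  exact List.prefix_append _ _

theorem posAt_of_prefix {K K' : List ℕ} (h : K <+: K') {a : ℕ} (ha : a < K.length) :
    posAt K' a = posAt K a := by
  apply posAt_of_getElem?
  obtain ⟨l, rfl⟩ := h
  rw [List.getElem?_append_left ha, getElem?_posAt ha]

/-- Between two prefixes with the same `i`-th thread there are no occurrences of this thread. -/
theorem root_ne_of_thread_eq {s t : JSeq M} (h : s <+: t) {i n : ℕ}
    (he : s.thread i = t.thread i) (hn : s.length ≤ n) (hn' : n < t.length) :
    root t n ≠ i := by
  intro hr
  have hl := congrArg List.length he
  rw [thread_length, thread_length] at hl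
  have hm := mem_threadPos.2 ⟨hn', hr⟩
  rw [← (threadPos_prefix h i).eq_of_length hl] at hm
  exact absurd (mem_threadPos.1 hm).1 (by omega)

/-- Each non-empty prefix of a thread is the thread of a prefix that ends in this thread. -/
theorem exists_prefix_thread_eq {u : JSeq M} (hu : Backward u) {k : ℕ} {s : JSeq M}
    (hs : s <+: u.thread k) (h0 : s ≠ []) :
    ∃ (v : JSeq M) (n : ℕ), v <+: u ∧ v.length = n + 1 ∧ root v n = k ∧ v.thread k = s := by
  have hl : s.length ≤ (threadPos u k).length := thread_length u k ▸ hs.length_le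
  have h0' := List.length_pos_iff.2 h0
  set a := s.length - 1 with ha
  have haT : a < (threadPos u k).length := by omega
  obtain ⟨hp, hr⟩ := mem_threadPos.1 (posAt_mem haT)
  set p := posAt (threadPos u k) a with hpdef
  have hv : u.take (p + 1) <+: u := List.take_prefix _ _
  have hvl : (u.take (p + 1)).length = p + 1 := by
    rw [List.length_take]
    omega
  have hrv : root (u.take (p + 1)) p = k := by
    rw [← hr, root_of_prefix hv (by omega)]
  refine ⟨u.take (p + 1), p, hv, hvl, hrv, ?_⟩
  refine (List.prefix_of_prefix_length_le (thread_prefix hu hv k) hs ?_).eq_of_length ?_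
  all_goals
    rw [thread_length]
    have hT := threadPos_prefix hv k
    have hsorted := threadPos_sorted u k
    obtain ⟨b, hb, hbp⟩ := exists_posAt_of_mem (mem_threadPos.2
      ⟨show p < (u.take (p + 1)).length by omega, hrv⟩)
    have hTl := hT.length_le
    rw [← posAt_of_prefix hT hb, hpdef] at hbp
    have hba := posAt_inj hsorted (by omega) haT hbp
    have : ¬ b + 1 < (threadPos (u.take (p + 1)) k).length := by
      intro h
      have h1 := (mem_threadPos.1 (posAt_mem h)).1
      rw [← posAt_of_prefix hT h, hvl] at h1
      have := posAt_lt_posAt hsorted (Nat.lt_add_one b)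
        (show b + 1 < (threadPos u k).length by omega)
      omega
    omega

theorem eq_of_thread_length_one {u : JSeq M} (hu : Backward u) {k n : ℕ}
    (hn : u.length = n + 1) (hr : root u n = k) (h1 : (u.thread k).length = 1) : n = k := by
  have hm := mem_threadPos.2 ⟨show n < u.length by omega, hr⟩
  have h2 := (threadPos_head hu (List.ne_nil_of_mem hm)).2.2.2
  obtain ⟨b, hb, rfl⟩ := exists_posAt_of_mem hm
  rw [thread_length] at h1
  obtain rfl : b = 0 := by omega
  exact h2

end JSeq

namespace Game
variable {A : Game.{u}} {α : Strategy (A.arrow sigmaGame)} {ρ : ℕ → Strategy A} {k : ℕ}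

/-- Runs with equal cores have equal cores after a further move, unless it is a P-move of the
`k`-th thread. -/
theorem Run.core_snoc_eq (hα : α.Innocent) (hρ : ∀ i, (ρ i).Innocent)
    (hρk : ∀ i j, k < i → k < j → ρ i = ρ j) {u w : JSeq A.Move} {b c : A.Move × Option ℕ}
    (hu : A.Run α ρ k (u ++ [b])) (hw : A.Run α ρ k (w ++ [c])) (hku : k < u.length)
    (hkw : k < w.length) (hpu : ptr u k = none) (hpw : ptr w k = none)
    (hcore : A.core k u = A.core k w)
    (hb : ¬ (A.player b.1 = Player.P ∧ root (u ++ [b]) u.length = k)) :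
    A.core k (u ++ [b]) = A.core k (w ++ [c]) := by
  have hwR := hw.of_prefix (List.prefix_append w [c])
  have huR := hu.of_prefix (List.prefix_append u [b])
  obtain ⟨c', h1, h2⟩ := Run.exists_step hα hρ hρk hu hwR hku hkw hpu hpw hcore hb
  have hcc : c' = c := by
    by_cases hev : Even w.length
    · exact h1.unique_O hw hev
    · refine h1.unique_P hw hev fun hr => hb ?_
      obtain ⟨n, hn⟩ := Nat.exists_eq_succ_of_ne_zero (show u.length ≠ 0 by omega)
      obtain ⟨n', hn'⟩ := Nat.exists_eq_succ_of_ne_zero (show w.length ≠ 0 by omega)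
      rw [Nat.succ_eq_add_one] at hn hn'
      obtain ⟨hpl, hrk, -, -⟩ := Arena.core_eq_last hwR.legal huR.legal hn' hn (by omega)
        (by omega) hpw hpu hcore.symm
      have hu_odd : ¬ Even u.length := by
        rw [hn', Nat.even_add_one, not_not, ← hwR.legal.playerAt_eq_O_iff (by omega), hpl,
          huR.legal.playerAt_eq_O_iff (by omega)] at hev
        rwa [hn, Nat.even_add_one, not_not]
      refine ⟨hu.legal.player_snoc_P_iff.2 hu_odd, ?_⟩
      rw [hu.root_P hu_odd, show u.length - 1 = n by omega]
      exact hrk (by rwa [show w.length - 1 = n' by omega] at hr)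
  rw [h2, hcc]

/-- From equal cores, two runs proceed alike until Opponent returns to the `k`-th thread: `l` and
`l'` are the stretches up to and including the next move of this thread. -/
theorem Run.core_append_eq (hα : α.Innocent) (hρ : ∀ i, (ρ i).Innocent)
    (hρk : ∀ i j, k < i → k < j → ρ i = ρ j) (l l' : JSeq A.Move) {u w : JSeq A.Move}
    (hl : l ≠ []) (hl' : l' ≠ [])
    (hu : A.Run α ρ k (u ++ l)) (hw : A.Run α ρ k (w ++ l')) (hku : k < u.length)
    (hkw : k < w.length) (hpu : ptr u k = none) (hpw : ptr w k = none)
    (hcore : A.core k u = A.core k w)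
    (hru : ∀ i, u.length ≤ i → i < (u ++ l).length →
      (root (u ++ l) i = k ↔ i + 1 = (u ++ l).length))
    (hrw : ∀ i, w.length ≤ i → i < (w ++ l').length →
      (root (w ++ l') i = k ↔ i + 1 = (w ++ l').length))
    (hO : ¬ Even (u ++ l).length) :
    A.core k (u ++ l) = A.core k (w ++ l') := by
  induction l generalizing l' u w with
  | nil => exact absurd rfl hl
  | cons b l ih =>
    rcases l' with _ | ⟨c, l'⟩
    · exact absurd rfl hl'
    · have e : ∀ (u l : JSeq A.Move) (b : A.Move × Option ℕ), u ++ b :: l = (u ++ [b]) ++ l :=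
        fun _ _ _ => by simp
      rw [e] at hu hru hO
      rw [e] at hw hrw
      rw [e u, e w]
      have hub : u ++ [b] <+: (u ++ [b]) ++ l := List.prefix_append _ _
      have hwc : w ++ [c] <+: (w ++ [c]) ++ l' := List.prefix_append _ _
      have hu1 := hu.of_prefix hub
      have hw1 := hw.of_prefix hwc
      have gu := hru u.length le_rfl (by simp)
      have gw := hrw w.length le_rfl (by simp)
      rw [root_of_prefix hub (by simp)] at gu
      rw [root_of_prefix hwc (by simp)] at gw
      have hb : ¬ (A.player b.1 = Player.P ∧ root (u ++ [b]) u.length = k) := by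
        rintro ⟨h1, h2⟩
        rw [← gu.1 h2] at hO
        have := hu1.legal.player_snoc_P_iff.1 h1
        rw [Nat.even_add_one] at hO
        exact hO this
      have hc1 := Run.core_snoc_eq hα hρ hρk hu1 hw1 hku hkw hpu hpw hcore hb
      have hpu' : ptr (u ++ [b]) k = none := by
        rw [ptr_of_prefix (List.prefix_append _ _) hku, hpu]
      have hpw' : ptr (w ++ [c]) k = none := by
        rw [ptr_of_prefix (List.prefix_append _ _) hkw, hpw]
      have g1 := (Arena.core_eq_last hu1.legal hw1.legal (n := u.length) (n' := w.length)
        (by simp) (by simp) hku.le hkw.le hpu' hpw' hc1).2.1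
      have g2 := (Arena.core_eq_last hw1.legal hu1.legal (n := w.length) (n' := u.length)
        (by simp) (by simp) hkw.le hku.le hpw' hpu' hc1.symm).2.1
      rcases l with _ | ⟨d, l⟩
      · rcases l' with _ | ⟨d', l'⟩
        · simpa using hc1
        · have := gw.1 (g1 (gu.2 (by simp)))
          simp at this
      · rcases l' with _ | ⟨d', l'⟩
        · have := gu.1 (g2 (gw.2 (by simp)))
          simp at this
        · refine ih (d' :: l') (by simp) (by simp) hu hw (by simp; omega) (by simp; omega)
            hpu' hpw' hc1 (fun i hi => hru i ?_) (fun i hi => hrw i ?_) hO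
          · rw [List.length_append] at hi
            omega
          · rw [List.length_append] at hi
            omega

/-- Opponent's next move in the `k`-th thread is determined by the core at the preceding P-move
of this thread. -/
theorem Run.core_eq_of_thread_snoc (hα : α.Innocent) (hρ : ∀ i, (ρ i).Innocent)
    (hρk : ∀ i j, k < i → k < j → ρ i = ρ j) {u w u₁ w₁ : JSeq A.Move}
    {x y : A.Move × Option ℕ} (hu : A.Run α ρ k u) (hw : A.Run α ρ k w) (hu₁ : u₁ <+: u)
    (hw₁ : w₁ <+: w) (hku : k < u₁.length) (hkw : k < w₁.length) (hpu : ptr u₁ k = none)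
    (hpw : ptr w₁ k = none) (hcore : A.core k u₁ = A.core k w₁) {n n' : ℕ}
    (hn : u.length = n + 1) (hn' : w.length = n' + 1) (hr : root u n = k) (hr' : root w n' = k)
    (hx : u.thread k = u₁.thread k ++ [x]) (hy : w.thread k = w₁.thread k ++ [y])
    (hxO : A.player x.1 = Player.O) : A.core k u = A.core k w := by
  -- only the last move after `u₁` belongs to the `k`-th thread
  have key : ∀ {u u₁ : JSeq A.Move} {x : A.Move × Option ℕ} {n : ℕ}, A.Run α ρ k u → u₁ <+: u →
      u.length = n + 1 → root u n = k → u.thread k = u₁.thread k ++ [x] →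
      ∃ l, l ≠ [] ∧ u = u₁ ++ l ∧ ∀ i, u₁.length ≤ i → i < (u₁ ++ l).length →
        (root (u₁ ++ l) i = k ↔ i + 1 = (u₁ ++ l).length) := by
    intro u u₁ x n hu hu₁ hn hr hx
    obtain ⟨l, rfl⟩ := hu₁
    have hl : l ≠ [] := by
      rintro rfl
      have := congrArg List.length hx
      simp at this
    refine ⟨l, hl, rfl, fun i hi hi' => ⟨fun h => ?_, fun h => ?_⟩⟩
    · obtain ⟨l', z, rfl⟩ := exists_snoc hl
      rw [← List.append_assoc] at *
      have hlen : (u₁ ++ l').length = n := by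
        rw [List.length_append, List.length_singleton] at hn
        omega
      rw [thread_snoc_self hu.legal.backward (by rw [hlen, hr])] at hx
      by_contra hne
      refine root_ne_of_thread_eq (List.prefix_append u₁ l') (List.append_inj' hx rfl).1.symm hi
        (?_ : i < _) (i := k) ?_
      · rw [List.length_append, List.length_singleton] at hi' hne
        omega
      · rw [← root_of_prefix (List.prefix_append (u₁ ++ l') [z]) ?_, h]
        rw [List.length_append, List.length_singleton] at hi' hne
        omega
    · rw [show i = n by omega, hr]
  obtain ⟨l, hl, rfl, h1⟩ := key hu hu₁ hn hr hx
  obtain ⟨l', hl', rfl, h2⟩ := key hw hw₁ hn' hr' hy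
  refine Run.core_append_eq hα hρ hρk l l' hl hl' hu hw hku hkw hpu hpw hcore h1 h2 ?_
  obtain ⟨h3, h4⟩ := Arena.posAt_threadPos_last hn hr
  have h5 := Arena.playerAt_thread (A := A.toArena) h3
  rw [h4, hx, List.length_append, List.length_singleton, Nat.add_sub_cancel, Arena.playerAt_last,
    hxO] at h5
  rw [hn, Nat.even_add_one, not_not]
  exact (hu.legal.playerAt_eq_O_iff (by omega)).1 h5.symm

/-- Just after a move in the `k`-th thread, the core of a run is determined by the O-view of this
thread: every other participant sees the environment only through this O-view. -/
theorem Run.core_eq_of_view_eq (hα : α.Innocent) (hρ : ∀ i, (ρ i).Innocent)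
    (hρk : ∀ i j, k < i → k < j → ρ i = ρ j) {u₀ : JSeq A.Move} (hu₀ : u₀.length = k + 1)
    (hp₀ : ptr u₀ k = none) {u w : JSeq A.Move} (hu : A.Run α ρ k u) (hw : A.Run α ρ k w)
    (hu₀u : u₀ <+: u) (hu₀w : u₀ <+: w) {n n' : ℕ}
    (hn : u.length = n + 1) (hn' : w.length = n' + 1) (hr : root u n = k) (hr' : root w n' = k)
    (hv : A.view Player.O (u.thread k) = A.view Player.O (w.thread k)) :
    A.core k u = A.core k w := by
  induction n using Nat.strong_induction_on generalizing u w n' with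
  | _ n ih =>
  have hpre : ∀ {u v : JSeq A.Move}, v <+: u → u₀ <+: u → k < v.length →
      u₀ <+: v ∧ ptr v k = none := by
    intro u v h h' hl
    have := List.prefix_of_prefix_length_le h' h (by omega)
    exact ⟨this, by rw [ptr_of_prefix this (by omega), hp₀]⟩
  obtain ⟨u', x, rfl⟩ := exists_snoc (l := u) (by rintro rfl; simp at hn)
  obtain ⟨w', y, rfl⟩ := exists_snoc (l := w) (by rintro rfl; simp at hn')
  obtain rfl : u'.length = n := by simpa using hn
  obtain rfl : w'.length = n' := by simpa using hn'
  have hθL := hu.legal_thread k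
  have hθL' := hw.legal_thread k
  have hθ := thread_snoc_self hu.legal.backward hr
  have hθ' := thread_snoc_self hw.legal.backward hr'
  have hplayer : A.player x.1 = A.player y.1 := by
    rw [hθ] at hθL hv
    rw [hθ'] at hθL' hv
    obtain ⟨v, p, h1⟩ := hθL.justified.view_last Player.O
    obtain ⟨v', p', h2⟩ := hθL'.justified.view_last Player.O
    rw [h1, h2] at hv
    have := (List.append_inj' hv rfl).2
    simp only [List.cons.injEq, Prod.mk.injEq, and_true] at this
    rw [this.1]
  rcases hx : A.player x.1 with _ | _
  · -- an O-move: the O-views of the thread before it agree as well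
    have hy : A.player y.1 = Player.O := hplayer ▸ hx
    rw [hθ] at hθL hv
    rw [hθ'] at hθL' hv
    rw [Arena.view_snoc_own hθL.backward hx, Arena.view_snoc_own hθL'.backward hy] at hv
    have hv1 := (List.append_inj' hv rfl).1
    by_cases h0 : thread u' k = []
    · have h0' : thread w' k = [] := by
        by_contra h
        rw [h0, Arena.view_nil] at hv1
        exact hθL'.init.justified.view_ne_nil h _ hv1.symm
      have h1 := eq_of_thread_length_one hu.legal.backward hn hr (by rw [hθ, h0]; rfl)
      have h2 := eq_of_thread_length_one hw.legal.backward hn' hr' (by rw [hθ', h0']; rfl)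
      rw [← hu₀u.eq_of_length (by omega), ← hu₀w.eq_of_length (by omega)]
    · have h0' : thread w' k ≠ [] := by
        intro h
        rw [h, Arena.view_nil] at hv1
        exact hθL.init.justified.view_ne_nil h0 _ hv1
      obtain ⟨u₁, n₁, h1, h2, h3, h4⟩ := exists_prefix_thread_eq
        (hu.of_prefix (List.prefix_append _ _)).legal.backward List.prefix_rfl h0
      obtain ⟨w₁, n₂, h1', h2', h3', h4'⟩ := exists_prefix_thread_eq
        (hw.of_prefix (List.prefix_append _ _)).legal.backward List.prefix_rfl h0'
      have hk1 : k ≤ n₁ := h3 ▸ root_le u₁ n₁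
      have hk2 : k ≤ n₂ := h3' ▸ root_le w₁ n₂
      have hu1 := h1.trans (List.prefix_append u' [x])
      have hw1 := h1'.trans (List.prefix_append w' [y])
      have p1 := hpre hu1 hu₀u (by omega)
      have p2 := hpre hw1 hu₀w (by omega)
      have hlt := h1.length_le
      refine Run.core_eq_of_thread_snoc hα hρ hρk
        (x := (x.1, x.2.bind fun j => (threadPos u' k).idxOf? j)) hu hw hu1 hw1 (by omega)
        (by omega) p1.2 p2.2
        (ih n₁ (by omega) (hu.of_prefix hu1) (hw.of_prefix hw1) p1.1 p2.1 h2 h2' h3 h3'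
          (by rw [h4, h4', hv1])) hn hn' hr hr' (by rw [h4, hθ]) (by rw [h4', hθ']) hx
  · -- a P-move: the O-views of the thread at its justifier agree
    have hy : A.player y.1 = Player.P := hplayer ▸ hx
    have key : ∀ {u' : JSeq A.Move} {x : A.Move × Option ℕ}, A.Run α ρ k (u' ++ [x]) →
        u₀ <+: u' ++ [x] → root (u' ++ [x]) u'.length = k → A.player x.1 = Player.P →
        ∃ j, x = (x.1, some j) ∧ j < u'.length ∧ A.Run α ρ k (u'.take (j + 1)) ∧
          u₀ <+: u'.take (j + 1) ∧ (u'.take (j + 1)).length = j + 1 ∧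
          root (u'.take (j + 1)) j = k ∧ ∃ q,
          A.view Player.O ((u' ++ [x]).thread k) =
            A.view Player.O (thread (u'.take (j + 1)) k) ++ [(x.1, q)] := by
      intro u' x hu hu₀u hr hx
      obtain ⟨m, _ | j⟩ := x
      · have := A.initial_opponent _ (hu.legal.justified.1 u'.length m (by simp))
        rw [hx] at this
        cases this
      · have hju : j < u'.length := hu.legal.backward u'.length m j (by simp)
        have hrj : root u' j = k := by
          rw [← hr, root_some (j := j) (by simp [ptr]) hju, root_snoc _ _ _ hju]
        have hpre1 : u'.take (j + 1) <+: u' := List.take_prefix _ _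
        have hlen : (u'.take (j + 1)).length = j + 1 := by
          rw [List.length_take]
          omega
        have hpre2 := hpre1.trans (List.prefix_append u' [(m, some j)])
        have hrj' : root (u'.take (j + 1)) j = k := by
          rw [← root_of_prefix hpre1 (by omega), hrj]
        have hkj := hrj ▸ root_le u' j
        have hR := hu.of_prefix hpre2
        refine ⟨j, rfl, hju, hR, (hpre hpre2 hu₀u (by omega)).1, hlen, hrj', ?_⟩
        obtain ⟨l1, l2⟩ := Arena.posAt_threadPos_last hlen hrj'
        have hTp := threadPos_prefix hpre1 k
        have hidx : (threadPos u' k).idxOf? j =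
            some ((thread (u'.take (j + 1)) k).length - 1) := by
          have := idxOf?_posAt (threadPos_sorted u' k) (l1.trans_le hTp.length_le)
          rwa [posAt_of_prefix hTp l1, l2] at this
        have hL := hu.legal_thread k
        rw [thread_snoc_self hu.legal.backward hr, Option.bind_some, hidx] at hL ⊢
        rw [Arena.view_snoc_other hL.justified (by rw [hx]; simp)]
        have h0 : thread (u'.take (j + 1)) k ≠ [] := by
          rw [← List.length_pos_iff, thread_length]
          omega
        rw [(hR.legal_thread k).justified.view_eq _ h0, Arena.viewAt_of_prefix
          (thread_prefix (hu.of_prefix (List.prefix_append _ _)).legal.backward hpre1 k) _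
          (l1.trans_eq (thread_length _ _).symm)]
        exact ⟨_, rfl⟩
    obtain ⟨j, e, h1, h2, h3, h4, h5, q, h6⟩ := key hu hu₀u hr hx
    obtain ⟨j', e', h1', h2', h3', h4', h5', q', h6'⟩ := key hw hu₀w hr' hy
    rw [h6, h6'] at hv
    obtain ⟨hv1, hv2⟩ := List.append_inj' hv rfl
    simp only [List.cons.injEq, Prod.mk.injEq, and_true] at hv2
    have hc := ih j h1 h2 h2' h3 h3' h4 h4' h5 h5' hv1
    rw [e] at hu hr ⊢
    rw [e'] at hw hr' ⊢
    rw [Arena.core_snoc_ext hu.legal.backward hx hr, Arena.core_snoc_ext hw.legal.backward hy hr',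
      hc, hv2.1]

/-- Each thread of a run of innocent participants is O-innocent. -/
theorem Run.oInnocent_thread (hα : α.Innocent) (hρ : ∀ i, (ρ i).Innocent)
    (hρk : ∀ i j, k < i → k < j → ρ i = ρ j) {u : JSeq A.Move} (hu : A.Run α ρ k u) :
    A.OInnocent (u.thread k) := by
  intro s₁ s₂ x₁ x₂ h₁ h₂ hO₁ hO₂ hv
  have hb := hu.legal.backward
  have hL := hu.legal_thread k
  by_cases h0 : s₁ = []
  · have h0' : s₂ = [] := by
      by_contra h
      rw [h0, Arena.view_nil] at hv
      exact (hL.of_prefix h₂).init.justified.view_ne_nil h _ hv.symm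
    subst h0 h0'
    rw [(List.prefix_of_prefix_length_le h₁ h₂ (by simp)).eq_of_length (by simp)]
  · have h0' : s₂ ≠ [] := by
      intro h
      rw [h, Arena.view_nil] at hv
      exact (hL.of_prefix h₁).init.justified.view_ne_nil h0 _ hv
    obtain ⟨u₁, n₁, a1, a2, a3, a4⟩ := exists_prefix_thread_eq hb h₁ (by simp)
    obtain ⟨u₂, n₂, b1, b2, b3, b4⟩ := exists_prefix_thread_eq hb h₂ (by simp)
    have hu₁ := hu.of_prefix a1
    have hu₂ := hu.of_prefix b1
    obtain ⟨v₁, m₁, c1, c2, c3, c4⟩ := exists_prefix_thread_eq hu₁.legal.backward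
      (a4 ▸ List.prefix_append s₁ [x₁]) h0
    obtain ⟨v₂, m₂, d1, d2, d3, d4⟩ := exists_prefix_thread_eq hu₂.legal.backward
      (b4 ▸ List.prefix_append s₂ [x₂]) h0'
    have hk1 : k ≤ m₁ := c3 ▸ root_le v₁ m₁
    have hk2 : k ≤ m₂ := d3 ▸ root_le v₂ m₂
    have hp : ptr v₁ k = none := c3 ▸ (hu₁.of_prefix c1).legal.backward.ptr_root m₁
    have hp' : ptr v₂ k = none := d3 ▸ (hu₂.of_prefix d1).legal.backward.ptr_root m₂
    have hpre : v₁.take (k + 1) <+: v₁ := List.take_prefix _ _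
    have hlen : (v₁.take (k + 1)).length = k + 1 := by
      rw [List.length_take]
      omega
    have hpre2 : v₁.take (k + 1) <+: v₂ := List.prefix_of_prefix_length_le
      ((hpre.trans c1).trans a1) (d1.trans b1) (by omega)
    have hc := Run.core_eq_of_view_eq hα hρ hρk hlen
      (by rw [← ptr_of_prefix hpre (by omega), hp]) (hu₁.of_prefix c1) (hu₂.of_prefix d1)
      hpre hpre2 c2 d2 c3 d3 (by rw [c4, d4, hv])
    have hc2 := Run.core_eq_of_thread_snoc hα hρ hρk hu₁ hu₂ c1 d1 (by omega) (by omega) hp hp'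
      hc a2 b2 a3 b3 (by rw [a4, c4]) (by rw [b4, d4]) hO₁
    rw [← a4, ← b4, hu₁.legal.view_thread_eq (hu₁.legal_thread k) a2 a3,
      hu₂.legal.view_thread_eq (hu₂.legal_thread k) b2 b3, hc2]

end Game

/-! ### Replacing threads one by one -/

namespace Arena
variable {A : Arena.{u}}

/-- If all O-views of `t` occur in `s`, then `t` starts with the same move as `s`. -/
theorem prefix_singleton_of_ovw_subset {s t : JSeq A.Move} {y : A.Move × Option ℕ}
    (hs : A.Legal s) (ht : A.Legal t) (hy : [y] <+: t) (h : A.ovw t ⊆ A.ovw s) : [y] <+: s := by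
  have hyL : A.Legal ([] ++ [y]) := ht.of_prefix hy
  obtain ⟨s', x, h1, h2, h3⟩ := exists_of_mem_ovw hs hyL (h ⟨_, hy, rfl⟩)
  have hyO : A.player y.1 = Player.O := hyL.player_snoc_O_iff.2 (by simp)
  have hxL := hs.of_prefix h1
  have h4 := h3
  rw [view_snoc_own hyL.backward hyO, view_snoc_own hxL.backward (h2.trans hyO), view_nil] at h4
  have h5 := (List.append_inj' h4 rfl).1
  obtain rfl : s' = [] := by
    by_contra hne
    exact hxL.init.justified.view_ne_nil hne _ h5.symm
  obtain rfl := eq_of_view_eq hyL hxL hyO (h2.trans hyO) h3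
  exact h1

end Arena

namespace Game
variable {A : Game.{u}} {α : Strategy (A.arrow sigmaGame)} {ρ : ℕ → Strategy A} {k : ℕ}

/-- The play `t` can replace the `k`-th thread of a run `u` if all its O-views occur in this
thread: the other participants then cannot tell the difference. -/
theorem Run.exists_follow (hans : A.AnswersTerminal) (hα : α.Innocent)
    (hρ : ∀ i, (ρ i).Innocent) (hρk : ∀ i j, k < i → k < j → ρ i = ρ j) {u u₀ t : JSeq A.Move}
    (hu : A.Run α ρ k u) (hu₀u : u₀ <+: u) (hu₀ : u₀.length = k + 1) (hp₀ : ptr u₀ k = none)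
    (htp : t ∈ A.plays) (htev : Even t.length) (htc : A.Complete t)
    (hts : A.ovw t ⊆ A.ovw (u.thread k)) {v w : JSeq A.Move} (hv : v <+: u)
    (hw : A.Run α ρ k w) (hu₀v : u₀ <+: v) (hu₀w : u₀ <+: w)
    (hcore : A.core k v = A.core k w) (hwt : w.thread k <+: t) :
    ∃ w', A.Run α ρ k w' ∧ u₀ <+: w' ∧ A.core k u = A.core k w' ∧ w'.thread k <+: t := by
  -- either the `k`-th thread grows, or it stays the same and the copied prefix `v` of `u` grows
  generalize hd : t.length - (w.thread k).length = d
  induction d using Nat.strong_induction_on generalizing v w with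
  | _ d ihd =>
  generalize he : u.length - v.length = e
  induction e using Nat.strong_induction_on generalizing v w with
  | _ e ihe =>
  have hsL := hu.legal_thread k
  have htL := A.legal _ htp
  obtain ⟨l, rfl⟩ := id hv
  rcases l with _ | ⟨b, l⟩
  · exact ⟨w, hw, hu₀w, by rwa [List.append_nil], hwt⟩
  have hvb : v ++ [b] <+: v ++ b :: l := ⟨l, by simp⟩
  have hvbR := hu.of_prefix hvb
  have hvR := hu.of_prefix hv
  have hkv : k < v.length := by
    have := hu₀v.length_le
    omega
  have hkw : k < w.length := by
    have := hu₀w.length_le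
    omega
  have hpv : ptr v k = none := by rw [ptr_of_prefix hu₀v (by omega), hp₀]
  have hpw : ptr w k = none := by rw [ptr_of_prefix hu₀w (by omega), hp₀]
  have hwk0 : w.thread k ≠ [] := by
    rw [← List.length_pos_iff, thread_length]
    exact List.length_pos_of_mem (mem_threadPos.2 ⟨hkw, root_none hpw⟩)
  have htd := hwt.length_le
  by_cases hb : A.player b.1 = Player.P ∧ root (v ++ [b]) v.length = k
  · -- a P-move of the `k`-th thread: play the next move of `t` instead
    obtain ⟨hbP, hbr⟩ := hb
    have hvodd := hvbR.legal.player_snoc_P_iff.1 hbP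
    obtain ⟨n, hn⟩ := Nat.exists_eq_succ_of_ne_zero (show v.length ≠ 0 by omega)
    obtain ⟨n', hn'⟩ := Nat.exists_eq_succ_of_ne_zero (show w.length ≠ 0 by omega)
    rw [Nat.succ_eq_add_one] at hn hn'
    obtain ⟨hpl, hrk, -, -⟩ := Arena.core_eq_last hvR.legal hw.legal hn hn' (by omega) (by omega)
      hpv hpw hcore
    have hrv := hvbR.root_P hvodd
    rw [hbr, hn, Nat.add_sub_cancel] at hrv
    have hrw := hrk hrv.symm
    have hvO : A.playerAt v n = some Player.O := by
      rw [hvR.legal.playerAt_eq_O_iff (by omega)]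
      rwa [hn, Nat.even_add_one, not_not] at hvodd
    have hwO : A.playerAt w n' = some Player.O := hpl ▸ hvO
    have hwodd : ¬ Even w.length := by
      rw [hn', Nat.even_add_one, not_not]
      exact (hw.legal.playerAt_eq_O_iff (by omega)).1 hwO
    have hthodd : ¬ Even (w.thread k).length := by
      obtain ⟨l1, l2⟩ := Arena.posAt_threadPos_last hn' hrw
      have h1 := Arena.playerAt_thread (A := A.toArena) l1
      have hpos := List.length_pos_iff.2 hwk0
      rw [l2, hwO, (hw.legal_thread k).playerAt_eq_O_iff (by omega)] at h1
      rw [show (w.thread k).length = (w.thread k).length - 1 + 1 by omega, Nat.even_add_one,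
        not_not]
      exact h1
    obtain ⟨l', hl'⟩ := id hwt
    rcases l' with _ | ⟨c, l'⟩
    · rw [List.append_nil] at hl'
      rw [hl'] at hthodd
      exact absurd htev hthodd
    have hct : w.thread k ++ [c] <+: t := ⟨l', by rw [← hl']; simp⟩
    have hcL := htL.of_prefix hct
    have hcP : A.player c.1 = Player.P := hcL.player_snoc_P_iff.2 hthodd
    obtain ⟨j, -, -, -, -, -, hI, hroot, hthr⟩ := hw.interleaved.extend hn' hwO
      (c := c) (by rw [hrw]; exact A.mem_of_prefix htp hct) hcP
    rw [hrw] at hroot hthr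
    have hwd := hw.snoc_P hwodd hI fun h => absurd hroot h
    obtain ⟨t', ht', hvt'⟩ := hts ⟨_, hct, rfl⟩
    have ht'0 : t' ≠ [] := by
      rintro rfl
      rw [Arena.view_nil] at hvt'
      exact hcL.justified.view_ne_nil (by simp) _ hvt'
    obtain ⟨v', n₁, a1, a2, a3, a4⟩ := exists_prefix_thread_eq hu.legal.backward ht' ht'0
    have hkn : k ≤ n₁ := a3 ▸ root_le v' n₁
    have hu₀v' := List.prefix_of_prefix_length_le hu₀u a1 (by omega)
    have hu₀d := hu₀w.trans (List.prefix_append w [(c.1, some j)])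
    have hc := Run.core_eq_of_view_eq hα hρ hρk hu₀ hp₀ (hu.of_prefix a1) hwd hu₀v' hu₀d a2
      (n' := w.length) (by simp) a3 hroot (by rw [a4, hthr, hvt'])
    have hctl := hct.length_le
    rw [List.length_append, List.length_singleton] at hctl
    -- continue from the prefix of `u` that produces the same O-view of the `k`-th thread
    refine ihd _ ?_ a1 hwd hu₀v' hu₀d hc (hthr ▸ hct) rfl
    rw [hthr, List.length_append, List.length_singleton]
    omega
  · obtain ⟨c, hwc, hc⟩ := Run.exists_step hα hρ hρk hvbR hw hkv hkw hpv hpw hcore hb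
    have hu₀vb := hu₀v.trans (List.prefix_append v [b])
    have hu₀wc := hu₀w.trans (List.prefix_append w [c])
    by_cases hr : root (w ++ [c]) w.length = k
    · -- an O-move of the `k`-th thread, which is the next move of `t` by O-innocence
      obtain ⟨hpl, hrk, -, -⟩ := Arena.core_eq_last hwc.legal hvbR.legal (n := w.length)
        (n' := v.length) (by simp) (by simp) (k := k) (by omega) (by omega)
        (by rw [ptr_of_prefix hu₀wc (by omega), hp₀])
        (by rw [ptr_of_prefix hu₀vb (by omega), hp₀]) hc.symm
      have hrb := hrk hr
      rw [Arena.playerAt_last, Arena.playerAt_last, Option.some.injEq] at hpl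
      have hbO : A.player b.1 = Player.O := by
        rcases h : A.player b.1 with _ | _
        · rfl
        · exact absurd ⟨h, hrb⟩ hb
      have hth := thread_snoc_self hwc.legal.backward hr
      set y : A.Move × Option ℕ := (c.1, c.2.bind fun j => (threadPos w k).idxOf? j) with hy
      have hyL := hwc.legal_thread k
      have hyO : A.player y.1 = Player.O := hpl.trans hbO
      have hview : A.view Player.O (w.thread k ++ [y]) ∈
          A.ovw ((v ++ b :: l : JSeq A.Move).thread k) := by
        refine ⟨JSeq.thread (v ++ [b]) k, thread_prefix hu.legal.backward hvb k, ?_⟩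
        rw [← hth, hwc.legal.view_thread_eq hyL (n := w.length) (by simp) hr, ← hc,
          ← hvbR.legal.view_thread_eq (hvbR.legal_thread k) (n := v.length) (by simp) hrb]
      have hsingle := thread_singleThreaded hwc.legal.backward (i := k) (by rw [hth]; simp)
      rw [hth] at hyL hsingle
      obtain ⟨l', hl'⟩ := id hwt
      rcases l' with _ | ⟨y', l'⟩
      · -- `t` is complete, so it cannot be continued by an O-move
        rw [List.append_nil] at hl'
        rw [hl'] at hyL hsingle hwk0
        have h1 := (hsingle.of_prefix hyL.backward (List.prefix_append _ _) hwk0)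
        exact absurd (Arena.AnsweredBefore.ptr_snoc_eq_none hans
          (htc.answeredBefore_zero htL hwk0) h1 hyL) (hsingle.snoc_ne_none hyL.backward hwk0)
      have hyt : w.thread k ++ [y'] <+: t := ⟨l', by rw [← hl']; simp⟩
      have hyL' := htL.of_prefix hyt
      have hyO' : A.player y'.1 = Player.O :=
        hyL'.player_snoc_O_iff.2 (hyL.player_snoc_O_iff.1 hyO)
      have hyy : y = y' := Arena.eq_of_view_eq hyL hyL' hyO hyO'
        (Arena.OInnocent.view_eq hsL (Run.oInnocent_thread hα hρ hρk hu) hyL hyL' hyO hyO' hview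
          (hts ⟨_, hyt, rfl⟩) rfl)
      have hytl := hyt.length_le
      rw [List.length_append, List.length_singleton] at hytl
      refine ihd _ ?_ hvb hwc hu₀vb hu₀wc hc (by rw [hth, hyy]; exact hyt) rfl
      rw [hth, List.length_append, List.length_singleton]
      omega
    · have hth := thread_snoc_other (s := w) hr
      refine ihe _ ?_ hvb hwc hu₀vb hu₀wc hc (hth ▸ hwt) (hth ▸ hd) rfl
      simp only [List.length_append, List.length_cons, List.length_nil] at he ⊢
      omega

/-- Whether the test succeeds is determined by the O-view. -/
theorem Run.qaplay_mem (hα : α.Innocent) {u w : JSeq A.Move} (hu : qaplay u ∈ α.carrier)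
    (hw : A.Run α ρ k w) (hu0 : u ≠ []) (hw0 : w ≠ []) (hwev : Even w.length)
    (hv : A.view Player.O u = A.view Player.O w) : qaplay w ∈ α.carrier := by
  obtain ⟨hI, huev, -⟩ := qaplay_mem_iff.1 (α.subset_plays hu)
  obtain ⟨w', x, rfl⟩ := exists_snoc hw0
  obtain ⟨u', y, rfl⟩ := exists_snoc hu0
  have hwodd : ¬ Even w'.length := by simpa [Nat.even_add_one] using hwev
  have h2 := hw.test_mem w' (List.prefix_append _ _) hwodd
  have h3 := qplay_mem_iff.2 hw.interleaved
  have e : ∀ (w : JSeq (A.arrow sigmaGame).Move) (a b : (A.arrow sigmaGame).Move × Option ℕ),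
      w ++ [a, b] = (w ++ [a]) ++ [b] := fun _ _ _ => by simp
  obtain ⟨c, h4, h5⟩ := hα (qplay u') (qplay w') (liftEntry y) (liftEntry x) (.inr .a, some 0)
    (by rw [e, ← qplay_snoc]; exact hu) h2 (by rw [← qplay_snoc]; exact h3)
    (by rw [← qplay_snoc, ← qplay_snoc, Arena.view_qplay_P hI.legal,
      Arena.view_qplay_P hw.legal, hv])
  rw [e, ← qplay_snoc] at h4
  rw [e, e, ← qplay_snoc, ← qplay_snoc,
    show qplay (u' ++ [y]) ++ [(.inr .a, some 0)] = qaplay (u' ++ [y]) from rfl,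
    view_qaplay hI.legal] at h5
  rcases arrow_plays_cases (α.subset_plays h4) with h | ⟨l, hl⟩ | ⟨l, hl⟩
  · simp at h
  · exfalso
    have hlL := (qplay_mem_iff.1 (hl ▸ α.subset_plays h4)).legal
    rcases l.eq_nil_or_concat with rfl | ⟨l, z, rfl⟩
    · have := congrArg List.length hl
      simp at this
    · rw [hl, Arena.view_qplay_P hlL] at h5
      rw [List.concat_eq_append] at hlL h5
      obtain ⟨v, p, h9⟩ := hlL.justified.view_last Player.O
      rw [h9, qplay_snoc] at h5
      have := (List.append_inj' h5 rfl).2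
      simp [liftEntry] at this
  · have h6 : qplay l = qplay (w' ++ [x]) := (List.append_inj' hl rfl).1.symm
    obtain rfl := qplay_injective h6
    rwa [← hl]

variable {σ τ : Strategy A}

/-- In a successful interaction of a test with `σ` and `τ`, the thread that starts at position `k`
may be changed from `σ` to `τ`. Later threads, which already follow `τ`, may move to other
positions; earlier ones stay in place. -/
theorem exists_qaplay_replace (hans : A.AnswersTerminal) (hσ : σ.Innocent) (hτ : τ.Innocent)
    (h : LeOS σ.obs τ.obs) (hα : α.Innocent) (k : ℕ)
    (H : ∃ u, qaplay u ∈ α.carrier ∧ ∀ i, u.thread i ∈ (if i < k + 1 then σ else τ).carrier) :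
    ∃ w, qaplay w ∈ α.carrier ∧ ∀ i, w.thread i ∈ (if i < k then σ else τ).carrier := by
  obtain ⟨u, hu, hth⟩ := H
  obtain ⟨hI, huev, hcompl⟩ := qaplay_mem_iff.1 (α.subset_plays hu)
  by_cases h0 : u.thread k = []
  · refine ⟨u, hu, fun i => ?_⟩
    rcases eq_or_ne i k with rfl | hi
    · rw [h0]
      exact Strategy.nil_mem _
    · have := hth i
      rwa [if_congr (show i < k + 1 ↔ i < k by omega) rfl rfl] at this
  set ρ : ℕ → Strategy A := fun i => if i < k then σ else τ with hρdef
  have hρ : ∀ i, (ρ i).Innocent := fun i => by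
    simp only [hρdef]
    split_ifs
    · exact hσ
    · exact hτ
  have hρk : ∀ i j, k < i → k < j → ρ i = ρ j := fun i j hi hj => by
    simp only [hρdef]
    rw [if_neg (by omega), if_neg (by omega)]
  have huR : A.Run α ρ k u := by
    refine ⟨hI, fun v hv ho => ?_, fun i hi v hv he => ?_⟩
    · refine α.mem_of_prefix hu ?_ (by simpa [Nat.even_add_one] using ho)
      obtain ⟨l, rfl⟩ := hv
      exact ⟨l.map liftEntry ++ [(.inr .a, some 0)], by simp [qaplay, qplay]⟩
    · have := hth i
      rw [if_congr (show i < k + 1 ↔ i < k by omega) rfl rfl] at this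
      exact (ρ i).mem_of_prefix this hv he
  have hb := hI.legal.backward
  have hs : u.thread k ∈ σ.carrier := by
    have := hth k
    rwa [if_pos (by omega)] at this
  obtain ⟨T, ⟨t, htτ, htc, -, hts, rfl⟩, hsub⟩ := h _ ⟨u.thread k, hs, hcompl.thread hb k,
    Run.oInnocent_thread hα hρ hρk huR, thread_singleThreaded hb h0, rfl⟩
  have htp := τ.subset_plays htτ
  have hTk : threadPos u k ≠ [] := by
    rw [← List.length_pos_iff, ← thread_length]
    exact List.length_pos_iff.2 h0
  obtain ⟨hku, hpu, hrk, -⟩ := threadPos_head hb hTk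
  have hpre : u.take (k + 1) <+: u := List.take_prefix _ _
  have hlen : (u.take (k + 1)).length = k + 1 := by
    rw [List.length_take]
    omega
  have hp₀ : ptr (u.take (k + 1)) k = none := by rw [← ptr_of_prefix hpre (by omega), hpu]
  -- the `k`-th thread of `u` starts with the first move of `t`
  have hstart : JSeq.thread (u.take (k + 1)) k <+: t := by
    obtain ⟨y, t', ht'⟩ := List.exists_cons_of_ne_nil hts.ne_nil
    have hyt : [y] <+: t := ⟨t', by simp [ht']⟩
    have hys := Arena.prefix_singleton_of_ovw_subset (huR.legal_thread k) (A.legal _ htp) hyt hsub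
    have hl1 : (JSeq.thread (u.take (k + 1)) k).length = 1 := by
      rw [thread_length]
      have h1 := Arena.posAt_threadPos_last hlen (i := k) (root_none hp₀)
      have hT := List.ne_nil_of_mem (mem_threadPos.2
        ⟨show k < (u.take (k + 1)).length by omega, root_none hp₀⟩)
      have h2 := (threadPos_head (huR.of_prefix hpre).legal.backward hT).2.2.2
      have := posAt_inj (threadPos_sorted _ k) h1.1 (List.length_pos_iff.2 hT)
        (h1.2.trans h2.symm)
      rw [thread_length] at this
      have := List.length_pos_iff.2 hT
      omega
    have := List.prefix_of_prefix_length_le (thread_prefix hb hpre k) hys (by simp [hl1])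
    rwa [this.eq_of_length (by simp [hl1])]
  obtain ⟨w, hw, hpw, hcore, hwt⟩ := Run.exists_follow hans hα hρ hρk huR hpre hlen hp₀ htp
    (τ.even _ htτ) htc hsub hpre (huR.of_prefix hpre) List.prefix_rfl List.prefix_rfl rfl hstart
  have hkw : k < w.length := by
    have := hpw.length_le
    omega
  have hu0 : u ≠ [] := List.length_pos_iff.1 (by omega)
  have hw0 : w ≠ [] := List.length_pos_iff.1 (by omega)
  have hwev : Even w.length := by
    obtain ⟨n, hn⟩ := Nat.exists_eq_succ_of_ne_zero (show u.length ≠ 0 by omega)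
    obtain ⟨n', hn'⟩ := Nat.exists_eq_succ_of_ne_zero (show w.length ≠ 0 by omega)
    rw [Nat.succ_eq_add_one] at hn hn'
    have h1 := (Arena.core_eq_last huR.legal hw.legal hn hn' (by omega) (by omega) hpu
      (by rw [ptr_of_prefix hpw (by omega), hp₀]) hcore).1
    have h2 := huR.legal.playerAt_eq_P_iff (i := n) (by omega)
    rw [h1, hw.legal.playerAt_eq_P_iff (by omega)] at h2
    rw [hn, Nat.even_add_one] at huev
    rw [hn', Nat.even_add_one]
    exact h2.2 huev
  refine ⟨w, Run.qaplay_mem hα hu hw hu0 hw0 hwev ?_, fun i => ?_⟩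
  · rw [hI.legal.view_core_O (k := k) hu0, hw.legal.view_core_O (k := k) hw0, hcore]
  · have hev := hw.legal.even_thread hwev (hw.legal_thread i)
    rcases eq_or_ne i k with rfl | hi
    · rw [if_neg (lt_irrefl i)]
      exact τ.mem_of_prefix htτ hwt hev
    · exact hw.thread_mem i hi _ List.prefix_rfl hev

/-- The threads of a successful interaction with `σ` are replaced by plays of `τ` one by one, in
descending order of their starting positions. -/
theorem leIB_of_leOS (hans : A.AnswersTerminal) (hσ : σ.Innocent) (hτ : τ.Innocent)
    (h : LeOS σ.obs τ.obs) : σ.LeIB τ := by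
  intro α hα hcomp
  rw [comp_eq_sigmaTop_iff] at hcomp ⊢
  obtain ⟨l, hl, hth⟩ := hcomp
  have key : ∀ k, (∃ u, qaplay u ∈ α.carrier ∧
      ∀ i, u.thread i ∈ (if i < k then σ else τ).carrier) →
      ∃ u, qaplay u ∈ α.carrier ∧ ∀ i, u.thread i ∈ τ.carrier := by
    intro k
    induction k with
    | zero =>
      rintro ⟨u, hu, hi⟩
      exact ⟨u, hu, fun i => by simpa using hi i⟩
    | succ k ih => exact fun H => ih (exists_qaplay_replace hans hσ hτ h hα k H)
  refine key l.length ⟨l, hl, fun i => ?_⟩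
  split_ifs with hi
  · exact hth i
  · have : l.thread i = [] := by
      rw [← List.length_eq_zero_iff, thread_length, List.length_eq_zero_iff,
        List.eq_nil_iff_forall_not_mem]
      intro n hn
      obtain ⟨h1, h2⟩ := mem_threadPos.1 hn
      have := root_le l n
      omega
    rw [this]
    exact τ.nil_mem

end Game

theorem mainTheorem2 (A : Game.{u}) (hans : A.AnswersTerminal) (hview : A.OViewDetermined)
    (σ τ : Strategy A) (hσ : σ.Innocent) (hτ : τ.Innocent) :
    σ.LeIB τ ↔ LeOS σ.obs τ.obs := by
  exact ⟨Game.leOS_of_leIB hans hview, Game.leIB_of_leOS hans hσ hτ⟩
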